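/- Let $G$ be a compact Lie group with a bi-invariant Riemannian metric $g_{\mathrm{bi}}$, acting smoothly and isometrically on a complete (smooth, boundaryless) Riemannian manifold $(M,g_M)$. Let $M^{\mathrm{reg}}\subset M$ be the union of the principal orbits, i.e. of the orbits of maximum orbit type: $x\in M^{\mathrm{reg}}$ if and only if the isotropy group $G_x$ is conjugate in $G$ to a subgroup of $G_y$ for every $y\in M$. For $l>0$ let $g_l$ be the Cheeger deformation of $g_M$, i.e. the unique smooth Riemannian metric on $M$ for which $$q:(G\times M,\; l^2 g_{\mathrm{bi}}+g_M)\to (M,g_l),\qquad q(a,m)=am,$$ (the quotient map of the action $a\cdot(b,m)=(ba^{-1},am)$ of $G$ on $G\times M$) is a Riemannian submersion; such a metric exists. For $x\in M^{\mathrm{reg}}$ let $T_xG(x)$ be the tangent space of the orbit through $x$ and $T_xG(x)^\perp$ its orthogonal complement, and set $$\tilde g_l=\frac1{l^2}\,g_l|_{T_xG(x)}+g_l|_{T_xG(x)^\perp}.$$ Let $\mathcal U\subset M$ be a $G$-invariant open set whose closure in $M$ is compact and contained in $M^{\mathrm{reg}}$. Then the tensors $\tilde g_l$, $l>0$, are smooth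 on $\mathcal U$, and there is a smooth $G$-invariant Riemannian metric $\tilde g$ on $\mathcal U$ such that: 1. For every integer $p\ge 0$, $\tilde g_l|_{\mathcal U}\to\tilde g$ in $C^p$ as $l\to 0^+$; more precisely, there are $C$ and $l_0>0$ with $|\tilde g_l-\tilde g|_{C^p}\le C\,l^2$ for $0<l<l_0$. Here $|T|_{C^p}$ is the supremum over $\mathcal U$ of the partial derivatives of order at most $p$ of the components of $T$ with respect to finitely many smooth charts of $M$ and compact subsets of their domains that together cover $\overline{\mathcal U}$; the statement holds for each such choice, with $C$ and $l_0$ depending on it and on $p$. 2. The orbit space $\mathcal U/G$, with the quotient topology, is Hausdorff and second countable, and it carries the structure of a smooth manifold and a smooth Riemannian metric for which the projection $(\mathcal U,\tilde g)\to\mathcal U/G$ is a Riemannian submersion. The fibers of this submersion (the $G$-orbits in $\mathcal U$) are totally geodesic in $(\mathcal U,\tilde g)$, and they are normal homogeneous: for every $x\in\mathcal U$, the map $G\to G(x)$, $a\mapsto ax$, is a Riemannian submersion from $(G,g_{\mathrm{bi}})$ onto the fiber through $x$ with the metric induced by $\tilde g$. -/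

import Mathlib

open scoped Manifold ContDiff Topology ENNReal Bundle
open Set Filter TopologicalSpace

noncomputable section

/-- Scalar-valued functions of two tangent vectors at each point; metrics and `(0,2)`-tensors are
viewed as such functions. -/
abbrev FormField {E : Type*} [NormedAddCommGroup E] [NormedSpace ℝ E] {H : Type*}
    [TopologicalSpace H] (I : ModelWithCorners ℝ E H) (M : Type*) [TopologicalSpace M]
    [ChartedSpace H M] : Type _ :=
  ∀ x : M, TangentSpace I x → TangentSpace I x → ℝ

/-- Smooth Riemannian metrics on an `n`-manifold without boundary. -/
abbrev SmoothMetric (n : ℕ) (M : Type*) [TopologicalSpace M]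
    [ChartedSpace (EuclideanSpace ℝ (Fin n)) M] [IsManifold (𝓡 n) ∞ M] : Type _ :=
  Bundle.ContMDiffRiemannianMetric (𝓡 n) ∞ (EuclideanSpace ℝ (Fin n))
    (fun x : M => TangentSpace (𝓡 n) x)

/-- The form field underlying a Riemannian metric. -/
def SmoothMetric.form {n : ℕ} {M : Type*} [TopologicalSpace M]
    [ChartedSpace (EuclideanSpace ℝ (Fin n)) M] [IsManifold (𝓡 n) ∞ M]
    (g : SmoothMetric n M) : FormField (𝓡 n) M :=
  fun x v w => g.inner x v w

section Submersions

variable {E : Type*} [NormedAddCommGroup E] [NormedSpace ℝ E] {H : Type*} [TopologicalSpace H]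
  (I : ModelWithCorners ℝ E H) {A : Type*} [TopologicalSpace A] [ChartedSpace H A]
  {E' : Type*} [NormedAddCommGroup E'] [NormedSpace ℝ E'] {H' : Type*} [TopologicalSpace H']
  (J : ModelWithCorners ℝ E' H') {B : Type*} [TopologicalSpace B] [ChartedSpace H' B]

/-- The pullback `f^* T`. -/
def pullbackForm (f : A → B) (T : FormField J B) : FormField I A :=
  fun a v w => T (f a) (mfderiv I J f a v) (mfderiv I J f a w)

/-- `v` is horizontal for `f`: it is orthogonal to the kernel of the differential of `f`. -/
def IsHorizontal (f : A → B) (g : FormField I A) (a : A) (v : TangentSpace I a) : Prop :=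
  ∀ u : TangentSpace I a, mfderiv I J f a u = 0 → g a v u = 0

/-- `f : (A, gA) → (B, gB)` is a Riemannian submersion. -/
structure IsRiemannianSubmersion (f : A → B) (gA : FormField I A) (gB : FormField J B) :
    Prop where
  contMDiff : ContMDiff I J ∞ f
  surjective_mfderiv (a : A) : Function.Surjective (mfderiv I J f a)
  isometry (a : A) (v w : TangentSpace I a) (hv : IsHorizontal I J f gA a v)
    (hw : IsHorizontal I J f gA a w) :
    gB (f a) (mfderiv I J f a v) (mfderiv I J f a w) = gA a v w

end Submersions

section Connection

variable {n : ℕ} {M : Type*} [TopologicalSpace M] [ChartedSpace (EuclideanSpace ℝ (Fin n)) M]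
  [IsManifold (𝓡 n) ∞ M]

/-- Every sequence which is Cauchy for the Riemannian distance of `g` converges. -/
def IsCompleteMetric (g : SmoothMetric n M) : Prop :=
  letI : Bundle.RiemannianBundle (fun x : M => TangentSpace (𝓡 n) x) := ⟨g.toRiemannianMetric⟩
  ∀ u : ℕ → M,
    (∀ ε : ℝ≥0∞, 0 < ε → ∃ N : ℕ, ∀ i ≥ N, ∀ j ≥ N, Manifold.riemannianEDist (𝓡 n) (u i) (u j) < ε) →
    ∃ x : M, Tendsto u atTop (𝓝 x)

/-- `∇` is the Levi-Civita connection of `g`: torsion-free, and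
`v (g(Y, Z)) = g(∇_v Y, Z) + g(Y, ∇_v Z)`. In Mathlib's convention `∇_v Y` at `x` is written
`cov Y x v`. -/
structure IsLeviCivita (g : SmoothMetric n M)
    (cov : CovariantDerivative (𝓡 n) (EuclideanSpace ℝ (Fin n))
      (fun x : M => TangentSpace (𝓡 n) x)) : Prop where
  torsion_eq_zero : cov.torsion = 0
  metric (x : M) (Y Z : ∀ y : M, TangentSpace (𝓡 n) y)
    (hY : MDifferentiableAt (𝓡 n) (𝓡 n).tangent (fun y => (⟨y, Y y⟩ : TangentBundle (𝓡 n) M)) x)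
    (hZ : MDifferentiableAt (𝓡 n) (𝓡 n).tangent (fun y => (⟨y, Z y⟩ : TangentBundle (𝓡 n) M)) x)
    (v : TangentSpace (𝓡 n) x) :
    mfderiv (𝓡 n) 𝓘(ℝ, ℝ) (fun y => g.form y (Y y) (Z y)) x v =
      g.form x (cov Y x v) (Z x) + g.form x (Y x) (cov Z x v)

/-- The fibers of the submersion `f` are totally geodesic for `g`: the second fundamental form
of each fiber vanishes, that is, `∇_v Y` is tangent to the fiber whenever `v` is tangent to the
fiber and the vector field `Y` is tangent to the fiber along the fiber. -/
def HasTotallyGeodesicFibers {k : ℕ} {B : Type*} [TopologicalSpace B]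
    [ChartedSpace (EuclideanSpace ℝ (Fin k)) B] (g : SmoothMetric n M) (f : M → B) : Prop :=
  ∃ cov : CovariantDerivative (𝓡 n) (EuclideanSpace ℝ (Fin n))
      (fun x : M => TangentSpace (𝓡 n) x),
    IsLeviCivita g cov ∧
    ∀ (b : B) (Y : ∀ y : M, TangentSpace (𝓡 n) y),
      ContMDiff (𝓡 n) (𝓡 n).tangent ∞ (fun y => (⟨y, Y y⟩ : TangentBundle (𝓡 n) M)) →
      (∀ y, f y = b → mfderiv (𝓡 n) (𝓡 k) f y (Y y) = 0) →
      ∀ x, f x = b → ∀ v : TangentSpace (𝓡 n) x,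
        mfderiv (𝓡 n) (𝓡 k) f x v = 0 → mfderiv (𝓡 n) (𝓡 k) f x (cov Y x v) = 0

end Connection

section Action

variable {d : ℕ} {G : Type*} [TopologicalSpace G] [ChartedSpace (EuclideanSpace ℝ (Fin d)) G]
  [Group G]
  {n : ℕ} {M : Type*} [TopologicalSpace M] [ChartedSpace (EuclideanSpace ℝ (Fin n)) M]
  [MulAction G M]

/-- Left and right translations are isometries. -/
def IsBiInvariant (T : FormField (𝓡 d) G) : Prop :=
  (∀ a : G, pullbackForm (𝓡 d) (𝓡 d) (fun b : G => a * b) T = T) ∧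
    ∀ a : G, pullbackForm (𝓡 d) (𝓡 d) (fun b : G => b * a) T = T

/-- The union `M^reg` of the principal orbits, the orbits of maximum orbit type: the isotropy
group of `x` is conjugate to a subgroup of the isotropy group of every other point. -/
def regularPart (G M : Type*) [Group G] [MulAction G M] : Set M :=
  {x | ∀ y : M, ∃ a : G, (MulAction.stabilizer G x).map (MulAut.conj a).toMonoidHom ≤
    MulAction.stabilizer G y}

/-- The metric `l² g_bi + g_M` on `G × M`. -/
def cheegerProduct (gbi : FormField (𝓡 d) G) (gM : FormField (𝓡 n) M) (l : ℝ) :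
    FormField ((𝓡 d).prod (𝓡 n)) (G × M) :=
  fun p v w => l ^ 2 * pullbackForm ((𝓡 d).prod (𝓡 n)) (𝓡 d) Prod.fst gbi p v w +
    pullbackForm ((𝓡 d).prod (𝓡 n)) (𝓡 n) Prod.snd gM p v w

/-- `T` is the Cheeger deformation `g_l` of `g_M`: the metric on `M ≅ (G × M) / G` induced by
`l² g_bi + g_M`, i.e. the one for which the quotient map `q(p, m) = pm` of the Cheeger action
is a Riemannian submersion. -/
def IsCheegerDeformation (gbi : FormField (𝓡 d) G) (gM : FormField (𝓡 n) M) (l : ℝ)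
    (T : FormField (𝓡 n) M) : Prop :=
  IsRiemannianSubmersion ((𝓡 d).prod (𝓡 n)) (𝓡 n) (fun p : G × M => p.1 • p.2)
    (cheegerProduct gbi gM l) T

variable (d n G) in
/-- The tangent space `T_x G(x)` of the orbit at `x`: the image of the differential of `a ↦ a • x`
at `1` (where `1 • x = x`). -/
def orbitTangent (x : M) : Submodule ℝ (TangentSpace (𝓡 n) x) :=
  LinearMap.range
    (show TangentSpace (𝓡 d) (1 : G) →L[ℝ] TangentSpace (𝓡 n) x from
      mfderiv (𝓡 d) (𝓡 n) (fun a : G => a • x) 1).toLinearMap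

variable (d G) in
/-- The `g`-orthogonal projection of `T_x M` onto `T_x G(x)`. -/
def orbitProj [IsManifold (𝓡 n) ∞ M] (g : SmoothMetric n M) (x : M)
    (v : TangentSpace (𝓡 n) x) : TangentSpace (𝓡 n) x :=
  letI : Bundle.RiemannianBundle (fun x : M => TangentSpace (𝓡 n) x) := ⟨g.toRiemannianMetric⟩
  haveI : FiniteDimensional ℝ (TangentSpace (𝓡 n) x) :=
    inferInstanceAs (FiniteDimensional ℝ (EuclideanSpace ℝ (Fin n)))
  (orbitTangent d G n x).starProjection v

variable (d G) in
/-- `g̃_l = l⁻² g_l` on `T G(x)` plus `g_l` on the orthogonal complement of `T G(x)`. -/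
def rescaledForm [IsManifold (𝓡 n) ∞ M] (gM gl : SmoothMetric n M) (l : ℝ) :
    FormField (𝓡 n) M :=
  fun x v w =>
    (l ^ 2)⁻¹ * gl.form x (orbitProj d G gM x v) (orbitProj d G gM x w) +
      gl.form x (v - orbitProj d G gM x v) (w - orbitProj d G gM x w)

variable (d G) in
/-- The restriction of `g̃_l` to `U`. -/
def rescaledOn [IsManifold (𝓡 n) ∞ M] (gM gl : SmoothMetric n M) (U : Opens M) (l : ℝ) :
    FormField (𝓡 n) U :=
  pullbackForm (𝓡 n) (𝓡 n) (Subtype.val : U → M) (rescaledForm d G gM gl l)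

/-- Translation by `a` on an invariant open set. -/
def openTranslate (U : Opens M) (hU : ∀ (a : G), ∀ x ∈ U, a • x ∈ U) (a : G) (x : U) : U :=
  ⟨a • (x : M), hU a x x.2⟩

variable (G) in
/-- The orbit space `U / G`, with the quotient topology. -/
abbrev OrbitSpace (U : Opens M) : Type _ :=
  Quotient ((MulAction.orbitRel G M).comap (Subtype.val : U → M))

variable (G) in
/-- The projection `U → U / G`. -/
def orbitMk (U : Opens M) (x : U) : OrbitSpace G U := Quotient.mk _ x

/-- The fibers of `f : U → B`, with the metrics induced by `g`, are normal homogeneous spaces of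
`(G, g_bi)`: for `x` in `U`, the orbit map `φ : a ↦ a • x` (hence `G / G_x`) has the fiber through
`x` as image, and is a Riemannian submersion from `(G, g_bi)` onto this fiber. -/
def HasNormalHomogeneousFibers {k : ℕ} {B : Type*} [TopologicalSpace B]
    [ChartedSpace (EuclideanSpace ℝ (Fin k)) B] (U : Opens M)
    (hU : ∀ (a : G), ∀ x ∈ U, a • x ∈ U) (gbi : FormField (𝓡 d) G) (g : FormField (𝓡 n) U)
    (f : U → B) : Prop :=
  ∀ x : U,
    let φ : G → U := fun a => openTranslate U hU a x
    range φ = f ⁻¹' {f x} ∧ ContMDiff (𝓡 d) (𝓡 n) ∞ φ ∧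
    ∀ a : G,
      (∀ u : TangentSpace (𝓡 n) (φ a),
        mfderiv (𝓡 n) (𝓡 k) f (φ a) u = 0 ↔ ∃ v, mfderiv (𝓡 d) (𝓡 n) φ a v = u) ∧
      ∀ v w : TangentSpace (𝓡 d) a, IsHorizontal (𝓡 d) (𝓡 n) φ gbi a v →
        IsHorizontal (𝓡 d) (𝓡 n) φ gbi a w →
        g (φ a) (mfderiv (𝓡 d) (𝓡 n) φ a v) (mfderiv (𝓡 d) (𝓡 n) φ a w) = gbi a v w

end Action

section CpNorm

variable {n : ℕ} {M : Type*} [TopologicalSpace M] [ChartedSpace (EuclideanSpace ℝ (Fin n)) M]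

open Classical in
/-- The components `T_ij = T(∂_i, ∂_j)` of a form field `T` on the open set `U` in the chart `e`
of `M`, as functions on the model space (`0` outside the image of `U`). -/
def chartComponents {U : Opens M} (e : OpenPartialHomeomorph M (EuclideanSpace ℝ (Fin n)))
    (T : FormField (𝓡 n) U) (y : EuclideanSpace ℝ (Fin n)) : Fin n → Fin n → ℝ :=
  if h : y ∈ e.target ∧ e.symm y ∈ U then
    let x : U := ⟨e.symm y, h.2⟩
    let frame (i : Fin n) : TangentSpace (𝓡 n) x :=
      (mfderiv (𝓡 n) (𝓡 n) (fun z : U => e (z : M)) x).inverse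
        (EuclideanSpace.single i (1 : ℝ))
    fun i j => T x (frame i) (frame j)
  else 0

/-- Finitely many smooth charts of `M`, with compact subsets of their domains which together cover
the closure of `U`; this is what a `C^p`-norm on `U` is computed with. -/
structure FiniteAtlas (U : Opens M) where
  card : ℕ
  chart : Fin card → OpenPartialHomeomorph M (EuclideanSpace ℝ (Fin n))
  mem_maximalAtlas (i : Fin card) : chart i ∈ IsManifold.maximalAtlas (𝓡 n) ∞ M
  piece : Fin card → Set M
  isCompact_piece (i : Fin card) : IsCompact (piece i)
  piece_subset (i : Fin card) : piece i ⊆ (chart i).source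
  closure_subset : closure (U : Set M) ⊆ ⋃ i, piece i

/-- Smoothness of a form field on `U`, in all charts. -/
def IsSmoothForm {U : Opens M} (T : FormField (𝓡 n) U) : Prop :=
  ∀ e ∈ IsManifold.maximalAtlas (𝓡 n) ∞ M,
    ContDiffOn ℝ ∞ (chartComponents e T) (e '' (e.source ∩ U))

/-- The `C^p`-norm on `U`: the supremum over `U` of all partial derivatives up to order `p` of
the components in the charts of a finite atlas. -/
def cpNorm {U : Opens M} (𝒜 : FiniteAtlas (n := n) U) (p : ℕ) (T : FormField (𝓡 n) U) : ℝ≥0∞ :=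
  ⨆ (i : Fin 𝒜.card) (k : ℕ) (_ : k ≤ p) (x : M) (_ : x ∈ 𝒜.piece i ∩ U),
    ‖iteratedFDeriv ℝ k (chartComponents (𝒜.chart i) T) (𝒜.chart i x)‖ₑ

end CpNorm

end

/-! Everything about `g̃_l` reduces to linear algebra at a point `x`. Let `Φ` be the differential at
`1` of `a ↦ a • x`, `b` the inner product `g_bi` at `1`, `a` the inner product `g_M` at `x`, and `P`
the `a`-orthogonal projection onto the range of `Φ`. Since all data are invariant, the Cheeger
condition says that `g_l` at `x` is the quotient of `l² b + a` under `(v, u) ↦ Φ v + u`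
(`isCheegerDeformation_iff`), and an explicit formula for quotient forms gives existence and
uniqueness. The rescaled form is then the quotient of the fixed inner product `b + a` under `(v, u)
↦ Φ v + l P u + (u - P u)` (`rescaled_eq_tildeForm`). This map remains surjective at `l = 0`, and
its quotient form there is the limit metric.

On dual spaces the family is affine in `l²`: the dual form at `l` is the one at `0` plus `l² P a⁻¹`
(`quotDual_tildeMap`). The identity `X⁻¹ - Y⁻¹ = -X⁻¹ (X - Y) Y⁻¹` therefore writes `g̃_l - g̃` as
`-l²` times a form that is smooth in `(l, x)` jointly, also at `l = 0`
(`tildeForm_sub_tildeForm_zero`, `contDiffAt_tildeDiff`). Its derivatives are locally bounded, and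
compactness gives the `C^p` estimate.

Smoothness requires `P` to be smooth, hence `Φ` to have locally constant rank. The kernel of `Φ`
grows with the isotropy group (`actDeriv_eq_zero_of_stabilizer_le`), so the rank is maximal at
regular points (`orbitRank_le_of_mem_regularPart`); as the rank cannot drop nearby, it is locally
constant, and `ContDiffAt.orthProj_range` applies.

For the orbit space, the inverse function theorem gives a transversal coordinate that is constant
along small pieces of orbits. An orbit might still return to the chart at a different height.
Compactness of `G` and the principal orbit condition exclude this: two points of one orbit near `x`
differ by a group element near `1` (`eventually_exists_smul_eq`). Transversal coordinates thus
become charts of the quotient, and the quotient forms, constant along orbits by invariance, give its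
metric.

At `l = 0` the form on the range of `Φ` is the quotient of `b` under `Φ`, which is normal
homogeneity. Consequently the action field of `V` has squared length at most `b V V` everywhere,
with equality at `x` if `V` is orthogonal to the kernel of `Φ`. Every vector tangent to an orbit at
`x` is the value of such a field; this Killing field has maximal length at `x`, so `∇_X X = 0` there
(`fderiv_add_christoffel_of_killing`). The second fundamental form of the orbit vanishes on the
diagonal and, being symmetric, vanishes (`hasTotallyGeodesicFibers`). -/

set_option linter.unusedSectionVars false

noncomputable section

/-! ### Linear algebra of quotient inner products -/

section QuotientForms

variable {A : Type*} [NormedAddCommGroup A] [NormedSpace ℝ A]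
  {B : Type*} [NormedAddCommGroup B] [NormedSpace ℝ B]

/-- A symmetric positive definite bilinear form. -/
structure IsInner (a : A →L[ℝ] A →L[ℝ] ℝ) : Prop where
  symm (v w : A) : a v w = a w v
  pos (v : A) (hv : v ≠ 0) : 0 < a v v

/-- `v` is `a`-orthogonal to the kernel of `L`. -/
def OrthKer (L : A →L[ℝ] B) (a : A →L[ℝ] A →L[ℝ] ℝ) (v : A) : Prop :=
  ∀ u, L u = 0 → a v u = 0

/-- `h` is the quotient under `L` of the inner product `a`. -/
def IsQuotForm (L : A →L[ℝ] B) (a : A →L[ℝ] A →L[ℝ] ℝ) (h : B → B → ℝ) : Prop :=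
  ∀ v w, OrthKer L a v → OrthKer L a w → h (L v) (L w) = a v w

/-- The transpose of a continuous linear map. -/
def transposeL (L : A →L[ℝ] B) : (B →L[ℝ] ℝ) →L[ℝ] (A →L[ℝ] ℝ) :=
  (ContinuousLinearMap.compL ℝ A B ℝ).flip L

@[simp]
lemma transposeL_apply (L : A →L[ℝ] B) (β : B →L[ℝ] ℝ) (v : A) : transposeL L β v = β (L v) := rfl

/-- The inner product on the dual space of `B` induced by `a` and `L`. -/
def quotDual (L : A →L[ℝ] B) (a : A →L[ℝ] A →L[ℝ] ℝ) : (B →L[ℝ] ℝ) →L[ℝ] B :=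
  L ∘L a.inverse ∘L transposeL L

/-- The quotient of the inner product `a` under the surjection `L`. -/
def quotForm (L : A →L[ℝ] B) (a : A →L[ℝ] A →L[ℝ] ℝ) : B →L[ℝ] B →L[ℝ] ℝ :=
  (quotDual L a).inverse

lemma IsInner.nonneg {a : A →L[ℝ] A →L[ℝ] ℝ} (ha : IsInner a) (v : A) : 0 ≤ a v v := by
  rcases eq_or_ne v 0 with rfl | hv
  · simp
  · exact (ha.pos v hv).le

lemma IsInner.eq_zero {a : A →L[ℝ] A →L[ℝ] ℝ} (ha : IsInner a) {v : A} (hv : a v v = 0) :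
    v = 0 := by
  by_contra h
  exact (ha.pos v h).ne' hv

lemma IsInner.ext {a : A →L[ℝ] A →L[ℝ] ℝ} (ha : IsInner a) {v w : A}
    (h : ∀ u, a v u = a w u) : v = w := by
  refine sub_eq_zero.1 (ha.eq_zero ?_)
  have h1 := h (v - w)
  rw [← sub_eq_zero, ← sub_apply, ← map_sub] at h1
  exact h1

variable [FiniteDimensional ℝ A] [FiniteDimensional ℝ B]

lemma finrank_clm_dual : Module.finrank ℝ (A →L[ℝ] ℝ) = Module.finrank ℝ A := by
  rw [← LinearEquiv.finrank_eq (LinearMap.toContinuousLinearMap (𝕜 := ℝ) (E := A) (F' := ℝ))]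
  exact Subspace.dual_finrank_eq

lemma ContinuousLinearMap.isInvertible_of_injective {V W : Type*} [NormedAddCommGroup V]
    [NormedSpace ℝ V] [NormedAddCommGroup W] [NormedSpace ℝ W] [FiniteDimensional ℝ V]
    [FiniteDimensional ℝ W] (T : V →L[ℝ] W) (hT : Function.Injective T)
    (h : Module.finrank ℝ V = Module.finrank ℝ W) : T.IsInvertible :=
  ⟨(LinearEquiv.ofInjectiveOfFinrankEq T.toLinearMap hT h).toContinuousLinearEquiv, by
    ext v; rfl⟩

lemma IsInner.isInvertible {a : A →L[ℝ] A →L[ℝ] ℝ} (ha : IsInner a) : a.IsInvertible := by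
  refine a.isInvertible_of_injective (fun v w h => ha.ext fun u => by rw [h]) ?_
  exact finrank_clm_dual.symm

lemma IsInner.apply_inverse {a : A →L[ℝ] A →L[ℝ] ℝ} (ha : IsInner a) (β : A →L[ℝ] ℝ) :
    a (a.inverse β) = β := by
  obtain ⟨e, rfl⟩ := ha.isInvertible
  simp

lemma IsInner.inverse_apply {a : A →L[ℝ] A →L[ℝ] ℝ} (ha : IsInner a) (v : A) :
    a.inverse (a v) = v := by
  obtain ⟨e, rfl⟩ := ha.isInvertible
  simp

variable {a : A →L[ℝ] A →L[ℝ] ℝ} {L : A →L[ℝ] B}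

omit [FiniteDimensional ℝ B] in
lemma orthKer_inverse_transpose (ha : IsInner a) (β : B →L[ℝ] ℝ) :
    OrthKer L a (a.inverse (transposeL L β)) := by
  intro u hu
  rw [ha.apply_inverse, transposeL_apply, hu, map_zero]

omit [FiniteDimensional ℝ B] in
-- This displays `quotDual` as the Gram form of the vectors `a⁻¹ Lᵀ β`, from which its symmetry and
-- definiteness are read off.
lemma apply_quotDual (ha : IsInner a) (β γ : B →L[ℝ] ℝ) :
    γ (quotDual L a β) = a (a.inverse (transposeL L β)) (a.inverse (transposeL L γ)) := by
  rw [ha.symm, ha.apply_inverse]; rfl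

/-- If `β` is killed, then `a⁻¹ Lᵀ β` has length zero, so `β ∘ L = 0`, and `β = 0` because `L` is
onto. Equality of dimensions does the rest. -/
lemma isInvertible_quotDual (ha : IsInner a) (hL : Function.Surjective L) :
    (quotDual L a).IsInvertible := by
  refine ContinuousLinearMap.isInvertible_of_injective _ ?_ finrank_clm_dual
  refine (injective_iff_map_eq_zero _).2 fun β hβ => ?_
  have h := apply_quotDual (L := L) ha β β
  rw [hβ, map_zero] at h
  have h' := ha.eq_zero h.symm
  have h2 : transposeL L β = 0 := by
    rw [← ha.apply_inverse (transposeL L β), h', map_zero]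
  ext b
  obtain ⟨v, rfl⟩ := hL b
  exact DFunLike.congr_fun h2 v

lemma quotForm_quotDual (ha : IsInner a) (hL : Function.Surjective L) (β : B →L[ℝ] ℝ) :
    quotForm L a (quotDual L a β) = β := by
  unfold quotForm
  obtain ⟨e, he⟩ := isInvertible_quotDual ha hL
  rw [← he]; simp

lemma quotDual_quotForm (ha : IsInner a) (hL : Function.Surjective L) (b : B) :
    quotDual L a (quotForm L a b) = b := by
  unfold quotForm
  obtain ⟨e, he⟩ := isInvertible_quotDual ha hL
  rw [← he]; simp

lemma exists_orthKer (ha : IsInner a) (hL : Function.Surjective L) (b : B) :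
    ∃ v, OrthKer L a v ∧ L v = b :=
  ⟨_, orthKer_inverse_transpose ha (quotForm L a b), quotDual_quotForm ha hL b⟩

omit [FiniteDimensional ℝ B] in
-- The functional `a v` vanishes on the kernel of `L`, hence factors through `L`; a linear section
-- of `L` produces the factor `β`. Together with `orthKer_inverse_transpose` this parametrizes the
-- horizontal vectors.
lemma OrthKer.exists_transpose (ha : IsInner a) (hL : Function.Surjective L) {v : A}
    (hv : OrthKer L a v) : ∃ β : B →L[ℝ] ℝ, v = a.inverse (transposeL L β) := by
  have : FiniteDimensional ℝ B :=
    FiniteDimensional.of_surjective L.toLinearMap hL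
  obtain ⟨s, hs⟩ := L.toLinearMap.exists_rightInverse_of_surjective (LinearMap.range_eq_top.2 hL)
  refine ⟨(a v) ∘L (LinearMap.toContinuousLinearMap s), ?_⟩
  rw [← ha.inverse_apply v]
  congr 1
  ext u
  rw [ha.inverse_apply, transposeL_apply]
  have : a v (u - s (L u)) = 0 := by
    apply hv
    have := LinearMap.congr_fun hs (L u)
    rw [map_sub, sub_eq_zero]
    exact this.symm
  rw [map_sub, sub_eq_zero] at this
  exact this

lemma quotForm_apply (ha : IsInner a) (hL : Function.Surjective L) {v w : A}
    (hv : OrthKer L a v) (hw : OrthKer L a w) : quotForm L a (L v) (L w) = a v w := by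
  obtain ⟨β, rfl⟩ := hv.exists_transpose ha hL
  obtain ⟨γ, rfl⟩ := hw.exists_transpose ha hL
  have := quotForm_quotDual ha hL β
  rw [← apply_quotDual ha]
  calc quotForm L a (quotDual L a β) (quotDual L a γ) = β (quotDual L a γ) := by rw [this]
    _ = γ (quotDual L a β) := by rw [apply_quotDual ha, apply_quotDual ha, ha.symm]

lemma isQuotForm_quotForm (ha : IsInner a) (hL : Function.Surjective L) :
    IsQuotForm L a (fun v w => quotForm L a v w) :=
  fun _ _ hv hw => quotForm_apply ha hL hv hw

lemma isInner_quotForm (ha : IsInner a) (hL : Function.Surjective L) :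
    IsInner (quotForm L a) := by
  constructor
  · intro b c
    obtain ⟨v, hv, rfl⟩ := exists_orthKer ha hL b
    obtain ⟨w, hw, rfl⟩ := exists_orthKer ha hL c
    rw [quotForm_apply ha hL hv hw, quotForm_apply ha hL hw hv, ha.symm]
  · intro b hb
    obtain ⟨v, hv, rfl⟩ := exists_orthKer ha hL b
    rw [quotForm_apply ha hL hv hv]
    exact ha.pos v fun h => hb (by rw [h, map_zero])

/-- Every vector of `B` has a horizontal lift, so the defining identity leaves no freedom. All later
identifications of metrics go through this uniqueness. -/
lemma IsQuotForm.eq (ha : IsInner a) (hL : Function.Surjective L) {h : B → B → ℝ}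
    (hh : IsQuotForm L a h) (b c : B) : h b c = quotForm L a b c := by
  obtain ⟨v, hv, rfl⟩ := exists_orthKer ha hL b
  obtain ⟨w, hw, rfl⟩ := exists_orthKer ha hL c
  rw [quotForm_apply ha hL hv hw, hh v w hv hw]

/-- Pythagoras: the horizontal lift is the shortest among all lifts, since it differs from any other
by an orthogonal vector of the kernel. -/
lemma quotForm_apply_le (ha : IsInner a) (hL : Function.Surjective L) (v : A) :
    quotForm L a (L v) (L v) ≤ a v v := by
  obtain ⟨w, hw, h⟩ := exists_orthKer ha hL (L v)
  rw [← h, quotForm_apply ha hL hw hw]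
  have h0 : a w (v - w) = 0 := hw _ (by rw [map_sub, h, sub_self])
  have h1 := ha.nonneg (v - w)
  have h2 := ha.symm w (v - w)
  have h3 : a v v = a w w + a w (v - w) + a (v - w) w + a (v - w) (v - w) := by
    simp only [map_sub, sub_apply]; ring
  rw [h3, ← h2, h0]; linarith

omit [FiniteDimensional ℝ A] [FiniteDimensional ℝ B] in
/-- Quotient forms are natural under isomorphisms. -/
lemma IsQuotForm.of_intertwine {A' B' : Type*} [NormedAddCommGroup A'] [NormedSpace ℝ A']
    [NormedAddCommGroup B'] [NormedSpace ℝ B'] {a' : A' →L[ℝ] A' →L[ℝ] ℝ} {L' : A' →L[ℝ] B'}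
    {h : B' → B' → ℝ} (hh : IsQuotForm L' a' h) (T : A →L[ℝ] A') (S : B →L[ℝ] B')
    (hT : Function.Surjective T) (hS : Function.Injective S) (hLT : ∀ v, L' (T v) = S (L v))
    (haT : ∀ v w, a' (T v) (T w) = a v w) :
    IsQuotForm L a (fun b c => h (S b) (S c)) := by
  have key : ∀ v, OrthKer L a v → OrthKer L' a' (T v) := by
    intro v hv u hu
    obtain ⟨u, rfl⟩ := hT u
    rw [haT]
    refine hv u (hS ?_)
    rw [← hLT, hu, map_zero]
  intro v w hv hw
  change h (S (L v)) (S (L w)) = _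
  rw [← hLT, ← hLT, hh _ _ (key v hv) (key w hw), haT]

section Smooth

variable {X : Type*} [NormedAddCommGroup X] [NormedSpace ℝ X] {m : ℕ∞ω}

omit [FiniteDimensional ℝ B] in
lemma ContDiffAt.clm_inverse {f : X → A →L[ℝ] B} {x : X} (hf : ContDiffAt ℝ m f x)
    (h : (f x).IsInvertible) : ContDiffAt ℝ m (fun y => (f y).inverse) x := by
  have := FiniteDimensional.complete ℝ A
  obtain ⟨e, he⟩ := h
  have h1 := contDiffAt_map_inverse (n := m) e
  rw [he] at h1
  exact h1.comp x hf

set_option synthInstance.maxHeartbeats 200000 in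
omit [FiniteDimensional ℝ A] [FiniteDimensional ℝ B] in
lemma ContDiffAt.transposeL {L : X → A →L[ℝ] B} {x : X} (hL : ContDiffAt ℝ m L x) :
    ContDiffAt ℝ m (fun y => transposeL (L y)) x := by
  unfold _root_.transposeL
  exact contDiffAt_const.clm_apply hL

omit [FiniteDimensional ℝ B] in
lemma ContDiffAt.quotDual {L : X → A →L[ℝ] B} {a : X → A →L[ℝ] A →L[ℝ] ℝ} {x : X}
    (hL : ContDiffAt ℝ m L x) (ha : ContDiffAt ℝ m a x) (hax : IsInner (a x)) :
    ContDiffAt ℝ m (fun y => quotDual (L y) (a y)) x :=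
  hL.clm_comp ((ha.clm_inverse hax.isInvertible).clm_comp hL.transposeL)

/-- The formula for `quotForm` uses only composition, transposition and inversion of invertible
maps; no choice of horizontal lifts has to be made smoothly. -/
lemma ContDiffAt.quotForm {L : X → A →L[ℝ] B} {a : X → A →L[ℝ] A →L[ℝ] ℝ} {x : X}
    (hL : ContDiffAt ℝ m L x) (ha : ContDiffAt ℝ m a x) (hax : IsInner (a x))
    (hLx : Function.Surjective (L x)) :
    ContDiffAt ℝ m (fun y => quotForm (L y) (a y)) x :=
  (hL.quotDual ha hax).clm_inverse (isInvertible_quotDual hax hLx)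

end Smooth

end QuotientForms

/-! ### Local bounds for derivatives depending on a parameter -/

section ParametricDerivatives

variable {E F : Type*} [NormedAddCommGroup E] [NormedSpace ℝ E] [NormedAddCommGroup F]
  [NormedSpace ℝ F]

/-- The partial derivatives of a smooth function of a parameter and a variable are locally
bounded. -/
lemma ContDiffAt.eventually_norm_iteratedFDeriv_le {D : ℝ × E → F} {p : ℝ × E}
    (hD : ContDiffAt ℝ ∞ D p) (k : ℕ) :
    ∃ C : ℝ, ∀ᶠ q in 𝓝 p, ‖iteratedFDeriv ℝ k (fun y => D (q.1, y)) q.2‖ ≤ C := by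
  have hk : ContDiffAt ℝ k D p := hD.of_le (by exact_mod_cast le_top)
  obtain ⟨u, hu, hDu⟩ := (hk.eventually (by simp)).exists_mem
  obtain ⟨s, hsu, hs, hps⟩ := mem_nhds_iff.1 hu
  have hon : ContDiffOn ℝ k D s := fun q hq => (hDu q (hsu hq)).contDiffWithinAt
  have hcont : ContinuousAt (iteratedFDerivWithin ℝ k D s) p :=
    (hon.continuousOn_iteratedFDerivWithin le_rfl hs.uniqueDiffOn).continuousAt (hs.mem_nhds hps)
  refine ⟨(‖iteratedFDerivWithin ℝ k D s p‖ + 1) *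
    ∏ _i : Fin k, ‖ContinuousLinearMap.inr ℝ ℝ E‖, ?_⟩
  filter_upwards [hs.mem_nhds hps, hcont.norm.eventually (ge_mem_nhds (lt_add_one _))] with q hq hqC
  -- Freezing the parameter amounts to translating `D` and composing with the linear inclusion `y ↦
  -- (0, y)`, so partial derivatives are bounded by full ones.
  let f : ℝ × E → F := fun r => D ((q.1, 0) + r)
  let t : Set (ℝ × E) := (fun r => (q.1, 0) + r) ⁻¹' s
  have ht : IsOpen t := hs.preimage (by fun_prop)
  have hf : ContDiffOn ℝ k f t :=
    hon.comp (contDiff_const.add contDiff_id).contDiffOn fun r hr => hr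
  have hcomp : (fun y => D (q.1, y)) = f ∘ ContinuousLinearMap.inr ℝ ℝ E := by
    ext y; simp [f]
  have hmem : ContinuousLinearMap.inr ℝ ℝ E q.2 ∈ t := by simpa [t] using hq
  have ht' : IsOpen (ContinuousLinearMap.inr ℝ ℝ E ⁻¹' t) :=
    ht.preimage (ContinuousLinearMap.continuous _)
  rw [hcomp, ← iteratedFDerivWithin_of_isOpen k ht' hmem,
    ContinuousLinearMap.iteratedFDerivWithin_comp_right _ hf ht.uniqueDiffOn ht'.uniqueDiffOn hmem
      le_rfl]
  refine (ContinuousMultilinearMap.norm_compContinuousLinearMap_le _ _).trans ?_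
  gcongr
  rw [iteratedFDerivWithin_of_isOpen k ht hmem]
  have : iteratedFDeriv ℝ k f (ContinuousLinearMap.inr ℝ ℝ E q.2) = iteratedFDeriv ℝ k D q := by
    simp only [f]
    rw [iteratedFDeriv_comp_add_left]
    simp
  rw [this, ← iteratedFDerivWithin_of_isOpen k hs hq]
  exact hqC

end ParametricDerivatives

end

noncomputable section

/-- Euclidean `n`-space. -/
abbrev Euc (n : ℕ) : Type := EuclideanSpace ℝ (Fin n)

/-! ### Differentials as maps of model spaces, and bilinear forms in charts -/

section TangentDerivative

variable {E : Type*} [NormedAddCommGroup E] [NormedSpace ℝ E]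
  {A : Type*} [TopologicalSpace A] [ChartedSpace E A]
  {E' : Type*} [NormedAddCommGroup E'] [NormedSpace ℝ E']
  {B : Type*} [TopologicalSpace B] [ChartedSpace E' B]
  {E'' : Type*} [NormedAddCommGroup E''] [NormedSpace ℝ E'']
  {C : Type*} [TopologicalSpace C] [ChartedSpace E'' C]

variable (E E') in
/-- The differential of `f` at `a`, as a map between the model spaces. -/
def tderiv (f : A → B) (a : A) : E →L[ℝ] E' := mfderiv 𝓘(ℝ, E) 𝓘(ℝ, E') f a

lemma tderiv_comp {g : B → C} {f : A → B} {a : A}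
    (hg : MDifferentiableAt 𝓘(ℝ, E') 𝓘(ℝ, E'') g (f a))
    (hf : MDifferentiableAt 𝓘(ℝ, E) 𝓘(ℝ, E') f a) :
    tderiv E E'' (fun x => g (f x)) a = tderiv E' E'' g (f a) ∘L tderiv E E' f a :=
  mfderiv_comp a hg hf

lemma tderiv_comp_apply {g : B → C} {f : A → B} {a : A}
    (hg : MDifferentiableAt 𝓘(ℝ, E') 𝓘(ℝ, E'') g (f a))
    (hf : MDifferentiableAt 𝓘(ℝ, E) 𝓘(ℝ, E') f a) (v : E) :
    tderiv E E'' (fun x => g (f x)) a v = tderiv E' E'' g (f a) (tderiv E E' f a v) := by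
  rw [tderiv_comp hg hf]; rfl

lemma tderiv_congr {f f' : A → B} {a : A} (h : f =ᶠ[𝓝 a] f') :
    tderiv E E' f a = tderiv E E' f' a := by
  unfold tderiv
  have := h.mfderiv_eq (I := 𝓘(ℝ, E)) (I' := 𝓘(ℝ, E'))
  exact this

lemma tderiv_id (a : A) : tderiv E E (fun x : A => x) a = ContinuousLinearMap.id ℝ E :=
  mfderiv_id

lemma tderiv_const (a : A) (b : B) : tderiv E E' (fun _ : A => b) a = 0 :=
  mfderiv_const

lemma tderiv_eq_fderiv {f : E → E'} {y : E} : tderiv E E' f y = fderiv ℝ f y :=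
  mfderiv_eq_fderiv

lemma tderiv_chartAt_self [IsManifold 𝓘(ℝ, E) 1 A] (x : A) :
    tderiv E E (chartAt E x) x = ContinuousLinearMap.id ℝ E := by
  have := mfderiv_extChartAt_self (I := 𝓘(ℝ, E)) (x := x)
  simp only [mfld_simps] at this
  exact this

variable {e : OpenPartialHomeomorph A E}

lemma tderiv_chart_comp_symm [IsManifold 𝓘(ℝ, E) ∞ A]
    (he : e ∈ IsManifold.maximalAtlas 𝓘(ℝ, E) ∞ A) {y : E} (hy : y ∈ e.target) (v : E) :
    tderiv E E e (e.symm y) (tderiv E E e.symm y v) = v := by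
  have h1 := (contMDiffAt_of_mem_maximalAtlas he (e.map_target hy)).mdifferentiableAt (by simp)
  have h2 := (contMDiffAt_symm_of_mem_maximalAtlas he hy).mdifferentiableAt (by simp)
  rw [← tderiv_comp_apply h1 h2]
  have : (fun x => e (e.symm x)) =ᶠ[𝓝 y] fun x => x := by
    filter_upwards [e.open_target.mem_nhds hy] with x hx using e.right_inv hx
  rw [tderiv_congr this, tderiv_id]; rfl

lemma tderiv_symm_comp_chart [IsManifold 𝓘(ℝ, E) ∞ A]
    (he : e ∈ IsManifold.maximalAtlas 𝓘(ℝ, E) ∞ A) {x : A} (hx : x ∈ e.source) (v : E) :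
    tderiv E E e.symm (e x) (tderiv E E e x v) = v := by
  have h1 := (contMDiffAt_of_mem_maximalAtlas he hx).mdifferentiableAt (by simp)
  have h2 := (contMDiffAt_symm_of_mem_maximalAtlas he (e.map_source hx)).mdifferentiableAt (by simp)
  rw [← tderiv_comp_apply h2 h1]
  have : (fun x => e.symm (e x)) =ᶠ[𝓝 x] fun x => x := by
    filter_upwards [e.open_source.mem_nhds hx] with x hx using e.left_inv hx
  rw [tderiv_congr this, tderiv_id]; rfl

lemma tderiv_chart_symm_comp [IsManifold 𝓘(ℝ, E) ∞ A]
    (he : e ∈ IsManifold.maximalAtlas 𝓘(ℝ, E) ∞ A) {y : E} (hy : y ∈ e.target) (v : E) :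
    tderiv E E e.symm y (tderiv E E e (e.symm y) v) = v := by
  have := tderiv_symm_comp_chart he (e.map_target hy) v
  rwa [e.right_inv hy] at this

/-- The expression of a family of bilinear forms on the tangent spaces in the chart `e`. -/
def coordForm (e : OpenPartialHomeomorph A E) (h : A → E →L[ℝ] E →L[ℝ] ℝ) (y : E) :
    E →L[ℝ] E →L[ℝ] ℝ :=
  (h (e.symm y)).bilinearComp (tderiv E E e.symm y) (tderiv E E e.symm y)

lemma coordForm_apply (e : OpenPartialHomeomorph A E) (h : A → E →L[ℝ] E →L[ℝ] ℝ) (y u v : E) :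
    coordForm e h y u v = h (e.symm y) (tderiv E E e.symm y u) (tderiv E E e.symm y v) := rfl

lemma ContDiffAt.bilinearComp {X V W : Type*} [NormedAddCommGroup X] [NormedSpace ℝ X]
    [NormedAddCommGroup V] [NormedSpace ℝ V] [NormedAddCommGroup W] [NormedSpace ℝ W] {m : ℕ∞ω}
    {h : X → V →L[ℝ] V →L[ℝ] ℝ} {T : X → W →L[ℝ] V} {x : X} (hh : ContDiffAt ℝ m h x)
    (hT : ContDiffAt ℝ m T x) :
    ContDiffAt ℝ m (fun y => (h y).bilinearComp (T y) (T y)) x := by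
  have : (fun y => (h y).bilinearComp (T y) (T y)) =
      fun y => _root_.transposeL (T y) ∘L (h y ∘L T y) := by
    ext y u v; rfl
  rw [this]
  exact hT.transposeL.clm_comp (hh.clm_comp hT)

/-- The two coordinate expressions differ by the smooth transition map and its derivative, so
smoothness need only be checked in one chart. -/
lemma contDiffAt_coordForm_of_chart [IsManifold 𝓘(ℝ, E) ∞ A] {h : A → E →L[ℝ] E →L[ℝ] ℝ}
    {e e' : OpenPartialHomeomorph A E} (he : e ∈ IsManifold.maximalAtlas 𝓘(ℝ, E) ∞ A)
    (he' : e' ∈ IsManifold.maximalAtlas 𝓘(ℝ, E) ∞ A) {x : A} (hx : x ∈ e.source)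
    (hx' : x ∈ e'.source) (hh : ContDiffAt ℝ ∞ (coordForm e h) (e x)) :
    ContDiffAt ℝ ∞ (coordForm e' h) (e' x) := by
  have hτ : ContDiffAt ℝ ∞ (fun y => e (e'.symm y)) (e' x) := by
    rw [← contMDiffAt_iff_contDiffAt]
    refine ContMDiffAt.comp (e' x) (g := e) (f := e'.symm) (I' := 𝓘(ℝ, E)) ?_ ?_
    · rw [e'.left_inv hx']; exact contMDiffAt_of_mem_maximalAtlas he hx
    · exact contMDiffAt_symm_of_mem_maximalAtlas he' (e'.map_source hx')
  have hDτ : ContDiffAt ℝ ∞ (fderiv ℝ (fun y => e (e'.symm y))) (e' x) :=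
    hτ.fderiv_right (by simp)
  have h1 : ContDiffAt ℝ ∞ (fun y => coordForm e h (e (e'.symm y))) (e' x) := by
    refine ContDiffAt.comp (e' x) (g := coordForm e h) ?_ hτ
    rwa [e'.left_inv hx']
  have h2 := h1.bilinearComp hDτ
  have hs : e'.symm ⁻¹' e.source ∈ 𝓝 (e' x) := by
    refine (e'.continuousAt_symm (e'.map_source hx')).preimage_mem_nhds ?_
    rw [e'.left_inv hx']; exact e.open_source.mem_nhds hx
  have h3 : coordForm e' h =ᶠ[𝓝 (e' x)] fun y => (coordForm e h (e (e'.symm y))).bilinearComp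
      (fderiv ℝ (fun y => e (e'.symm y)) y) (fderiv ℝ (fun y => e (e'.symm y)) y) := by
    filter_upwards [hs, e'.open_target.mem_nhds (e'.map_source hx')] with y hy hy'
    ext u v
    have key : ∀ w, tderiv E E e.symm (e (e'.symm y)) (fderiv ℝ (fun y => e (e'.symm y)) y w) =
        tderiv E E e'.symm y w := by
      intro w
      have h1 := (contMDiffAt_of_mem_maximalAtlas he hy).mdifferentiableAt (by simp)
      have h2 := (contMDiffAt_symm_of_mem_maximalAtlas he' hy').mdifferentiableAt (by simp)
      rw [← tderiv_eq_fderiv, tderiv_comp_apply h1 h2, tderiv_symm_comp_chart he hy]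
    rw [ContinuousLinearMap.bilinearComp_apply]
    rw [coordForm_apply, coordForm_apply, key, key, e.left_inv hy]
  exact h2.congr_of_eventuallyEq h3

end TangentDerivative

/-! ### Riemannian metrics as smooth families of inner products -/

section Metrics

/-- On the compact unit sphere `a v v` has a positive lower bound `c`, so `c ‖v‖² ≤ a v v`. This
supplies the boundedness field of a Riemannian metric. -/
lemma IsInner.isVonNBounded {V : Type*} [NormedAddCommGroup V] [NormedSpace ℝ V]
    [FiniteDimensional ℝ V] {a : V →L[ℝ] V →L[ℝ] ℝ} (ha : IsInner a) :
    Bornology.IsVonNBounded ℝ {v : V | a v v < 1} := by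
  have hcont : Continuous fun v => a v v := by fun_prop
  have : ∃ c > 0, ∀ v ∈ Metric.sphere (0 : V) 1, c ≤ a v v := by
    rcases (Metric.sphere (0 : V) 1).eq_empty_or_nonempty with h | h
    · exact ⟨1, one_pos, by simp [h]⟩
    · obtain ⟨v, hv, hmin⟩ := (isCompact_sphere (0 : V) 1).exists_isMinOn h hcont.continuousOn
      exact ⟨a v v, ha.pos v (ne_zero_of_mem_unit_sphere ⟨v, hv⟩), fun w hw => hmin hw⟩
  obtain ⟨c, hc, hcv⟩ := this
  refine (NormedSpace.isVonNBounded_iff ℝ).2 (isBounded_iff_forall_norm_le.2 ⟨√(c⁻¹), ?_⟩)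
  intro v hv
  rcases eq_or_ne v 0 with rfl | hv0
  · simp
  have hn : 0 < ‖v‖ := norm_pos_iff.2 hv0
  have h1 := hcv (‖v‖⁻¹ • v) (by simp [norm_smul, hn.ne'])
  simp only [map_smul, smul_apply, smul_eq_mul] at h1
  refine Real.le_sqrt_of_sq_le ?_
  have h2 : c * ‖v‖ ^ 2 ≤ a v v := by
    have := mul_le_mul_of_nonneg_right h1 (sq_nonneg ‖v‖)
    calc c * ‖v‖ ^ 2 ≤ _ := this
      _ = a v v := by field_simp
  rw [le_inv_comm₀ (by positivity) hc, ← one_div, le_div_iff₀ (by positivity)]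
  exact h2.trans (le_of_lt hv)

variable {n : ℕ} {M : Type*} [TopologicalSpace M] [ChartedSpace (Euc n) M] [IsManifold (𝓡 n) ∞ M]

lemma chartAt_mem_maximalAtlas (x : M) :
    chartAt (Euc n) x ∈ IsManifold.maximalAtlas (𝓡 n) ∞ M :=
  IsManifold.chart_mem_maximalAtlas x

/-- The inner products of a Riemannian metric, as bilinear forms on the model space. -/
def SmoothMetric.toForm (g : SmoothMetric n M) (x : M) : Euc n →L[ℝ] Euc n →L[ℝ] ℝ := g.inner x

lemma SmoothMetric.isInner_toForm (g : SmoothMetric n M) (x : M) : IsInner (g.toForm x) :=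
  ⟨g.symm x, g.pos x⟩

/-- The trivialization of the tangent bundle is inverted by the differential of the inverse chart,
so the bundle expression of a form is its chart expression. -/
lemma eq_inCoordinates (h : M → Euc n →L[ℝ] Euc n →L[ℝ] ℝ) {x₀ x : M}
    (hx : x ∈ (chartAt (Euc n) x₀).source) :
    ContinuousLinearMap.inCoordinates (Euc n) (fun x : M => TangentSpace (𝓡 n) x)
      (Euc n →L[ℝ] ℝ) (fun x : M => TangentSpace (𝓡 n) x →L[ℝ] ℝ) x₀ x x₀ x
      (show TangentSpace (𝓡 n) x →L[ℝ] TangentSpace (𝓡 n) x →L[ℝ] ℝ from h x) =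
      coordForm (chartAt (Euc n) x₀) h (chartAt (Euc n) x₀ x) := by
  ext u v
  rw [coordForm_apply]
  have h1 : x ∈ (trivializationAt (Euc n) (fun x : M => TangentSpace (𝓡 n) x) x₀).baseSet := hx
  have key : ∀ w : Euc n,
      (trivializationAt (Euc n) (fun x : M => TangentSpace (𝓡 n) x) x₀).symm x w =
        tderiv (Euc n) (Euc n) (chartAt (Euc n) x₀).symm (chartAt (Euc n) x₀ x) w := by
    intro w
    have := TangentBundle.symmL_trivializationAt (I := 𝓡 n) hx
    simp only [mfld_simps, mfderivWithin_univ] at this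
    rw [← Bundle.Trivialization.symmL_apply (R := ℝ) _ h1, this]
    rfl
  rw [inCoordinates_apply_eq₂ (E₃ := fun _ : M => ℝ) (F₃ := ℝ) h1 h1 (mem_univ _)]
  rw [key, key, (chartAt (Euc n) x₀).left_inv hx]
  simp
  rfl

/-- The bridge between smoothness of a section of the bundle of forms and ordinary smoothness of its
chart expression, on which `mkMetric` rests. -/
lemma contMDiffAt_form_iff (h : M → Euc n →L[ℝ] Euc n →L[ℝ] ℝ) (x₀ : M) :
    ContMDiffAt (𝓡 n) ((𝓡 n).prod 𝓘(ℝ, Euc n →L[ℝ] Euc n →L[ℝ] ℝ)) ∞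
      (fun x => Bundle.TotalSpace.mk' (Euc n →L[ℝ] Euc n →L[ℝ] ℝ)
        (E := fun x : M => TangentSpace (𝓡 n) x →L[ℝ] TangentSpace (𝓡 n) x →L[ℝ] ℝ) x (h x)) x₀ ↔
      ContDiffAt ℝ ∞ (coordForm (chartAt (Euc n) x₀) h) (chartAt (Euc n) x₀ x₀) := by
  rw [contMDiffAt_hom_bundle]
  have hx₀ := mem_chart_source (Euc n) x₀
  have heq : (fun x => ContinuousLinearMap.inCoordinates (Euc n) (fun x : M => TangentSpace (𝓡 n) x)
      (Euc n →L[ℝ] ℝ) (fun x : M => TangentSpace (𝓡 n) x →L[ℝ] ℝ) x₀ x x₀ x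
      (show TangentSpace (𝓡 n) x →L[ℝ] TangentSpace (𝓡 n) x →L[ℝ] ℝ from h x)) =ᶠ[𝓝 x₀]
      fun x => coordForm (chartAt (Euc n) x₀) h (chartAt (Euc n) x₀ x) := by
    filter_upwards [(chartAt (Euc n) x₀).open_source.mem_nhds hx₀] with x hx
    exact eq_inCoordinates h hx
  have hchart : ContMDiffAt (𝓡 n) (𝓡 n) ∞ (chartAt (Euc n) x₀) x₀ :=
    contMDiffAt_of_mem_maximalAtlas (chartAt_mem_maximalAtlas x₀) hx₀
  have hsymm : ContMDiffAt (𝓡 n) (𝓡 n) ∞ (chartAt (Euc n) x₀).symm (chartAt (Euc n) x₀ x₀) :=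
    contMDiffAt_symm_of_mem_maximalAtlas (chartAt_mem_maximalAtlas x₀)
      ((chartAt (Euc n) x₀).map_source hx₀)
  constructor
  · rintro ⟨-, h2⟩
    have h3 := ContMDiffAt.congr_of_eventuallyEq h2 heq.symm
    rw [← contMDiffAt_iff_contDiffAt]
    have h4 : ContMDiffAt (𝓡 n) 𝓘(ℝ, Euc n →L[ℝ] Euc n →L[ℝ] ℝ) ∞
        (fun y => coordForm (chartAt (Euc n) x₀) h
          (chartAt (Euc n) x₀ ((chartAt (Euc n) x₀).symm y))) (chartAt (Euc n) x₀ x₀) := by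
      refine ContMDiffAt.comp (I' := 𝓡 n) _
        (g := fun x => coordForm (chartAt (Euc n) x₀) h (chartAt (Euc n) x₀ x)) ?_ hsymm
      rw [(chartAt (Euc n) x₀).left_inv hx₀]; exact h3
    refine h4.congr_of_eventuallyEq ?_
    filter_upwards [(chartAt (Euc n) x₀).open_target.mem_nhds
      ((chartAt (Euc n) x₀).map_source hx₀)] with y hy
    rw [(chartAt (Euc n) x₀).right_inv hy]
  · intro h1
    refine ⟨contMDiffAt_id, ContMDiffAt.congr_of_eventuallyEq ?_ heq⟩
    rw [← contMDiffAt_iff_contDiffAt] at h1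
    exact ContMDiffAt.comp (I' := 𝓡 n) (g := coordForm (chartAt (Euc n) x₀) h) x₀ h1 hchart

/-- A smooth family of inner products on the tangent spaces is a Riemannian metric. -/
def mkMetric (h : M → Euc n →L[ℝ] Euc n →L[ℝ] ℝ) (hi : ∀ x, IsInner (h x))
    (hs : ∀ x₀, ContDiffAt ℝ ∞ (coordForm (chartAt (Euc n) x₀) h) (chartAt (Euc n) x₀ x₀)) :
    SmoothMetric n M where
  inner x := h x
  symm x := (hi x).symm
  pos x := (hi x).pos
  isVonNBounded x := (hi x).isVonNBounded
  contMDiff x₀ := (contMDiffAt_form_iff h x₀).2 (hs x₀)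

lemma SmoothMetric.contDiffAt_coordForm (g : SmoothMetric n M)
    {e : OpenPartialHomeomorph M (Euc n)} (he : e ∈ IsManifold.maximalAtlas (𝓡 n) ∞ M) {x : M}
    (hx : x ∈ e.source) : ContDiffAt ℝ ∞ (coordForm e g.toForm) (e x) :=
  contDiffAt_coordForm_of_chart (chartAt_mem_maximalAtlas x) he (mem_chart_source _ x) hx
    ((contMDiffAt_form_iff g.toForm x).1 (g.contMDiff x))

lemma IsInner.coordForm {h : M → Euc n →L[ℝ] Euc n →L[ℝ] ℝ}
    {e : OpenPartialHomeomorph M (Euc n)} (he : e ∈ IsManifold.maximalAtlas (𝓡 n) ∞ M) {y : Euc n}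
    (hy : y ∈ e.target) (hh : IsInner (h (e.symm y))) : IsInner (coordForm e h y) where
  symm v w := hh.symm _ _
  pos v hv := hh.pos _ fun h0 => hv <| by
    have h1 : tderiv (Euc n) (Euc n) e.symm y v = 0 := h0
    have h2 := tderiv_chart_comp_symm he hy v
    rwa [h1, map_zero, eq_comm] at h2

lemma SmoothMetric.ext_toForm {g g' : SmoothMetric n M} (h : ∀ x, g.toForm x = g'.toForm x) :
    g = g' := by
  have : g.inner = g'.inner := funext h
  cases g; cases g'; congr

end Metrics

/-! ### The inclusion of an open subset -/

section OpenSubsets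

variable {E : Type*} [NormedAddCommGroup E] [NormedSpace ℝ E]
  {A : Type*} [TopologicalSpace A] [ChartedSpace E A] [IsManifold 𝓘(ℝ, E) ∞ A]

/-- The preferred chart of `U` at `x` is the restriction of the one of the ambient manifold, and
both have the identity as differential at `x`. -/
lemma tderiv_subtype_val (U : Opens A) (x : U) :
    tderiv E E (Subtype.val : U → A) x = ContinuousLinearMap.id ℝ E := by
  have : IsManifold 𝓘(ℝ, E) 1 A := IsManifold.of_le (n := ∞) (by simp)
  have h1 : MDifferentiableAt 𝓘(ℝ, E) 𝓘(ℝ, E) (chartAt E (x : A)) (x : A) :=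
    mdifferentiableAt_atlas (chart_mem_atlas E _) (mem_chart_source E _)
  have h2 : MDifferentiableAt 𝓘(ℝ, E) 𝓘(ℝ, E) (Subtype.val : U → A) x :=
    (contMDiff_subtype_val (n := ∞)).mdifferentiableAt (by simp)
  have h3 := tderiv_comp h1 h2
  rw [tderiv_chartAt_self, ContinuousLinearMap.id_comp] at h3
  rw [← h3, ← tderiv_chartAt_self x]
  rfl

end OpenSubsets

end

noncomputable section

/-! ### The infinitesimal action and the dimension of orbits -/

section ActionCalculus

variable {d n : ℕ} {G : Type*} [TopologicalSpace G] [ChartedSpace (Euc d) G] [Group G]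
  {M : Type*} [TopologicalSpace M] [ChartedSpace (Euc n) M] [MulAction G M]

variable (d n G) in
/-- The differential at `1` of the orbit map `a ↦ a • x`. -/
def actDeriv (x : M) : Euc d →L[ℝ] Euc n := tderiv (Euc d) (Euc n) (fun a : G => a • x) 1

variable (d) in
/-- The adjoint action of `a`. -/
def adjointMap (a : G) : Euc d →L[ℝ] Euc d := tderiv (Euc d) (Euc d) (fun b : G => a * b * a⁻¹) 1

variable (d) in
/-- The differential at `a` of the right translation by `a⁻¹`. -/
def rightDeriv (a : G) : Euc d →L[ℝ] Euc d := tderiv (Euc d) (Euc d) (fun b : G => b * a⁻¹) a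

variable (n) in
/-- The differential at `x` of the translation by `a`. -/
def transDeriv (a : G) (x : M) : Euc n →L[ℝ] Euc n := tderiv (Euc n) (Euc n) (fun y : M => a • y) x

variable [ContMDiffSMul (𝓡 d) (𝓡 n) ∞ G M]

lemma contMDiff_orbitMap (x : M) : ContMDiff (𝓡 d) (𝓡 n) ∞ (fun a : G => a • x) :=
  contMDiff_id.smul contMDiff_const

variable (d G) in
include d in
lemma contMDiff_translate (a : G) : ContMDiff (𝓡 n) (𝓡 n) ∞ (fun x : M => a • x) :=
  ContMDiffSMul.contMDiff_const_smul (I := 𝓡 d) a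

lemma mdifferentiableAt_orbitMap (x : M) (a : G) :
    MDifferentiableAt (𝓡 d) (𝓡 n) (fun a : G => a • x) a :=
  (contMDiff_orbitMap x).mdifferentiableAt (by simp)

variable (d G) in
include d in
lemma mdifferentiableAt_translate (a : G) (x : M) :
    MDifferentiableAt (𝓡 n) (𝓡 n) (fun x : M => a • x) x :=
  (contMDiff_translate d G a).mdifferentiableAt (by simp)

variable (d) in
include d in
lemma transDeriv_inv_transDeriv (a : G) (x : M) (v : Euc n) :
    transDeriv n a⁻¹ (a • x) (transDeriv n a x v) = v := by
  unfold transDeriv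
  rw [← tderiv_comp_apply (f := fun y : M => a • y)
    (mdifferentiableAt_translate d G _ _) (mdifferentiableAt_translate d G _ _)]
  simp only [inv_smul_smul, tderiv_id, ContinuousLinearMap.id_apply]

variable (d) in
include d in
lemma bijective_transDeriv (a : G) (x : M) : Function.Bijective (transDeriv n a x) := by
  refine Function.bijective_iff_has_inverse.2
    ⟨transDeriv n a⁻¹ (a • x), transDeriv_inv_transDeriv d a x, fun v => ?_⟩
  have := transDeriv_inv_transDeriv d a⁻¹ (a • x) v
  rwa [inv_inv, inv_smul_smul] at this

variable [LieGroup (𝓡 d) ∞ G]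

lemma contMDiff_mul_const (a : G) : ContMDiff (𝓡 d) (𝓡 d) ∞ (fun b : G => b * a) :=
  contMDiff_id.mul contMDiff_const

lemma surjective_rightDeriv (a : G) : Function.Surjective (rightDeriv d a) := by
  intro v
  refine ⟨tderiv (Euc d) (Euc d) (fun b : G => b * a) 1 v, ?_⟩
  have h1 : MDifferentiableAt (𝓡 d) (𝓡 d) (fun b : G => b * a⁻¹) (1 * a) :=
    (contMDiff_mul_const _).mdifferentiableAt (by simp)
  have h2 : MDifferentiableAt (𝓡 d) (𝓡 d) (fun b : G => b * a) 1 :=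
    (contMDiff_mul_const _).mdifferentiableAt (by simp)
  have := tderiv_comp_apply (g := fun b : G => b * a⁻¹) (f := fun b : G => b * a) h1 h2 v
  simp only [mul_inv_cancel_right, tderiv_id, ContinuousLinearMap.id_apply, one_mul] at this
  exact this.symm

/-- Differentiate `b • x = (b a⁻¹) • (a • x)` at `b = a`. All orbit maps are thereby expressed
through their differentials at `1`. -/
lemma tderiv_orbitMap (x : M) (a : G) :
    tderiv (Euc d) (Euc n) (fun b : G => b • x) a = actDeriv d n G (a • x) ∘L rightDeriv d a := by
  have h1 : MDifferentiableAt (𝓡 d) (𝓡 n) (fun b : G => b • (a • x)) (a * a⁻¹) :=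
    mdifferentiableAt_orbitMap _ _
  have h2 : MDifferentiableAt (𝓡 d) (𝓡 d) (fun b : G => b * a⁻¹) a :=
    (contMDiff_mul_const _).mdifferentiableAt (by simp)
  have := tderiv_comp (g := fun b : G => b • (a • x)) (f := fun b : G => b * a⁻¹) h1 h2
  simp only [← mul_smul, inv_mul_cancel_right] at this
  simp only [mul_inv_cancel, mul_smul] at this
  exact this

/-- Differentiate `a • (b • x) = (a b a⁻¹) • (a • x)` at `b = 1`. -/
lemma transDeriv_actDeriv (a : G) (x : M) (v : Euc d) :
    transDeriv n a x (actDeriv d n G x v) = actDeriv d n G (a • x) (adjointMap d a v) := by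
  have h1 : MDifferentiableAt (𝓡 n) (𝓡 n) (fun y : M => a • y) ((1 : G) • x) :=
    mdifferentiableAt_translate d G _ _
  have h2 := tderiv_comp_apply (g := fun y : M => a • y) (f := fun b : G => b • x) h1
    (mdifferentiableAt_orbitMap (d := d) x (1 : G)) v
  have h3 : MDifferentiableAt (𝓡 d) (𝓡 n) (fun b : G => b • (a • x)) (a * 1 * a⁻¹) :=
    mdifferentiableAt_orbitMap _ _
  have h4 : MDifferentiableAt (𝓡 d) (𝓡 d) (fun b : G => a * b * a⁻¹) 1 :=
    ((contMDiff_const.mul contMDiff_id).mul contMDiff_const).mdifferentiableAt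
      (n := ∞) (by simp)
  have h5 := tderiv_comp_apply (g := fun b : G => b • (a • x)) (f := fun b : G => a * b * a⁻¹)
    h3 h4 v
  simp only [← mul_smul, inv_mul_cancel_right] at h2 h5
  simp only [mul_one, mul_inv_cancel, one_smul] at h2 h5
  unfold transDeriv actDeriv adjointMap
  rw [← h2, h5]
  simp only [mul_smul]

variable (d n G) in
/-- The dimension of the orbit of `x`. -/
def orbitRank (x : M) : ℕ := Module.finrank ℝ (LinearMap.range (actDeriv d n G x).toLinearMap)

lemma surjective_adjointMap (a : G) : Function.Surjective (adjointMap d a) := by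
  intro v
  have hd : ∀ (a c : G), MDifferentiableAt (𝓡 d) (𝓡 d) (fun b : G => a * b * a⁻¹) c := fun a c =>
    ((contMDiff_const.mul contMDiff_id).mul contMDiff_const).mdifferentiableAt
      (n := ∞) (by simp)
  refine ⟨adjointMap d a⁻¹ v, ?_⟩
  have h3 := tderiv_comp_apply (g := fun b : G => a * b * a⁻¹) (f := fun b : G => a⁻¹ * b * a⁻¹⁻¹)
    (hd a _) (hd a⁻¹ 1) v
  have h4 : (fun b : G => a * (a⁻¹ * b * a⁻¹⁻¹) * a⁻¹) = fun b => b := by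
    ext b; group
  rw [h4, tderiv_id] at h3
  simp only [mul_one, inv_inv, inv_mul_cancel, ContinuousLinearMap.id_apply] at h3
  unfold adjointMap
  simpa only [inv_inv] using h3.symm

lemma range_actDeriv_smul (a : G) (x : M) :
    LinearMap.range (actDeriv d n G (a • x)).toLinearMap =
      (LinearMap.range (actDeriv d n G x).toLinearMap).map (transDeriv n a x).toLinearMap := by
  ext u
  simp only [LinearMap.mem_range, Submodule.mem_map, ContinuousLinearMap.coe_coe]
  constructor
  · rintro ⟨v, rfl⟩
    obtain ⟨w, rfl⟩ := surjective_adjointMap a v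
    exact ⟨_, ⟨w, rfl⟩, transDeriv_actDeriv a x w⟩
  · rintro ⟨_, ⟨w, rfl⟩, rfl⟩
    exact ⟨_, (transDeriv_actDeriv a x w).symm⟩

lemma orbitRank_smul (a : G) (x : M) : orbitRank d n G (a • x) = orbitRank d n G x := by
  unfold orbitRank
  rw [range_actDeriv_smul]
  exact (LinearEquiv.finrank_eq (Submodule.equivMapOfInjective _
    (bijective_transDeriv d a x).1 _)).symm

variable [IsManifold (𝓡 n) ∞ M]

/-- The infinitesimal action in the chart `e`. -/
def coordAct (d G) [TopologicalSpace G] [ChartedSpace (Euc d) G] [Group G] [MulAction G M]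
    (e : OpenPartialHomeomorph M (Euc n)) (y : Euc n) : Euc d →L[ℝ] Euc n :=
  tderiv (Euc n) (Euc n) e (e.symm y) ∘L actDeriv d n G (e.symm y)

variable (d G) in
lemma tderiv_symm_coordAct {e : OpenPartialHomeomorph M (Euc n)}
    (he : e ∈ IsManifold.maximalAtlas (𝓡 n) ∞ M) {y : Euc n} (hy : y ∈ e.target) (v : Euc d) :
    tderiv (Euc n) (Euc n) e.symm y (coordAct d G e y v) = actDeriv d n G (e.symm y) v :=
  tderiv_chart_symm_comp he hy _

/-- The action near `1` in the chart `e`. -/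
def localAct (d G) [TopologicalSpace G] [ChartedSpace (Euc d) G] [Group G] [MulAction G M]
    (e : OpenPartialHomeomorph M (Euc n)) (p : Euc d × Euc n) : Euc n :=
  e ((chartAt (Euc d) (1 : G)).symm p.1 • e.symm p.2)

variable (d G) in
lemma contDiffAt_localAct_of_mem {e : OpenPartialHomeomorph M (Euc n)}
    (he : e ∈ IsManifold.maximalAtlas (𝓡 n) ∞ M) {p : Euc d × Euc n}
    (hc : p.1 ∈ (chartAt (Euc d) (1 : G)).target) (hy : p.2 ∈ e.target)
    (hs : (chartAt (Euc d) (1 : G)).symm p.1 • e.symm p.2 ∈ e.source) :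
    ContDiffAt ℝ ∞ (localAct d G e) p := by
  rw [← contMDiffAt_iff_contDiffAt]
  have h1 : ContMDiffAt 𝓘(ℝ, Euc d × Euc n) (𝓡 d) ∞
      (fun p : Euc d × Euc n => (chartAt (Euc d) (1 : G)).symm p.1) p := by
    refine ContMDiffAt.comp (I' := 𝓡 d) (g := (chartAt (Euc d) (1 : G)).symm) _ ?_
      contDiff_fst.contMDiff.contMDiffAt
    exact contMDiffAt_symm_of_mem_maximalAtlas (IsManifold.chart_mem_maximalAtlas _) hc
  have h2 : ContMDiffAt 𝓘(ℝ, Euc d × Euc n) (𝓡 n) ∞ (fun p : Euc d × Euc n => e.symm p.2) p := by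
    refine ContMDiffAt.comp (I' := 𝓡 n) (g := e.symm) _ ?_ contDiff_snd.contMDiff.contMDiffAt
    exact contMDiffAt_symm_of_mem_maximalAtlas he hy
  exact ContMDiffAt.comp (I' := 𝓡 n) (g := e) _ (contMDiffAt_of_mem_maximalAtlas he hs) (h1.smul h2)

lemma chartAt_one_symm_smul (x : M) :
    (chartAt (Euc d) (1 : G)).symm (chartAt (Euc d) (1 : G) 1) • x = x := by
  rw [(chartAt (Euc d) (1 : G)).left_inv (mem_chart_source _ _), one_smul]

variable (d G) in
lemma contDiffAt_localAct {e : OpenPartialHomeomorph M (Euc n)}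
    (he : e ∈ IsManifold.maximalAtlas (𝓡 n) ∞ M) {y : Euc n} (hy : y ∈ e.target) :
    ContDiffAt ℝ ∞ (localAct d G e) (chartAt (Euc d) (1 : G) 1, y) :=
  contDiffAt_localAct_of_mem d G he (mem_chart_target _ _) hy
    (by rw [chartAt_one_symm_smul]; exact e.map_target hy)

variable (d G) in
-- The infinitesimal action becomes a partial derivative of one smooth map of `(a, y)`, which makes
-- its smooth dependence on `y` visible.
lemma coordAct_eq_fderiv {e : OpenPartialHomeomorph M (Euc n)}
    (he : e ∈ IsManifold.maximalAtlas (𝓡 n) ∞ M) {y : Euc n} (hy : y ∈ e.target) :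
    coordAct d G e y = fderiv ℝ (localAct d G e) (chartAt (Euc d) (1 : G) 1, y) ∘L
      ContinuousLinearMap.inl ℝ (Euc d) (Euc n) := by
  have h0 := (contDiffAt_localAct d G he hy).differentiableAt (by simp)
  set c := chartAt (Euc d) (1 : G) with hc
  have hc1 : c.symm (c 1) = 1 := c.left_inv (mem_chart_source _ _)
  have hcm : c ∈ IsManifold.maximalAtlas (𝓡 d) ∞ G := IsManifold.chart_mem_maximalAtlas _
  have h1 : fderiv ℝ (localAct d G e) (c 1, y) ∘L ContinuousLinearMap.inl ℝ (Euc d) (Euc n) =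
      fderiv ℝ (fun u => localAct d G e (u, y)) (c 1) := by
    have h2 : HasFDerivAt (fun u : Euc d => (u, y)) (ContinuousLinearMap.inl ℝ (Euc d) (Euc n))
      (c 1) := hasFDerivAt_prodMk_left _ _
    exact (h0.hasFDerivAt.comp (c 1) h2).fderiv.symm
  rw [h1, ← tderiv_eq_fderiv]
  have h3 : MDifferentiableAt (𝓡 n) (𝓡 n) e ((1 : G) • e.symm y) := by
    rw [one_smul]
    exact (contMDiffAt_of_mem_maximalAtlas he (e.map_target hy)).mdifferentiableAt (by simp)
  have h4 : MDifferentiableAt (𝓡 d) (𝓡 n) (fun a : G => e (a • e.symm y)) (c.symm (c 1)) := by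
    rw [hc1]
    exact MDifferentiableAt.comp (1 : G) h3 (mdifferentiableAt_orbitMap (d := d) (e.symm y) 1)
  have h5 : MDifferentiableAt (𝓡 d) (𝓡 d) c.symm (c 1) :=
    (contMDiffAt_symm_of_mem_maximalAtlas hcm
      (c.map_source (mem_chart_source _ _))).mdifferentiableAt (by simp)
  -- The chart at `1` has identity differential at its own base point, so no correction factor
  -- appears.
  have h6 : tderiv (Euc d) (Euc d) c.symm (c 1) = ContinuousLinearMap.id ℝ _ := by
    have : IsManifold (𝓡 d) 1 G := IsManifold.of_le (n := ∞) (by simp)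
    ext1 v
    have := tderiv_symm_comp_chart hcm (mem_chart_source _ (1 : G)) v
    rwa [hc, tderiv_chartAt_self] at this
  have h7 : (fun u => localAct d G e (u, y)) = fun u => e ((c.symm u : G) • e.symm y) := rfl
  rw [h7, tderiv_comp (g := fun a : G => e (a • e.symm y)) h4 h5, h6, ContinuousLinearMap.comp_id,
    hc1, tderiv_comp (g := e) (f := fun a : G => a • e.symm y) h3
      (mdifferentiableAt_orbitMap (d := d) (e.symm y) 1), one_smul]
  rfl

variable (d G) in
lemma contDiffAt_coordAct {e : OpenPartialHomeomorph M (Euc n)}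
    (he : e ∈ IsManifold.maximalAtlas (𝓡 n) ∞ M) {y : Euc n} (hy : y ∈ e.target) :
    ContDiffAt ℝ ∞ (coordAct d G e) y := by
  have h1 : ContDiffAt ℝ ∞ (fderiv ℝ (localAct d G e)) (chartAt (Euc d) (1 : G) 1, y) :=
    (contDiffAt_localAct d G he hy).fderiv_right (by simp)
  have h2 : ContDiffAt ℝ ∞ (fun y => fderiv ℝ (localAct d G e) (chartAt (Euc d) (1 : G) 1, y) ∘L
      ContinuousLinearMap.inl ℝ (Euc d) (Euc n)) y := by
    refine ContDiffAt.clm_comp ?_ contDiffAt_const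
    exact h1.comp y (contDiffAt_const.prodMk contDiffAt_id)
  refine h2.congr_of_eventuallyEq ?_
  filter_upwards [e.open_target.mem_nhds hy] with z hz
  exact coordAct_eq_fderiv d G he hz

/-- The orbit map of `x` is constant along the flow of a left-invariant vector field generated by
an element of the kernel of its differential. Therefore this kernel depends monotonically on the
isotropy group. -/
lemma actDeriv_eq_zero_of_stabilizer_le {x z : M}
    (h : MulAction.stabilizer G x ≤ MulAction.stabilizer G z) {v : Euc d}
    (hv : actDeriv d n G x v = 0) : actDeriv d n G z v = 0 := by
  have : LieGroup (𝓡 d) (minSmoothness ℝ 3) G := by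
    rw [minSmoothness_of_isRCLikeNormedField]
    exact LieGroup.of_le (n := ∞) (m := 3) (by norm_cast)
  have hX : ContMDiffAt (𝓡 d) (𝓡 d).tangent 1
      (fun a : G => (mulInvariantVectorField (I := 𝓡 d) v a : TangentBundle (𝓡 d) G)) 1 := by
    refine (contMDiffAt_mulInvariantVectorField (I := 𝓡 d) (G := G) v).of_le ?_
    rw [minSmoothness_of_isRCLikeNormedField]
    exact one_le_two
  have : IsManifold (𝓡 d) 1 G := IsManifold.of_le (n := ∞) (by simp)
  -- A local integral curve of the left-invariant field takes the place of the one-parameter group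
  -- of `v`.
  obtain ⟨γ, hγ0, hγ⟩ := exists_isMIntegralCurveAt_of_contMDiffAt_boundaryless (t₀ := 0) hX
  have hder : ∀ᶠ t in 𝓝 (0 : ℝ), HasMFDerivAt 𝓘(ℝ, ℝ) (𝓡 d) γ t
      ((1 : ℝ →L[ℝ] ℝ).smulRight (mulInvariantVectorField (I := 𝓡 d) v (γ t))) := hγ
  -- Left invariance turns the velocity of `γ t • z` into the translate by `γ t` of the velocity at
  -- `z`. The range of `t` does not depend on `z`, so the formula serves both `x` and the given `z`.
  have hcomp : ∀ᶠ t in 𝓝 (0 : ℝ), ∀ z : M, tderiv ℝ (Euc n) (fun t => γ t • z) t 1 =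
      transDeriv n (γ t) z (actDeriv d n G z v) := by
    filter_upwards [hder] with t ht z
    have h1 := tderiv_comp_apply (g := fun b : G => b • z) (f := γ)
      (mdifferentiableAt_orbitMap (d := d) (n := n) z (γ t))
      ht.mdifferentiableAt 1
    have h2 : tderiv ℝ (Euc d) γ t 1 = tderiv (Euc d) (Euc d) (fun b : G => γ t * b) 1 v := by
      have := ht.mfderiv
      change (mfderiv 𝓘(ℝ, ℝ) (𝓡 d) γ t : ℝ →L[ℝ] Euc d) 1 = _
      rw [this]
      change (1 : ℝ) • (tderiv (Euc d) (Euc d) (fun b : G => γ t * b) 1 v) = _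
      rw [one_smul]
    have h3 : MDifferentiableAt (𝓡 d) (𝓡 n) (fun b : G => b • z) (γ t * 1) :=
      mdifferentiableAt_orbitMap _ _
    have h4 : MDifferentiableAt (𝓡 d) (𝓡 d) (fun b : G => γ t * b) 1 :=
      (contMDiff_const.mul contMDiff_id).mdifferentiableAt (n := ∞) (by simp)
    have h5 := tderiv_comp_apply (g := fun b : G => b • z) (f := fun b : G => γ t * b) h3 h4 v
    have h6 : MDifferentiableAt (𝓡 n) (𝓡 n) (fun y : M => γ t • y) ((1 : G) • z) :=
      mdifferentiableAt_translate d G _ _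
    have h7 := tderiv_comp_apply (g := fun y : M => γ t • y) (f := fun b : G => b • z) h6
      (mdifferentiableAt_orbitMap (d := d) z (1 : G)) v
    simp only [← mul_smul] at h7
    rw [mul_one] at h5
    rw [one_smul] at h7
    rw [h1, h2, ← h5, h7]
    rfl
  have hcont : ContinuousAt γ 0 := hγ.hasMFDerivAt.continuousAt
  -- the curve stays in the isotropy group of `x`
  have hstab : ∀ᶠ t in 𝓝 (0 : ℝ), γ t • x = x := by
    set e := chartAt (Euc n) x
    have he : e ∈ IsManifold.maximalAtlas (𝓡 n) ∞ M := IsManifold.chart_mem_maximalAtlas _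
    have hcx : ContinuousAt (fun t => γ t • x) 0 :=
      ((contMDiff_orbitMap (d := d) (n := n) x).continuous.continuousAt (x := γ 0)).comp hcont
    have hmem : ∀ᶠ t in 𝓝 (0 : ℝ), γ t • x ∈ e.source := by
      refine hcx.eventually (e.open_source.mem_nhds ?_)
      change γ 0 • x ∈ e.source
      rw [hγ0, one_smul]; exact mem_chart_source _ _
    have hall := hcomp.and (hder.and hmem)
    obtain ⟨ε, hε, hball⟩ := Metric.eventually_nhds_iff_ball.1 hall
    have hd : ∀ t ∈ Metric.ball (0 : ℝ) ε, HasDerivAt (fun t => e (γ t • x)) 0 t := by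
      intro t ht
      obtain ⟨h1, h2, h3⟩ := hball t ht
      have h4 : MDifferentiableAt 𝓘(ℝ, ℝ) (𝓡 n) (fun t => γ t • x) t :=
        MDifferentiableAt.comp (I' := 𝓡 d) t (mdifferentiableAt_orbitMap (d := d) x (γ t))
          h2.mdifferentiableAt
      have h5 : MDifferentiableAt (𝓡 n) (𝓡 n) e (γ t • x) :=
        (contMDiffAt_of_mem_maximalAtlas he h3).mdifferentiableAt (by simp)
      have h6 : MDifferentiableAt 𝓘(ℝ, ℝ) (𝓡 n) (fun t => e (γ t • x)) t :=
        MDifferentiableAt.comp (I' := 𝓡 n) t h5 h4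
      have h7 := tderiv_comp_apply (g := e) (f := fun t => γ t • x) h5 h4 1
      rw [h1, hv, map_zero, map_zero, tderiv_eq_fderiv] at h7
      have h8 := (mdifferentiableAt_iff_differentiableAt.1 h6).hasDerivAt
      rwa [← fderiv_apply_one_eq_deriv, h7] at h8
    have hconst : ∀ t ∈ Metric.ball (0 : ℝ) ε, e (γ t • x) = e (γ 0 • x) := by
      intro t ht
      refine (convex_ball (0 : ℝ) ε).is_const_of_fderivWithin_eq_zero (𝕜 := ℝ)
        (f := fun t => e (γ t • x)) (fun s hs => (hd s hs).differentiableAt.differentiableWithinAt)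
        (fun s hs => ?_) ht (Metric.mem_ball_self hε)
      rw [fderivWithin_of_isOpen Metric.isOpen_ball hs, (hd s hs).hasFDerivAt.fderiv]
      ext; simp
    filter_upwards [Metric.ball_mem_nhds (0 : ℝ) hε] with t ht
    have := e.injOn (hball t ht).2.2 (hball 0 (Metric.mem_ball_self hε)).2.2 (hconst t ht)
    rw [this, hγ0, one_smul]
  -- For small `t` the curve lies in the isotropy group of `x`, hence in that of `z`; its velocity
  -- at `t = 0` on `z` is therefore zero.
  have hz : (fun t => γ t • z) =ᶠ[𝓝 (0 : ℝ)] fun _ => z := by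
    filter_upwards [hstab] with t ht using h ht
  have h1 := hcomp.self_of_nhds z
  rw [tderiv_congr hz, tderiv_const, hγ0] at h1
  refine (bijective_transDeriv d (1 : G) z).1 ?_
  rw [← h1, map_zero]
  rfl

lemma orbitRank_le_of_stabilizer_le {x z : M}
    (h : MulAction.stabilizer G x ≤ MulAction.stabilizer G z) :
    orbitRank d n G z ≤ orbitRank d n G x := by
  have hk : LinearMap.ker (actDeriv d n G x).toLinearMap ≤
      LinearMap.ker (actDeriv d n G z).toLinearMap :=
    fun v hv => actDeriv_eq_zero_of_stabilizer_le h hv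
  have h1 := LinearMap.finrank_range_add_finrank_ker (actDeriv d n G x).toLinearMap
  have h2 := LinearMap.finrank_range_add_finrank_ker (actDeriv d n G z).toLinearMap
  have h3 := Submodule.finrank_mono hk
  unfold orbitRank
  omega

/-- The conjugate of the isotropy group of `x` inside that of `y` is the isotropy group of `a • x`,
and the rank is constant along the orbit of `x`. -/
lemma orbitRank_le_of_mem_regularPart {x : M} (hx : x ∈ regularPart G M) (y : M) :
    orbitRank d n G y ≤ orbitRank d n G x := by
  obtain ⟨a, ha⟩ := hx y
  rw [← MulAction.stabilizer_smul_eq_stabilizer_map_conj] at ha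
  exact (orbitRank_le_of_stabilizer_le ha).trans (orbitRank_smul a x).le

end ActionCalculus

end

noncomputable section

/-! ### Orthogonal projections onto ranges of constant rank -/

section OrthogonalProjection

variable {E : Type*} [NormedAddCommGroup E] [NormedSpace ℝ E] [FiniteDimensional ℝ E]
  {R : Type*} [NormedAddCommGroup R] [NormedSpace ℝ R] [FiniteDimensional ℝ R]

/-- `P` is the `a`-orthogonal projection onto `T`. -/
structure IsOrthProj (a : E →L[ℝ] E →L[ℝ] ℝ) (T : Submodule ℝ E) (P : E → E) : Prop where
  mem (u : E) : P u ∈ T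
  orth (u t : E) (ht : t ∈ T) : a (u - P u) t = 0

omit [FiniteDimensional ℝ E] in
lemma IsOrthProj.eq {a : E →L[ℝ] E →L[ℝ] ℝ} (ha : IsInner a) {T : Submodule ℝ E} {P P' : E → E}
    (hP : IsOrthProj a T P) (hP' : IsOrthProj a T P') (u : E) : P u = P' u := by
  have h : P u - P' u ∈ T := T.sub_mem (hP.mem u) (hP'.mem u)
  refine sub_eq_zero.1 (ha.eq_zero ?_)
  have h1 := hP.orth u _ h
  have h2 := hP'.orth u _ h
  have h3 : P u - P' u = (u - P' u) - (u - P u) := by abel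
  calc a (P u - P' u) (P u - P' u) = a ((u - P' u) - (u - P u)) (P u - P' u) := by rw [← h3]
    _ = a (u - P' u) (P u - P' u) - a (u - P u) (P u - P' u) := by
      rw [map_sub a, sub_apply]
    _ = 0 := by rw [h1, h2, sub_zero]

/-- The orthogonal projection onto the range of the injective map `Ψ`. -/
def rangeProj (a : E →L[ℝ] E →L[ℝ] ℝ) (Ψ : R →L[ℝ] E) : E →L[ℝ] E :=
  Ψ ∘L (a.bilinearComp Ψ Ψ).inverse ∘L transposeL Ψ ∘L a

omit [FiniteDimensional ℝ E] [FiniteDimensional ℝ R] in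
lemma IsInner.bilinearComp {a : E →L[ℝ] E →L[ℝ] ℝ} (ha : IsInner a) {Ψ : R →L[ℝ] E}
    (hΨ : Function.Injective Ψ) : IsInner (a.bilinearComp Ψ Ψ) where
  symm _ _ := ha.symm _ _
  pos v hv := ha.pos (Ψ v) fun h => hv (hΨ (h.trans (map_zero Ψ).symm))

lemma isOrthProj_rangeProj {a : E →L[ℝ] E →L[ℝ] ℝ} (ha : IsInner a) {Ψ : R →L[ℝ] E}
    (hΨ : Function.Injective Ψ) :
    IsOrthProj a (LinearMap.range Ψ.toLinearMap) (rangeProj a Ψ) where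
  mem u := ⟨_, rfl⟩
  orth u t ht := by
    obtain ⟨r, rfl⟩ := ht
    have h1 := (ha.bilinearComp hΨ).apply_inverse (transposeL Ψ (a u))
    have h2 := DFunLike.congr_fun h1 r
    change a (rangeProj a Ψ u) (Ψ r) = a u (Ψ r) at h2
    rw [map_sub, sub_apply, sub_eq_zero]
    exact h2.symm

/-- The `a`-orthogonal projection onto `T`. -/
def orthProj (a : E →L[ℝ] E →L[ℝ] ℝ) (T : Submodule ℝ E) : E →L[ℝ] E := rangeProj a T.subtypeL

lemma isOrthProj_orthProj {a : E →L[ℝ] E →L[ℝ] ℝ} (ha : IsInner a) (T : Submodule ℝ E) :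
    IsOrthProj a T (orthProj a T) := by
  have := isOrthProj_rangeProj ha (Ψ := T.subtypeL) T.injective_subtype
  rwa [show LinearMap.range (T.subtypeL).toLinearMap = T from T.range_subtype] at this

lemma IsOrthProj.apply_of_mem {a : E →L[ℝ] E →L[ℝ] ℝ} (ha : IsInner a) {T : Submodule ℝ E}
    {P : E → E} (hP : IsOrthProj a T P) {t : E} (ht : t ∈ T) : P t = t := by
  have h := hP.orth t (t - P t) (T.sub_mem ht (hP.mem t))
  exact (sub_eq_zero.1 (ha.eq_zero h)).symm

/-- Orthogonal projections onto the ranges of a smooth family of linear maps of constant rank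
vary smoothly. -/
lemma ContDiffAt.orthProj_range {X A : Type*} [NormedAddCommGroup X] [NormedSpace ℝ X]
    [NormedAddCommGroup A] [NormedSpace ℝ A] [FiniteDimensional ℝ A] {m : ℕ∞ω}
    {Φ : X → A →L[ℝ] E} {a : X → E →L[ℝ] E →L[ℝ] ℝ} {x₀ : X} (hΦ : ContDiffAt ℝ m Φ x₀)
    (ha : ContDiffAt ℝ m a x₀) (hi : ∀ᶠ x in 𝓝 x₀, IsInner (a x))
    (hr : ∀ᶠ x in 𝓝 x₀, Module.finrank ℝ (LinearMap.range (Φ x).toLinearMap) ≤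
      Module.finrank ℝ (LinearMap.range (Φ x₀).toLinearMap)) :
    ContDiffAt ℝ m (fun x => orthProj (a x) (LinearMap.range (Φ x).toLinearMap)) x₀ := by
  -- On a complement of the kernel at `x₀` the map is injective, and it stays so nearby; this gives
  -- an explicit smooth projection `rangeProj`.
  obtain ⟨K, hK⟩ := (LinearMap.ker (Φ x₀).toLinearMap).exists_isCompl
  have hinj : Function.Injective (Φ x₀ ∘L K.subtypeL) := by
    refine (injective_iff_map_eq_zero _).2 fun v hv => ?_
    have h1 : (v : A) ∈ LinearMap.ker (Φ x₀).toLinearMap ⊓ K := ⟨hv, v.2⟩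
    rw [hK.inf_eq_bot] at h1
    exact Subtype.ext h1
  have hcomp : ContDiffAt ℝ m (fun x => Φ x ∘L K.subtypeL) x₀ := hΦ.clm_comp contDiffAt_const
  have hinj' : ∀ᶠ x in 𝓝 x₀, Function.Injective (Φ x ∘L K.subtypeL) :=
    hcomp.continuousAt.eventually (ContinuousLinearMap.isOpen_injective.mem_nhds hinj)
  have hbil : ContDiffAt ℝ m
      (fun x => (a x).bilinearComp (Φ x ∘L K.subtypeL) (Φ x ∘L K.subtypeL)) x₀ :=
    ha.bilinearComp hcomp
  have hsm : ContDiffAt ℝ m (fun x => rangeProj (a x) (Φ x ∘L K.subtypeL)) x₀ :=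
    hcomp.clm_comp ((hbil.clm_inverse
      (hi.self_of_nhds.bilinearComp hinj).isInvertible).clm_comp (hcomp.transposeL.clm_comp ha))
  refine hsm.congr_of_eventuallyEq ?_
  filter_upwards [hi, hr, hinj'] with x hix hrx hjx
  have hdim : Module.finrank ℝ K = Module.finrank ℝ (LinearMap.range (Φ x₀).toLinearMap) := by
    have h1 := LinearMap.finrank_range_add_finrank_ker (Φ x₀).toLinearMap
    have h2 := Submodule.finrank_add_eq_of_isCompl hK
    omega
  have hle : LinearMap.range (Φ x ∘L K.subtypeL).toLinearMap ≤
      LinearMap.range (Φ x).toLinearMap := by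
    rintro _ ⟨v, rfl⟩; exact ⟨v, rfl⟩
  -- The restricted range already has the rank at `x₀`, which by hypothesis is an upper bound for
  -- the rank at `x`; so nothing is lost by restricting.
  have heq : LinearMap.range (Φ x ∘L K.subtypeL).toLinearMap =
      LinearMap.range (Φ x).toLinearMap := by
    refine Submodule.eq_of_le_of_finrank_le hle ?_
    rw [LinearMap.finrank_range_of_inj (f := (Φ x ∘L K.subtypeL).toLinearMap) hjx, hdim]
    exact hrx
  ext1 u
  refine (isOrthProj_orthProj hix _).eq hix ?_ u
  rw [← heq]
  exact isOrthProj_rangeProj hix hjx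

end OrthogonalProjection

/-! ### The rescaled Cheeger form as a quotient that extends to `l = 0` -/

section RescaledForms

variable {A : Type*} [NormedAddCommGroup A] [NormedSpace ℝ A]
  {E : Type*} [NormedAddCommGroup E] [NormedSpace ℝ E]

/-- The orthogonal sum of two bilinear forms. -/
def prodForm (b : A →L[ℝ] A →L[ℝ] ℝ) (a : E →L[ℝ] E →L[ℝ] ℝ) :
    (A × E) →L[ℝ] (A × E) →L[ℝ] ℝ :=
  b.bilinearComp (ContinuousLinearMap.fst ℝ A E) (ContinuousLinearMap.fst ℝ A E) +
    a.bilinearComp (ContinuousLinearMap.snd ℝ A E) (ContinuousLinearMap.snd ℝ A E)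

@[simp]
lemma prodForm_apply (b : A →L[ℝ] A →L[ℝ] ℝ) (a : E →L[ℝ] E →L[ℝ] ℝ) (p q : A × E) :
    prodForm b a p q = b p.1 q.1 + a p.2 q.2 := rfl

lemma IsInner.prodForm {b : A →L[ℝ] A →L[ℝ] ℝ} {a : E →L[ℝ] E →L[ℝ] ℝ} (hb : IsInner b)
    (ha : IsInner a) : IsInner (prodForm b a) where
  symm v w := by simp [hb.symm v.1, ha.symm v.2]
  pos v hv := by
    rw [prodForm_apply]
    rcases eq_or_ne v.1 0 with h | h
    · have h2 : v.2 ≠ 0 := fun h2 => hv (Prod.ext h h2)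
      have := ha.pos _ h2
      have := hb.nonneg v.1
      linarith
    · have := hb.pos _ h
      have := ha.nonneg v.2
      linarith

lemma IsInner.smul {b : A →L[ℝ] A →L[ℝ] ℝ} (hb : IsInner b) {c : ℝ} (hc : 0 < c) :
    IsInner (c • b) where
  symm v w := by simp [hb.symm v]
  pos v hv := by
    have := hb.pos v hv
    simp only [smul_apply, smul_eq_mul]
    positivity

lemma ContDiffAt.prodForm {X : Type*} [NormedAddCommGroup X] [NormedSpace ℝ X] {m : ℕ∞ω}
    (b : A →L[ℝ] A →L[ℝ] ℝ) {a : X → E →L[ℝ] E →L[ℝ] ℝ} {x : X} (ha : ContDiffAt ℝ m a x) :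
    ContDiffAt ℝ m (fun y => prodForm b (a y)) x :=
  contDiffAt_const.add (ha.bilinearComp contDiffAt_const)

variable [FiniteDimensional ℝ A] [FiniteDimensional ℝ E]

/-- The linear map `(v, u) ↦ Φ v + l P u + (u - P u)`, where `P` is the orthogonal projection onto
the range of `Φ`. -/
def tildeMap (Φ : A →L[ℝ] E) (a : E →L[ℝ] E →L[ℝ] ℝ) (l : ℝ) : (A × E) →L[ℝ] E :=
  Φ.coprod (l • orthProj a (LinearMap.range Φ.toLinearMap) +
    (ContinuousLinearMap.id ℝ E - orthProj a (LinearMap.range Φ.toLinearMap)))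

omit [FiniteDimensional ℝ A] [FiniteDimensional ℝ E] in
lemma tildeMap_apply (Φ : A →L[ℝ] E) (a : E →L[ℝ] E →L[ℝ] ℝ) (l : ℝ) (p : A × E) :
    tildeMap Φ a l p = Φ p.1 + (l • orthProj a (LinearMap.range Φ.toLinearMap) p.2 +
      (p.2 - orthProj a (LinearMap.range Φ.toLinearMap) p.2)) := rfl

/-- The rescaled inner products, as quotient forms. -/
def tildeForm (b : A →L[ℝ] A →L[ℝ] ℝ) (Φ : A →L[ℝ] E) (a : E →L[ℝ] E →L[ℝ] ℝ) (l : ℝ) :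
    E →L[ℝ] E →L[ℝ] ℝ :=
  quotForm (tildeMap Φ a l) (prodForm b a)

variable {b : A →L[ℝ] A →L[ℝ] ℝ} {Φ : A →L[ℝ] E} {a : E →L[ℝ] E →L[ℝ] ℝ}

/-- The summand `Φ` reaches `P u`, and `u - P u` is fixed whatever `l` is. The value `l = 0` is
allowed, which is the point of this presentation. -/
lemma surjective_tildeMap (ha : IsInner a) (l : ℝ) : Function.Surjective (tildeMap Φ a l) := by
  intro u
  have hP := isOrthProj_orthProj ha (LinearMap.range Φ.toLinearMap)
  set P := orthProj a (LinearMap.range Φ.toLinearMap) with hPdef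
  obtain ⟨v, hv⟩ := hP.mem u
  refine ⟨(v, u - P u), ?_⟩
  have hPP : P (P u) = P u := hP.apply_of_mem ha (hP.mem u)
  have hv' : Φ v = P u := hv
  rw [tildeMap_apply, ← hPdef]
  simp only [map_sub, hPP, hv']
  simp

lemma isInner_tildeForm (hb : IsInner b) (ha : IsInner a) (l : ℝ) :
    IsInner (tildeForm b Φ a l) :=
  isInner_quotForm (hb.prodForm ha) (surjective_tildeMap ha l)

/-- The vector `(v, 0)` is a lift of `Φ v`, and a quotient norm is at most the norm of any lift.
This is the global bound on the lengths of action fields. -/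
lemma tildeForm_zero_apply_le (hb : IsInner b) (ha : IsInner a) (v : A) :
    tildeForm b Φ a 0 (Φ v) (Φ v) ≤ b v v := by
  have := quotForm_apply_le (hb.prodForm ha) (surjective_tildeMap (Φ := Φ) ha 0) (v, 0)
  rw [tildeForm]
  simpa [tildeMap_apply] using this

/-- At `l = 0`, applying `P` to an element `(s, t)` of the kernel gives `Φ s = 0`. Hence `(v, 0)` is
horizontal as soon as `v` is orthogonal to the kernel of `Φ`. -/
lemma tildeForm_zero_apply (hb : IsInner b) (ha : IsInner a) {v w : A} (hv : OrthKer Φ b v)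
    (hw : OrthKer Φ b w) : tildeForm b Φ a 0 (Φ v) (Φ w) = b v w := by
  have hP := isOrthProj_orthProj ha (LinearMap.range Φ.toLinearMap)
  set P := orthProj a (LinearMap.range Φ.toLinearMap) with hPdef
  have key : ∀ v, OrthKer Φ b v → OrthKer (tildeMap Φ a 0) (prodForm b a) (v, 0) := by
    rintro v hv ⟨s, t⟩ h
    rw [tildeMap_apply, ← hPdef] at h
    have h1 := congrArg P h
    have h2 : P (Φ s) = Φ s := hP.apply_of_mem ha ⟨s, rfl⟩
    have h3 : P (P t) = P t := hP.apply_of_mem ha (hP.mem t)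
    simp only [map_add, map_sub, h2, h3, zero_smul, sub_self, add_zero, map_zero] at h1
    simp [hv s h1]
  have := quotForm_apply (hb.prodForm ha) (surjective_tildeMap (Φ := Φ) ha 0) (key v hv) (key w hw)
  rw [tildeForm]
  simpa [tildeMap_apply] using this

/-- A horizontal vector is the inverse image under the product form of `β ∘ tildeMap`; take `u = a⁻¹
β` and use that `P` is self-adjoint. -/
lemma OrthKer.exists_of_tildeMap (hb : IsInner b) (ha : IsInner a) {l : ℝ} {p : A × E}
    (hp : OrthKer (tildeMap Φ a l) (prodForm b a) p) :
    ∃ u, (∀ s, b p.1 s = a u (Φ s)) ∧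
      p.2 = l • orthProj a (LinearMap.range Φ.toLinearMap) u +
        (u - orthProj a (LinearMap.range Φ.toLinearMap) u) := by
  have hP := isOrthProj_orthProj ha (LinearMap.range Φ.toLinearMap)
  set P := orthProj a (LinearMap.range Φ.toLinearMap) with hPdef
  obtain ⟨β, hβ⟩ := hp.exists_transpose (hb.prodForm ha) (surjective_tildeMap ha l)
  have h1 : ∀ q, prodForm b a p q = β (tildeMap Φ a l q) := by
    intro q
    rw [hβ, (hb.prodForm ha).apply_inverse]; rfl
  have hu : a (a.inverse β) = β := ha.apply_inverse β
  set u := a.inverse β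
  refine ⟨u, fun s => ?_, ha.ext fun t => ?_⟩
  · have := h1 (s, 0)
    rw [tildeMap_apply] at this
    simpa [hu] using this
  · have h2 := h1 (0, t)
    rw [tildeMap_apply, ← hPdef] at h2
    simp only [prodForm_apply, map_zero, zero_add] at h2
    rw [h2, ← hu]
    have h3 : ∀ x y, a x (P y) = a (P x) (P y) := fun x y => by
      have := hP.orth x _ (hP.mem y)
      rwa [map_sub, sub_apply, sub_eq_zero] at this
    have h4 : ∀ x y, a (P x) y = a (P x) (P y) := fun x y => by
      rw [ha.symm (P x) y, h3, ha.symm]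
    simp only [map_add, map_smul, map_sub, add_apply, sub_apply, smul_apply]
    rw [h3 u t, h4 u t]

/-- Rescaling the Cheeger deformed inner product on the range of `Φ`. -/
lemma rescaled_eq_tildeForm (hb : IsInner b) (ha : IsInner a) {l : ℝ} (hl : l ≠ 0) {h : E → E → ℝ}
    (hh : IsQuotForm (Φ.coprod (ContinuousLinearMap.id ℝ E)) (prodForm (l ^ 2 • b) a) h)
    {P : E → E} (hP : IsOrthProj a (LinearMap.range Φ.toLinearMap) P) (u w : E) :
    (l ^ 2)⁻¹ * h (P u) (P w) + h (u - P u) (w - P w) = tildeForm b Φ a l u w := by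
  have hP' := isOrthProj_orthProj ha (LinearMap.range Φ.toLinearMap)
  have hPP : P = orthProj a (LinearMap.range Φ.toLinearMap) := funext (hP.eq ha hP')
  subst hPP
  set P := orthProj a (LinearMap.range Φ.toLinearMap) with hPdef
  refine IsQuotForm.eq (hb.prodForm ha) (surjective_tildeMap ha l)
    (h := fun u w => (l ^ 2)⁻¹ * h (P u) (P w) + h (u - P u) (w - P w)) ?_ u w
  intro p q hp hq
  obtain ⟨u, hu1, hu2⟩ := hp.exists_of_tildeMap hb ha
  obtain ⟨w, hw1, hw2⟩ := hq.exists_of_tildeMap hb ha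
  rw [← hPdef] at hu2 hw2
  have hid : ∀ x, P (P x) = P x := fun x => hP.apply_of_mem ha (hP.mem x)
  have hΦ : ∀ s, P (Φ s) = Φ s := fun s => hP.apply_of_mem ha ⟨s, rfl⟩
  have horth : ∀ x s, a (x - P x) (Φ s) = 0 := fun x s => hP.orth x _ ⟨s, rfl⟩
  -- The image of `p` splits into its tangential part `Φ p.1 + l² P u` and its normal part `u - P
  -- u`; one factor `l` comes from `p`, the other from the map.
  have hL : ∀ (p : A × E) u, p.2 = l • P u + (u - P u) →
      P (tildeMap Φ a l p) = Φ p.1 + l ^ 2 • P u ∧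
      tildeMap Φ a l p - P (tildeMap Φ a l p) = u - P u := by
    intro p u hp
    have h1 : P p.2 = l • P u := by simp [hp, hid]
    have h2 : tildeMap Φ a l p = Φ p.1 + l ^ 2 • P u + (u - P u) := by
      rw [tildeMap_apply, ← hPdef, h1, hp, smul_smul, sq]; abel
    have h3 : P (tildeMap Φ a l p) = Φ p.1 + l ^ 2 • P u := by
      rw [h2]; simp [hid, hΦ]
    exact ⟨h3, by rw [h3, h2]; abel⟩
  -- The two parts lift horizontally for the Cheeger quotient to `(p.1, l² P u)` and `(0, u - P u)`.
  -- Evaluating `l² b + a` on these lifts, the factor `l⁻²` on the tangential part restores `b + a`.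
  have hor1 : ∀ (p : A × E) u, (∀ s, b p.1 s = a u (Φ s)) →
      OrthKer (Φ.coprod (ContinuousLinearMap.id ℝ E)) (prodForm (l ^ 2 • b) a)
        (p.1, l ^ 2 • P u) := by
    rintro p u hp ⟨s, t⟩ hst
    have ht : t = - Φ s := by
      have : Φ s + t = 0 := hst
      exact eq_neg_of_add_eq_zero_right this
    have := horth u s
    rw [map_sub, sub_apply, sub_eq_zero] at this
    simp [ht, hp s, this]
  have hor2 : ∀ u, OrthKer (Φ.coprod (ContinuousLinearMap.id ℝ E)) (prodForm (l ^ 2 • b) a)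
        (0, u - P u) := by
    rintro u ⟨s, t⟩ hst
    have ht : t = - Φ s := by
      have : Φ s + t = 0 := hst
      exact eq_neg_of_add_eq_zero_right this
    rw [prodForm_apply]
    simp only [map_zero, zero_apply, zero_add, ht, map_neg, horth, neg_zero]
  have e1 := hh _ _ (hor1 p u hu1) (hor1 q w hw1)
  have e2 := hh _ _ (hor2 u) (hor2 w)
  simp only [ContinuousLinearMap.coprod_apply, ContinuousLinearMap.id_apply, prodForm_apply,
    map_zero, zero_add, smul_apply, map_smul, smul_eq_mul] at e1 e2
  change (l ^ 2)⁻¹ * h (P (tildeMap Φ a l p)) (P (tildeMap Φ a l q)) +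
    h (tildeMap Φ a l p - P (tildeMap Φ a l p)) (tildeMap Φ a l q - P (tildeMap Φ a l q)) = _
  rw [(hL p u hu2).2, (hL q w hw2).2, (hL p u hu2).1, (hL q w hw2).1, e1, e2, prodForm_apply,
    hu2, hw2]
  have c1 : a (P u) (w - P w) = 0 := by rw [ha.symm]; exact hP.orth w _ (hP.mem u)
  have c2 : a (u - P u) (P w) = 0 := hP.orth u _ (hP.mem w)
  have c3 : a (l • P u + (u - P u)) (l • P w + (w - P w)) =
      l ^ 2 * a (P u) (P w) + a (u - P u) (w - P w) := by
    rw [map_add a, add_apply, map_smul a, smul_apply, map_add (a (P u)), map_add (a (u - P u)),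
      map_smul (a (P u)), map_smul (a (u - P u)), c1, c2]
    simp only [smul_eq_mul]; ring
  rw [c3]
  field_simp
  ring

/-- Naturality of the rescaled inner products. -/
lemma tildeForm_natural {A' E' : Type*} [NormedAddCommGroup A'] [NormedSpace ℝ A']
    [NormedAddCommGroup E'] [NormedSpace ℝ E'] [FiniteDimensional ℝ A'] [FiniteDimensional ℝ E']
    {b' : A' →L[ℝ] A' →L[ℝ] ℝ} {Φ' : A' →L[ℝ] E'} {a' : E' →L[ℝ] E' →L[ℝ] ℝ}
    (hb : IsInner b) (ha : IsInner a) (hb' : IsInner b') (ha' : IsInner a') (T : A →L[ℝ] A')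
    (S : E →L[ℝ] E') (hT : Function.Surjective T) (hS : Function.Bijective S)
    (hΦ : ∀ v, Φ' (T v) = S (Φ v)) (hbT : ∀ v w, b' (T v) (T w) = b v w)
    (haS : ∀ v w, a' (S v) (S w) = a v w) (l : ℝ) (u w : E) :
    tildeForm b' Φ' a' l (S u) (S w) = tildeForm b Φ a l u w := by
  have hP := isOrthProj_orthProj ha (LinearMap.range Φ.toLinearMap)
  have hP' := isOrthProj_orthProj ha' (LinearMap.range Φ'.toLinearMap)
  -- The projection conjugated by `S` has the properties that characterize the projection on the
  -- other side.
  have hPS : ∀ u, orthProj a' (LinearMap.range Φ'.toLinearMap) (S u) =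
      S (orthProj a (LinearMap.range Φ.toLinearMap) u) := by
    intro u
    have : IsOrthProj a' (LinearMap.range Φ'.toLinearMap)
        (fun x => S (orthProj a (LinearMap.range Φ.toLinearMap) (Function.surjInv hS.2 x))) := by
      constructor
      · intro x
        obtain ⟨v, hv⟩ := hP.mem (Function.surjInv hS.2 x)
        exact ⟨T v, by rw [← hv]; exact hΦ v⟩
      · rintro x t ⟨v, rfl⟩
        obtain ⟨v, rfl⟩ := hT v
        obtain ⟨y, rfl⟩ := hS.2 x
        rw [Function.leftInverse_surjInv hS, ← map_sub]
        change a' _ (Φ' (T v)) = 0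
        rw [hΦ, haS]
        exact hP.orth y _ ⟨v, rfl⟩
    rw [hP'.eq ha' this, Function.leftInverse_surjInv hS]
  have hpr1 : ∀ p : A × E, (T.prodMap S p).1 = T p.1 := fun _ => rfl
  have hpr2 : ∀ p : A × E, (T.prodMap S p).2 = S p.2 := fun _ => rfl
  refine IsQuotForm.eq (hb.prodForm ha) (surjective_tildeMap (Φ := Φ) ha l)
    (h := fun u w => tildeForm b' Φ' a' l (S u) (S w)) ?_ u w
  refine (isQuotForm_quotForm (hb'.prodForm ha') (surjective_tildeMap ha' l)).of_intertwine
    (T.prodMap S) S (hT.prodMap hS.2) hS.1 ?_ ?_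
  · intro p
    rw [tildeMap_apply, tildeMap_apply]
    simp only [hpr1, hpr2, hPS, hΦ, map_add, map_smul, map_sub]
  · intro p q
    simp only [prodForm_apply, hpr1, hpr2, hbT, haS]

/-- Since `P` is idempotent and `a`-self-adjoint, the summand `l P` contributes `(l P) a⁻¹ (l P)ᵀ =
l² P a⁻¹`, and its cross terms with `1 - P` vanish. The remaining terms do not contain `l`. -/
lemma quotDual_tildeMap (hb : IsInner b) (ha : IsInner a) (l : ℝ) (β : E →L[ℝ] ℝ) :
    quotDual (tildeMap Φ a l) (prodForm b a) β = quotDual (tildeMap Φ a 0) (prodForm b a) β +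
      l ^ 2 • orthProj a (LinearMap.range Φ.toLinearMap) (a.inverse β) := by
  have hP := isOrthProj_orthProj ha (LinearMap.range Φ.toLinearMap)
  set P := orthProj a (LinearMap.range Φ.toLinearMap) with hPdef
  have hid : ∀ x, P (P x) = P x := fun x => hP.apply_of_mem ha (hP.mem x)
  have h3 : ∀ x y, a x (P y) = a (P x) (P y) := fun x y => by
    have := hP.orth x _ (hP.mem y)
    rwa [map_sub, sub_apply, sub_eq_zero] at this
  have h4 : ∀ x y, a (P x) y = a (P x) (P y) := fun x y => by
    rw [ha.symm (P x) y, h3, ha.symm]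
  have hu : a (a.inverse β) = β := ha.apply_inverse β
  set u := a.inverse β
  have key : ∀ l, quotDual (tildeMap Φ a l) (prodForm b a) β =
      Φ (b.inverse (transposeL Φ β)) + (l ^ 2 • P u + (u - P u)) := by
    intro l
    have h1 : (prodForm b a).inverse (transposeL (tildeMap Φ a l) β) =
        (b.inverse (transposeL Φ β), l • P u + (u - P u)) := by
      refine (hb.prodForm ha).ext fun q => ?_
      rw [(hb.prodForm ha).apply_inverse, transposeL_apply, tildeMap_apply, prodForm_apply,
        hb.apply_inverse, ← hPdef, ← hu]
      simp only [transposeL_apply, map_add, map_smul, map_sub, add_apply, sub_apply, smul_apply]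
      rw [h3 u q.2, h4 u q.2]
    change tildeMap Φ a l ((prodForm b a).inverse (transposeL (tildeMap Φ a l) β)) = _
    rw [h1, tildeMap_apply, ← hPdef]
    simp only [map_add, map_smul, map_sub, hid, sq, mul_smul]
    module
  rw [key l, key 0]
  simp only [ne_eq, OfNat.ofNat_ne_zero, not_false_eq_true, zero_pow, zero_smul, zero_add]
  abel

/-- The difference quotient of the family `tildeForm` with respect to `-l ^ 2`. -/
def tildeDiff (b : A →L[ℝ] A →L[ℝ] ℝ) (Φ : A →L[ℝ] E) (a : E →L[ℝ] E →L[ℝ] ℝ) (l : ℝ) :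
    E →L[ℝ] E →L[ℝ] ℝ :=
  tildeForm b Φ a l ∘L (orthProj a (LinearMap.range Φ.toLinearMap) ∘L a.inverse) ∘L
    tildeForm b Φ a 0

/-- This is `X⁻¹ - Y⁻¹ = -X⁻¹ (X - Y) Y⁻¹` applied to the dual forms, whose difference is `l² P
a⁻¹`. It is the source of the rate `l²`. -/
lemma tildeForm_sub_tildeForm_zero (hb : IsInner b) (ha : IsInner a) (l : ℝ) :
    tildeForm b Φ a l - tildeForm b Φ a 0 = -l ^ 2 • tildeDiff b Φ a l := by
  ext1 u
  have h1 := quotDual_tildeMap (Φ := Φ) hb ha l (tildeForm b Φ a 0 u)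
  have h2 : quotDual (tildeMap Φ a 0) (prodForm b a) (tildeForm b Φ a 0 u) = u :=
    quotDual_quotForm (hb.prodForm ha) (surjective_tildeMap ha 0) u
  rw [h2] at h1
  have h3 : tildeForm b Φ a l
      (quotDual (tildeMap Φ a l) (prodForm b a) (tildeForm b Φ a 0 u)) = tildeForm b Φ a 0 u :=
    quotForm_quotDual (hb.prodForm ha) (surjective_tildeMap ha l) _
  rw [h1, map_add, map_smul] at h3
  rw [sub_apply, ← h3]
  rw [sub_add_cancel_left, smul_apply, neg_smul]
  rfl

section Smooth

variable {X : Type*} [NormedAddCommGroup X] [NormedSpace ℝ X] {m : ℕ∞ω}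
  {Ψ : X → A →L[ℝ] E} {α : X → E →L[ℝ] E →L[ℝ] ℝ} {x₀ : X}

/-- Joint smoothness in `(l, x)`, with `l₀ = 0` included: the rank bound makes the projection
smooth, and surjectivity of `tildeMap` holds for all `l`. -/
lemma contDiffAt_tildeForm (hb : IsInner b) (hΨ : ContDiffAt ℝ m Ψ x₀) (hα : ContDiffAt ℝ m α x₀)
    (hi : ∀ᶠ x in 𝓝 x₀, IsInner (α x))
    (hr : ∀ᶠ x in 𝓝 x₀, Module.finrank ℝ (LinearMap.range (Ψ x).toLinearMap) ≤
      Module.finrank ℝ (LinearMap.range (Ψ x₀).toLinearMap)) (l₀ : ℝ) :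
    ContDiffAt ℝ m (fun p : ℝ × X => tildeForm b (Ψ p.2) (α p.2) p.1) (l₀, x₀) := by
  have hP : ContDiffAt ℝ m (fun p : ℝ × X => orthProj (α p.2)
      (LinearMap.range (Ψ p.2).toLinearMap)) (l₀, x₀) :=
    (hΨ.orthProj_range hα hi hr).comp (l₀, x₀) contDiffAt_snd
  have hL : ContDiffAt ℝ m (fun p : ℝ × X => tildeMap (Ψ p.2) (α p.2) p.1) (l₀, x₀) := by
    have h1 : ContDiffAt ℝ m (fun p : ℝ × X => Ψ p.2) (l₀, x₀) := hΨ.comp (l₀, x₀) contDiffAt_snd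
    have h2 : (fun p : ℝ × X => tildeMap (Ψ p.2) (α p.2) p.1) = fun p : ℝ × X =>
        Ψ p.2 ∘L ContinuousLinearMap.fst ℝ A E +
        (p.1 • orthProj (α p.2) (LinearMap.range (Ψ p.2).toLinearMap) +
          (ContinuousLinearMap.id ℝ E - orthProj (α p.2)
            (LinearMap.range (Ψ p.2).toLinearMap))) ∘L ContinuousLinearMap.snd ℝ A E := by
      ext p q <;> simp [tildeMap]
    rw [h2]
    exact (h1.clm_comp contDiffAt_const).add
      (((contDiffAt_fst.smul hP).add (contDiffAt_const.sub hP)).clm_comp contDiffAt_const)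
  have hα' : ContDiffAt ℝ m (fun p : ℝ × X => α p.2) (l₀, x₀) := hα.comp (l₀, x₀) contDiffAt_snd
  exact hL.quotForm (hα'.prodForm b) (hb.prodForm hi.self_of_nhds)
    (surjective_tildeMap hi.self_of_nhds l₀)

lemma contDiffAt_tildeDiff (hb : IsInner b) (hΨ : ContDiffAt ℝ m Ψ x₀) (hα : ContDiffAt ℝ m α x₀)
    (hi : ∀ᶠ x in 𝓝 x₀, IsInner (α x))
    (hr : ∀ᶠ x in 𝓝 x₀, Module.finrank ℝ (LinearMap.range (Ψ x).toLinearMap) ≤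
      Module.finrank ℝ (LinearMap.range (Ψ x₀).toLinearMap)) (l₀ : ℝ) :
    ContDiffAt ℝ m (fun p : ℝ × X => tildeDiff b (Ψ p.2) (α p.2) p.1) (l₀, x₀) := by
  have hP : ContDiffAt ℝ m (fun p : ℝ × X => orthProj (α p.2)
      (LinearMap.range (Ψ p.2).toLinearMap)) (l₀, x₀) :=
    (hΨ.orthProj_range hα hi hr).comp (l₀, x₀) contDiffAt_snd
  have hα' : ContDiffAt ℝ m (fun p : ℝ × X => (α p.2).inverse) (l₀, x₀) :=
    ContDiffAt.clm_inverse (f := fun p : ℝ × X => α p.2) (hα.comp (l₀, x₀) contDiffAt_snd)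
      hi.self_of_nhds.isInvertible
  have h0 : ContDiffAt ℝ m (fun p : ℝ × X => tildeForm b (Ψ p.2) (α p.2) 0) (l₀, x₀) :=
    ContDiffAt.comp (g := fun p : ℝ × X => tildeForm b (Ψ p.2) (α p.2) p.1)
      (f := fun p : ℝ × X => ((0 : ℝ), p.2)) (l₀, x₀) (contDiffAt_tildeForm hb hΨ hα hi hr 0)
      (contDiffAt_const.prodMk contDiffAt_snd)
  exact (contDiffAt_tildeForm hb hΨ hα hi hr l₀).clm_comp ((hP.clm_comp hα').clm_comp h0)

end Smooth

end RescaledForms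

end

noncomputable section

/-! ### Existence and uniqueness of the Cheeger deformation -/

section Cheeger

variable {d n : ℕ} {G : Type*} [TopologicalSpace G] [ChartedSpace (Euc d) G] [Group G]
  [LieGroup (𝓡 d) ∞ G]
  {M : Type*} [TopologicalSpace M] [ChartedSpace (Euc n) M] [IsManifold (𝓡 n) ∞ M]
  [MulAction G M] [ContMDiffSMul (𝓡 d) (𝓡 n) ∞ G M]

lemma IsBiInvariant.rightDeriv {gbi : SmoothMetric d G} (hbi : IsBiInvariant gbi.form) (a : G)
    (v w : Euc d) :
    gbi.toForm 1 (rightDeriv d a v) (rightDeriv d a w) = gbi.toForm a v w := by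
  have h := congrFun (congrFun (congrFun (hbi.2 a⁻¹) a) v) w
  have h' : gbi.toForm (a * a⁻¹) (_root_.rightDeriv d a v) (_root_.rightDeriv d a w) =
    gbi.toForm a v w := h
  rwa [mul_inv_cancel] at h'

lemma IsBiInvariant.adjointMap {gbi : SmoothMetric d G} (hbi : IsBiInvariant gbi.form) (a : G)
    (v w : Euc d) :
    gbi.toForm 1 (adjointMap d a v) (adjointMap d a w) = gbi.toForm 1 v w := by
  have h1 : MDifferentiableAt (𝓡 d) (𝓡 d) (fun b : G => b * a⁻¹) (a * 1) :=
    (contMDiff_mul_const _).mdifferentiableAt (by simp)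
  have h2 : MDifferentiableAt (𝓡 d) (𝓡 d) (fun b : G => a * b) 1 :=
    (contMDiff_const.mul contMDiff_id).mdifferentiableAt (n := ∞) (by simp)
  have h3 : ∀ v, _root_.adjointMap d a v =
      _root_.rightDeriv d a (tderiv (Euc d) (Euc d) (fun b : G => a * b) 1 v) := by
    intro v
    have := tderiv_comp_apply (g := fun b : G => b * a⁻¹) (f := fun b : G => a * b) h1 h2 v
    rwa [mul_one] at this
  have h := congrFun (congrFun (congrFun (hbi.1 a) 1) v) w
  have h' : gbi.toForm (a * 1) (tderiv (Euc d) (Euc d) (fun b : G => a * b) 1 v)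
    (tderiv (Euc d) (Euc d) (fun b : G => a * b) 1 w) = gbi.toForm 1 v w := h
  rw [mul_one] at h'
  rw [h3, h3, hbi.rightDeriv, h']

omit [LieGroup (𝓡 d) ∞ G] in
lemma toForm_transDeriv {gM : SmoothMetric n M}
    {a : G} (hisom : pullbackForm (𝓡 n) (𝓡 n) (fun x : M => a • x) gM.form = gM.form)
    (x : M) (v w : Euc n) :
    gM.toForm (a • x) (transDeriv n a x v) (transDeriv n a x w) = gM.toForm x v w :=
  congrFun (congrFun (congrFun hisom x) v) w

omit [LieGroup (𝓡 d) ∞ G] in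
lemma mdifferentiable_smul (p : G × M) :
    MDifferentiableAt ((𝓡 d).prod (𝓡 n)) (𝓡 n) (fun p : G × M => p.1 • p.2) p :=
  (contMDiff_fst.smul contMDiff_snd).mdifferentiableAt (n := ∞) (by simp)

/-- The sum of the two partial differentials, with the first rewritten at the point `p.1 • p.2`. In
this form the differential at `(p, m)` is visibly carried to the one at `(1, p • m)`. -/
lemma mfderiv_smul_apply (p : G × M) (v : Euc d × Euc n) :
    (show Euc d × Euc n →L[ℝ] Euc n from
      mfderiv ((𝓡 d).prod (𝓡 n)) (𝓡 n) (fun p : G × M => p.1 • p.2) p) v =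
    actDeriv d n G (p.1 • p.2) (rightDeriv d p.1 v.1) + transDeriv n p.1 p.2 v.2 := by
  have h := mfderiv_prod_eq_add_apply (v := v) (mdifferentiable_smul (d := d) (n := n) p)
  have h2 := congrArg (fun f : Euc d →L[ℝ] Euc n => f v.1)
    (tderiv_orbitMap (d := d) (n := n) p.2 p.1)
  refine h.trans ?_
  exact congrArg (fun z : Euc n => z + transDeriv n p.1 p.2 v.2) h2

omit [LieGroup (𝓡 d) ∞ G] [MulAction G M] [ContMDiffSMul (𝓡 d) (𝓡 n) ∞ G M] in
lemma cheegerProduct_apply [IsManifold (𝓡 d) ∞ G] (gbi : SmoothMetric d G) (gM : SmoothMetric n M)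
    (l : ℝ) (p : G × M) (v w : Euc d × Euc n) :
    cheegerProduct gbi.form gM.form l p v w =
      prodForm (l ^ 2 • gbi.toForm p.1) (gM.toForm p.2) v w := by
  unfold cheegerProduct pullbackForm
  rw [mfderiv_fst, mfderiv_snd]
  rfl

lemma rightDeriv_one : rightDeriv d (1 : G) = ContinuousLinearMap.id ℝ (Euc d) := by
  unfold rightDeriv
  simp only [inv_one, mul_one]
  exact tderiv_id 1

lemma transDeriv_one (x : M) : transDeriv n (1 : G) x = ContinuousLinearMap.id ℝ (Euc n) := by
  unfold transDeriv
  simp only [one_smul]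
  exact tderiv_id x

lemma surjective_coprod_id {A E : Type*} [NormedAddCommGroup A] [NormedSpace ℝ A]
    [NormedAddCommGroup E] [NormedSpace ℝ E] (Φ : A →L[ℝ] E) :
    Function.Surjective (Φ.coprod (ContinuousLinearMap.id ℝ E)) :=
  fun u => ⟨(0, u), by simp⟩

/-- Right translation on `G` and translation on `M` are isometries taking the situation at `(p, m)`
to that at `(1, p • m)`. Hence the submersion condition need only hold at the points `(1, x)`, where
it is linear algebra. -/
lemma isCheegerDeformation_iff {gbi : SmoothMetric d G} (hbi : IsBiInvariant gbi.form)
    {gM : SmoothMetric n M}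
    (hisom : ∀ a : G, pullbackForm (𝓡 n) (𝓡 n) (fun x : M => a • x) gM.form = gM.form)
    (l : ℝ) (T : M → Euc n → Euc n → ℝ) :
    IsCheegerDeformation gbi.form gM.form l T ↔
      ∀ x, IsQuotForm ((actDeriv d n G x).coprod (ContinuousLinearMap.id ℝ (Euc n)))
        (prodForm (l ^ 2 • gbi.toForm 1) (gM.toForm x)) (T x) := by
  constructor
  · intro h x v w hv hw
    have key : ∀ v : Euc d × Euc n, (show Euc d × Euc n →L[ℝ] Euc n from
        mfderiv ((𝓡 d).prod (𝓡 n)) (𝓡 n) (fun p : G × M => p.1 • p.2) ((1 : G), x)) v =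
        (actDeriv d n G x).coprod (ContinuousLinearMap.id ℝ (Euc n)) v := by
      intro v
      rw [mfderiv_smul_apply]
      simp only [rightDeriv_one, one_smul, transDeriv_one]
      rfl
    have hor : ∀ v : Euc d × Euc n,
        OrthKer ((actDeriv d n G x).coprod (ContinuousLinearMap.id ℝ (Euc n)))
        (prodForm (l ^ 2 • gbi.toForm 1) (gM.toForm x)) v →
        IsHorizontal ((𝓡 d).prod (𝓡 n)) (𝓡 n) (fun p : G × M => p.1 • p.2)
          (cheegerProduct gbi.form gM.form l) ((1 : G), x) v := by
      intro v hv u hu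
      refine (cheegerProduct_apply gbi gM l ((1 : G), x) v u).trans (hv u ?_)
      exact (key u).symm.trans hu
    have := h.isometry ((1 : G), x) v w (hor v hv) (hor w hw)
    have h2 := this.trans (cheegerProduct_apply gbi gM l ((1 : G), x) v w)
    rw [← key, ← key]
    refine Eq.trans ?_ h2
    have h1 : T ((1 : G) • x) = T x := by rw [one_smul]
    exact (congrFun (congrFun h1 _) _).symm
  · intro h
    refine ⟨contMDiff_fst.smul contMDiff_snd, ?_, ?_⟩
    · intro p u
      obtain ⟨w, hw⟩ := (bijective_transDeriv (n := n) d p.1 p.2).2 u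
      refine ⟨((0 : Euc d), w), ?_⟩
      refine (mfderiv_smul_apply (d := d) p ((0 : Euc d), w)).trans ?_
      rw [hw, map_zero, map_zero]
      exact zero_add u
    · intro p v w hv hw
      set L : Euc d × Euc n →L[ℝ] Euc n :=
        mfderiv ((𝓡 d).prod (𝓡 n)) (𝓡 n) (fun p : G × M => p.1 • p.2) p with hL
      have hq : IsQuotForm L (prodForm (l ^ 2 • gbi.toForm p.1) (gM.toForm p.2))
          (T (p.1 • p.2)) := by
        have := (h (p.1 • p.2)).of_intertwine (L := L)
          (a := prodForm (l ^ 2 • gbi.toForm p.1) (gM.toForm p.2))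
          ((rightDeriv d p.1).prodMap (transDeriv n p.1 p.2)) (ContinuousLinearMap.id ℝ (Euc n))
          ((surjective_rightDeriv p.1).prodMap (bijective_transDeriv d p.1 p.2).2)
          Function.injective_id ?_ ?_
        · exact this
        · intro v
          exact (mfderiv_smul_apply p v).symm
        · intro v w
          simp only [prodForm_apply, smul_apply]
          congr 1
          · exact congrArg (fun z => l ^ 2 • z) (hbi.rightDeriv p.1 v.1 w.1)
          · exact toForm_transDeriv (hisom p.1) p.2 v.2 w.2
      have hor : ∀ v : Euc d × Euc n,
          IsHorizontal ((𝓡 d).prod (𝓡 n)) (𝓡 n) (fun p : G × M => p.1 • p.2)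
            (cheegerProduct gbi.form gM.form l) p v →
          OrthKer L (prodForm (l ^ 2 • gbi.toForm p.1) (gM.toForm p.2)) v := by
        intro v hv u hu
        exact (cheegerProduct_apply gbi gM l p v u).symm.trans (hv u hu)
      exact (hq v w (hor v hv) (hor w hw)).trans (cheegerProduct_apply gbi gM l p v w).symm

/-- The Cheeger deformation at `x`. -/
def cheegerAt (gbi : SmoothMetric d G) (gM : SmoothMetric n M) (l : ℝ) (x : M) :
    Euc n →L[ℝ] Euc n →L[ℝ] ℝ :=
  quotForm ((actDeriv d n G x).coprod (ContinuousLinearMap.id ℝ (Euc n)))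
    (prodForm (l ^ 2 • gbi.toForm 1) (gM.toForm x))

/-- Quotient forms are natural under the isomorphism given by the chart, so the coordinate
expression is a quotient form built from smooth coordinate data. -/
lemma coordForm_cheegerAt (gbi : SmoothMetric d G) (gM : SmoothMetric n M) {l : ℝ} (hl : 0 < l)
    {e : OpenPartialHomeomorph M (Euc n)} (he : e ∈ IsManifold.maximalAtlas (𝓡 n) ∞ M) {y : Euc n}
    (hy : y ∈ e.target) :
    coordForm e (cheegerAt gbi gM l) y =
      quotForm ((coordAct d G e y).coprod (ContinuousLinearMap.id ℝ (Euc n)))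
        (prodForm (l ^ 2 • gbi.toForm 1) (coordForm e gM.toForm y)) := by
  have hb := (gbi.isInner_toForm 1).smul (pow_pos hl 2)
  have ha := gM.isInner_toForm (e.symm y)
  have ha' : IsInner (coordForm e gM.toForm y) := ha.coordForm he hy
  have hS : Function.Surjective (tderiv (Euc n) (Euc n) e.symm y) := fun v =>
    ⟨_, tderiv_chart_symm_comp he hy v⟩
  have hI : Function.Injective (tderiv (Euc n) (Euc n) e.symm y) :=
    Function.LeftInverse.injective (tderiv_chart_comp_symm he hy)
  ext u v
  refine IsQuotForm.eq (hb.prodForm ha') (surjective_coprod_id _)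
    (h := fun u v => coordForm e (cheegerAt gbi gM l) y u v) ?_ u v
  refine (isQuotForm_quotForm (hb.prodForm ha) (surjective_coprod_id
    (actDeriv d n G (e.symm y)))).of_intertwine
    ((ContinuousLinearMap.id ℝ (Euc d)).prodMap (tderiv (Euc n) (Euc n) e.symm y))
    (tderiv (Euc n) (Euc n) e.symm y) (Function.surjective_id.prodMap hS) hI ?_ ?_
  · intro p
    change actDeriv d n G (e.symm y) p.1 + tderiv (Euc n) (Euc n) e.symm y p.2 =
      tderiv (Euc n) (Euc n) e.symm y (coordAct d G e y p.1 + p.2)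
    rw [map_add, tderiv_symm_coordAct d G he hy]
  · intro p q
    rfl

lemma contDiffAt_coordForm_cheegerAt (gbi : SmoothMetric d G) (gM : SmoothMetric n M) {l : ℝ}
    (hl : 0 < l) {e : OpenPartialHomeomorph M (Euc n)}
    (he : e ∈ IsManifold.maximalAtlas (𝓡 n) ∞ M) {x : M} (hx : x ∈ e.source) :
    ContDiffAt ℝ ∞ (coordForm e (cheegerAt gbi gM l)) (e x) := by
  have hy := e.map_source hx
  have h : coordForm e (cheegerAt gbi gM l) =ᶠ[𝓝 (e x)] fun y =>
      quotForm ((coordAct d G e y).coprod (ContinuousLinearMap.id ℝ (Euc n)))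
        (prodForm (l ^ 2 • gbi.toForm 1) (coordForm e gM.toForm y)) := by
    filter_upwards [e.open_target.mem_nhds hy] with y hy
    exact coordForm_cheegerAt gbi gM hl he hy
  refine ContDiffAt.congr_of_eventuallyEq ?_ h
  refine ContDiffAt.quotForm ?_ ((gM.contDiffAt_coordForm he hx).prodForm _)
    (((gbi.isInner_toForm 1).smul (pow_pos hl 2)).prodForm
      ((gM.isInner_toForm _).coordForm he hy)) (surjective_coprod_id _)
  have h2 : (fun y => (coordAct d G e y).coprod (ContinuousLinearMap.id ℝ (Euc n))) = fun y =>
      coordAct d G e y ∘L ContinuousLinearMap.fst ℝ (Euc d) (Euc n) +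
        ContinuousLinearMap.snd ℝ (Euc d) (Euc n) := by
    ext y q <;> simp
  rw [h2]
  exact ((contDiffAt_coordAct d G he hy).clm_comp contDiffAt_const).add contDiffAt_const

theorem existsUnique_isCheegerDeformation {gbi : SmoothMetric d G} (hbi : IsBiInvariant gbi.form)
    {gM : SmoothMetric n M}
    (hisom : ∀ a : G, pullbackForm (𝓡 n) (𝓡 n) (fun x : M => a • x) gM.form = gM.form)
    {l : ℝ} (hl : 0 < l) :
    ∃! gl : SmoothMetric n M, IsCheegerDeformation gbi.form gM.form l gl.form := by
  have hin : ∀ x, IsInner (prodForm (l ^ 2 • gbi.toForm 1) (gM.toForm x)) := fun x =>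
    ((gbi.isInner_toForm 1).smul (pow_pos hl 2)).prodForm (gM.isInner_toForm x)
  refine ⟨mkMetric (cheegerAt gbi gM l) (fun x => isInner_quotForm (hin x) (surjective_coprod_id _))
    fun x => contDiffAt_coordForm_cheegerAt gbi gM hl (chartAt_mem_maximalAtlas x)
      (mem_chart_source _ x), ?_, ?_⟩
  · exact (isCheegerDeformation_iff hbi hisom l _).2 fun x =>
      isQuotForm_quotForm (hin x) (surjective_coprod_id _)
  · intro g hg
    refine SmoothMetric.ext_toForm fun x => ?_
    have h := (isCheegerDeformation_iff hbi hisom l g.form).1 hg x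
    ext u v
    exact h.eq (hin x) (surjective_coprod_id _) u v

end Cheeger

/-! ### The rescaled forms on the manifold -/

section Rescaled

variable {d n : ℕ} {G : Type*} [TopologicalSpace G] [ChartedSpace (Euc d) G] [Group G]
  [LieGroup (𝓡 d) ∞ G]
  {M : Type*} [TopologicalSpace M] [ChartedSpace (Euc n) M] [IsManifold (𝓡 n) ∞ M]
  [MulAction G M] [ContMDiffSMul (𝓡 d) (𝓡 n) ∞ G M]

omit [LieGroup (𝓡 d) ∞ G] [ContMDiffSMul (𝓡 d) (𝓡 n) ∞ G M] in
lemma isOrthProj_orbitProj (gM : SmoothMetric n M) (x : M) :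
    IsOrthProj (gM.toForm x) (LinearMap.range (actDeriv d n G x).toLinearMap)
      (orbitProj d G gM x) := by
  let _ : Bundle.RiemannianBundle (fun x : M => TangentSpace (𝓡 n) x) := ⟨gM.toRiemannianMetric⟩
  have : FiniteDimensional ℝ (TangentSpace (𝓡 n) x) :=
    inferInstanceAs (FiniteDimensional ℝ (EuclideanSpace ℝ (Fin n)))
  constructor
  · intro u
    exact Submodule.starProjection_apply_mem (orbitTangent d G n x) u
  · intro u t ht
    exact Submodule.starProjection_inner_eq_zero (K := orbitTangent d G n x) u t ht

/-- The rescaled Cheeger deformations and, for `l = 0`, their limit, at `x`. -/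
def tildeAt (gbi : SmoothMetric d G) (gM : SmoothMetric n M) (l : ℝ) (x : M) :
    Euc n →L[ℝ] Euc n →L[ℝ] ℝ :=
  tildeForm (gbi.toForm 1) (actDeriv d n G x) (gM.toForm x) l

lemma isInner_tildeAt (gbi : SmoothMetric d G) (gM : SmoothMetric n M) (l : ℝ) (x : M) :
    IsInner (tildeAt gbi gM l x) :=
  isInner_tildeForm (gbi.isInner_toForm 1) (gM.isInner_toForm x) l

/-- For `l > 0` the rescaled form agrees with `tildeAt`, whose definition also covers `l = 0`; from
here on only `tildeAt` has to be studied. -/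
lemma rescaledForm_eq {gbi : SmoothMetric d G} (hbi : IsBiInvariant gbi.form)
    {gM : SmoothMetric n M}
    (hisom : ∀ a : G, pullbackForm (𝓡 n) (𝓡 n) (fun x : M => a • x) gM.form = gM.form)
    {l : ℝ} (hl : 0 < l) {gl : SmoothMetric n M}
    (hgl : IsCheegerDeformation gbi.form gM.form l gl.form) (x : M) (u v : Euc n) :
    rescaledForm d G gM gl l x u v = tildeAt gbi gM l x u v :=
  rescaled_eq_tildeForm (gbi.isInner_toForm 1) (gM.isInner_toForm x) hl.ne'
    ((isCheegerDeformation_iff hbi hisom l gl.form).1 hgl x) (isOrthProj_orbitProj gM x) u v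

/-- Naturality, with the adjoint action of `a` on the Lie algebra and the differential of `a` on
tangent spaces; both are isometries. -/
lemma tildeAt_transDeriv {gbi : SmoothMetric d G} (hbi : IsBiInvariant gbi.form)
    {gM : SmoothMetric n M} {a : G}
    (hisom : pullbackForm (𝓡 n) (𝓡 n) (fun x : M => a • x) gM.form = gM.form)
    (l : ℝ) (x : M) (u v : Euc n) :
    tildeAt gbi gM l (a • x) (transDeriv n a x u) (transDeriv n a x v) = tildeAt gbi gM l x u v :=
  tildeForm_natural (gbi.isInner_toForm 1) (gM.isInner_toForm x) (gbi.isInner_toForm 1)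
    (gM.isInner_toForm _) (adjointMap d a) (transDeriv n a x) (surjective_adjointMap a)
    (bijective_transDeriv d a x) (fun v => (transDeriv_actDeriv a x v).symm) (hbi.adjointMap a)
    (toForm_transDeriv hisom x) l u v

lemma coordForm_tildeAt (gbi : SmoothMetric d G) (gM : SmoothMetric n M) (l : ℝ)
    {e : OpenPartialHomeomorph M (Euc n)} (he : e ∈ IsManifold.maximalAtlas (𝓡 n) ∞ M) {y : Euc n}
    (hy : y ∈ e.target) :
    coordForm e (tildeAt gbi gM l) y =
      tildeForm (gbi.toForm 1) (coordAct d G e y) (coordForm e gM.toForm y) l := by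
  have hb := gbi.isInner_toForm 1
  have ha := gM.isInner_toForm (e.symm y)
  have ha' : IsInner (coordForm e gM.toForm y) := ha.coordForm he hy
  have hS : Function.Surjective (tderiv (Euc n) (Euc n) e.symm y) := fun v =>
    ⟨_, tderiv_chart_symm_comp he hy v⟩
  have hI : Function.Injective (tderiv (Euc n) (Euc n) e.symm y) :=
    Function.LeftInverse.injective (tderiv_chart_comp_symm he hy)
  ext u v
  exact tildeForm_natural hb ha' hb ha (ContinuousLinearMap.id ℝ (Euc d))
    (tderiv (Euc n) (Euc n) e.symm y) Function.surjective_id ⟨hI, hS⟩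
    (fun v => (tderiv_symm_coordAct d G he hy v).symm) (fun _ _ => rfl) (fun _ _ => rfl) l u v

lemma finrank_range_coordAct {e : OpenPartialHomeomorph M (Euc n)}
    (he : e ∈ IsManifold.maximalAtlas (𝓡 n) ∞ M) {y : Euc n} (hy : y ∈ e.target) :
    Module.finrank ℝ (LinearMap.range (coordAct d G e y).toLinearMap) =
      orbitRank d n G (e.symm y) := by
  have hI : Function.Injective (tderiv (Euc n) (Euc n) e (e.symm y)) :=
    Function.LeftInverse.injective (tderiv_chart_symm_comp he hy)
  have : LinearMap.range (coordAct d G e y).toLinearMap =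
      (LinearMap.range (actDeriv d n G (e.symm y)).toLinearMap).map
        (tderiv (Euc n) (Euc n) e (e.symm y)).toLinearMap := by
    rw [← LinearMap.range_comp]; rfl
  rw [this]
  exact (LinearEquiv.finrank_eq (Submodule.equivMapOfInjective _ hI _)).symm

variable {e : OpenPartialHomeomorph M (Euc n)}

/-- At a regular point the orbit has maximal dimension in all of `M`, so the bound holds on the
whole chart domain. This feeds the smoothness of the orthogonal projections. -/
lemma eventually_finrank_range_coordAct_le (he : e ∈ IsManifold.maximalAtlas (𝓡 n) ∞ M) {x : M}
    (hx : x ∈ e.source) (hr : x ∈ regularPart G M) :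
    ∀ᶠ y in 𝓝 (e x), Module.finrank ℝ (LinearMap.range (coordAct d G e y).toLinearMap) ≤
      Module.finrank ℝ (LinearMap.range (coordAct d G e (e x)).toLinearMap) := by
  filter_upwards [e.open_target.mem_nhds (e.map_source hx)] with y hy
  rw [finrank_range_coordAct he hy, finrank_range_coordAct he (e.map_source hx), e.left_inv hx]
  exact orbitRank_le_of_mem_regularPart hr _

lemma eventually_isInner_coordForm (gM : SmoothMetric n M)
    (he : e ∈ IsManifold.maximalAtlas (𝓡 n) ∞ M) {x : M} (hx : x ∈ e.source) :
    ∀ᶠ y in 𝓝 (e x), IsInner (coordForm e gM.toForm y) := by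
  filter_upwards [e.open_target.mem_nhds (e.map_source hx)] with y hy
  exact (gM.isInner_toForm _).coordForm he hy

lemma contDiffAt_coordForm_tildeAt (gbi : SmoothMetric d G) (gM : SmoothMetric n M) (l : ℝ)
    (he : e ∈ IsManifold.maximalAtlas (𝓡 n) ∞ M) {x : M} (hx : x ∈ e.source)
    (hr : x ∈ regularPart G M) :
    ContDiffAt ℝ ∞ (coordForm e (tildeAt gbi gM l)) (e x) := by
  have hy := e.map_source hx
  have h := contDiffAt_tildeForm (gbi.isInner_toForm 1) (contDiffAt_coordAct d G he hy)
    (gM.contDiffAt_coordForm he hx) (eventually_isInner_coordForm gM he hx)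
    (eventually_finrank_range_coordAct_le he hx hr) l
  have h2 := ContDiffAt.comp (g := fun p : ℝ × Euc n =>
      tildeForm (gbi.toForm 1) (coordAct d G e p.2) (coordForm e gM.toForm p.2) p.1)
      (f := fun y : Euc n => (l, y)) (e x) h (contDiffAt_const.prodMk contDiffAt_id)
  refine h2.congr_of_eventuallyEq ?_
  filter_upwards [e.open_target.mem_nhds hy] with y hy
  exact coordForm_tildeAt gbi gM l he hy

end Rescaled

end

noncomputable section

/-! ### Components of forms on an open subset -/

section OpenSubsets

variable {n : ℕ} {M : Type*} [TopologicalSpace M] [ChartedSpace (Euc n) M] [IsManifold (𝓡 n) ∞ M]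
  {U : Opens M}

lemma pullbackForm_subtype_val (T : M → Euc n → Euc n → ℝ) (x : U) (v w : Euc n) :
    pullbackForm (𝓡 n) (𝓡 n) (Subtype.val : U → M) T x v w = T x v w := by
  have h := tderiv_subtype_val (E := Euc n) U x
  have : ∀ v : Euc n, (mfderiv (𝓡 n) (𝓡 n) (Subtype.val : U → M) x : Euc n →L[ℝ] Euc n) v = v :=
    fun v => congrArg (fun f : Euc n →L[ℝ] Euc n => f v) h
  exact congrArg₂ (T x) (this v) (this w)

/-- The components of a bilinear form in the standard basis. -/
def formComponents (n : ℕ) (B : Euc n →L[ℝ] Euc n →L[ℝ] ℝ) (i j : Fin n) : ℝ :=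
  B (EuclideanSpace.single i 1) (EuclideanSpace.single j 1)

lemma formComponents_apply (B : Euc n →L[ℝ] Euc n →L[ℝ] ℝ) (i j : Fin n) :
    formComponents n B i j = B (EuclideanSpace.single i 1) (EuclideanSpace.single j 1) := rfl

lemma formComponents_smul (c : ℝ) (B : Euc n →L[ℝ] Euc n →L[ℝ] ℝ) :
    formComponents n (c • B) = c • formComponents n B := rfl

lemma norm_iteratedFDeriv_of_eventuallyEq_smul {E F : Type*} [NormedAddCommGroup E]
    [NormedSpace ℝ E] [NormedAddCommGroup F] [NormedSpace ℝ F] {f g : E → F} {x : E} {c : ℝ}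
    {k : ℕ} (h : f =ᶠ[𝓝 x] c • g) (hg : ContDiffAt ℝ k g x) :
    ‖iteratedFDeriv ℝ k f x‖ = |c| * ‖iteratedFDeriv ℝ k g x‖ := by
  rw [(Filter.EventuallyEq.iteratedFDeriv ℝ h k).eq_of_nhds, iteratedFDeriv_const_smul_apply hg,
    norm_smul, Real.norm_eq_abs]

lemma ContDiffAt.exists_norm_iteratedFDeriv_le {E F : Type*} [NormedAddCommGroup E]
    [NormedSpace ℝ E] [NormedAddCommGroup F] [NormedSpace ℝ F] {D : ℝ × E → F} {l₀ : ℝ} {y₀ : E}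
    (hD : ContDiffAt ℝ ∞ D (l₀, y₀)) (k : ℕ) :
    ∃ C : ℝ, ∃ S ∈ 𝓝 l₀, ∃ W ∈ 𝓝 y₀, ∀ l ∈ S, ∀ y ∈ W,
      ‖iteratedFDeriv ℝ k (fun y => D (l, y)) y‖ ≤ C := by
  obtain ⟨C, hC⟩ := hD.eventually_norm_iteratedFDeriv_le k
  obtain ⟨S, hS, W, hW, hSW⟩ := mem_nhds_prod_iff.1 hC
  exact ⟨C, S, hS, W, hW, fun l hl y hy => hSW (mk_mem_prod hl hy)⟩

lemma ContDiffAt.formComponents {X : Type*} [NormedAddCommGroup X] [NormedSpace ℝ X] {m : ℕ∞ω}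
    {f : X → Euc n →L[ℝ] Euc n →L[ℝ] ℝ} {x : X} (hf : ContDiffAt ℝ m f x) :
    ContDiffAt ℝ m (fun y => formComponents n (f y)) x :=
  contDiffAt_pi.2 fun _ => contDiffAt_pi.2 fun _ =>
    (hf.clm_apply contDiffAt_const).clm_apply contDiffAt_const

variable {e : OpenPartialHomeomorph M (Euc n)}

/-- The inclusion of `U` has identity differential, so the frame of `chartComponents` is the image
of the standard basis under the differential of the inverse chart of `M`. -/
lemma chartComponents_eq (he : e ∈ IsManifold.maximalAtlas (𝓡 n) ∞ M)
    (h : M → Euc n →L[ℝ] Euc n →L[ℝ] ℝ) {T : U → Euc n → Euc n → ℝ}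
    (hT : ∀ x v w, T x v w = h x v w) {y : Euc n} (hy : y ∈ e.target) (hyU : e.symm y ∈ U) :
    chartComponents e (U := U) T y = formComponents n (coordForm e h y) := by
  have hx := e.map_target hy
  set x : U := ⟨e.symm y, hyU⟩ with hxdef
  have hd : tderiv (Euc n) (Euc n) (fun z : U => e (z : M)) x =
      tderiv (Euc n) (Euc n) e (e.symm y) := by
    have h1 : MDifferentiableAt (𝓡 n) (𝓡 n) e (e.symm y) :=
      (contMDiffAt_of_mem_maximalAtlas he hx).mdifferentiableAt (by simp)
    have h2 : MDifferentiableAt (𝓡 n) (𝓡 n) (Subtype.val : U → M) x :=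
      (contMDiff_subtype_val (n := ∞)).mdifferentiableAt (by simp)
    have := tderiv_comp (g := e) (f := (Subtype.val : U → M)) (a := x) h1 h2
    rw [this, tderiv_subtype_val]
    rfl
  have hinv : (tderiv (Euc n) (Euc n) (fun z : U => e (z : M)) x).inverse =
      tderiv (Euc n) (Euc n) e.symm y := by
    rw [hd]
    refine ContinuousLinearMap.inverse_eq ?_ ?_
    · ext1 v; exact tderiv_chart_comp_symm he hy v
    · ext1 v; exact tderiv_chart_symm_comp he hy v
  unfold chartComponents
  rw [dif_pos ⟨hy, hyU⟩]
  funext i j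
  rw [formComponents_apply, coordForm_apply, ← hinv]
  exact hT x _ _

/-- As `U` is open, the default value `0` of `chartComponents` is not seen near `e x`. An equality
of germs is needed because derivatives are taken next. -/
lemma chartComponents_eventuallyEq (he : e ∈ IsManifold.maximalAtlas (𝓡 n) ∞ M)
    (h : M → Euc n →L[ℝ] Euc n →L[ℝ] ℝ) {T : U → Euc n → Euc n → ℝ}
    (hT : ∀ x v w, T x v w = h x v w) {x : M} (hx : x ∈ e.source) (hxU : x ∈ U) :
    chartComponents e (U := U) T =ᶠ[𝓝 (e x)] fun y => formComponents n (coordForm e h y) := by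
  have h1 : e.target ∩ e.symm ⁻¹' U ∈ 𝓝 (e x) := by
    refine (e.isOpen_inter_preimage_symm U.isOpen).mem_nhds ⟨e.map_source hx, ?_⟩
    simpa [e.left_inv hx] using hxU
  filter_upwards [h1] with y hy
  exact chartComponents_eq he h hT hy.1 hy.2

lemma isSmoothForm_of_coordForm (h : M → Euc n →L[ℝ] Euc n →L[ℝ] ℝ) {T : U → Euc n → Euc n → ℝ}
    (hT : ∀ x v w, T x v w = h x v w)
    (hs : ∀ e ∈ IsManifold.maximalAtlas (𝓡 n) ∞ M, ∀ x ∈ e.source, x ∈ U →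
      ContDiffAt ℝ ∞ (coordForm e h) (e x)) : IsSmoothForm (U := U) T := by
  rintro e he _ ⟨x, ⟨hx, hxU⟩, rfl⟩
  refine ContDiffAt.contDiffWithinAt ?_
  refine ContDiffAt.congr_of_eventuallyEq ?_ (chartComponents_eventuallyEq he h hT hx hxU)
  exact (hs e he x hx hxU).formComponents

/-- The inverse chart of `U` agrees on its target with that of `M`, so smoothness proved on `M`
yields a metric on `U`. -/
lemma coordForm_subtype (h : M → Euc n →L[ℝ] Euc n →L[ℝ] ℝ) (x₀ : U) :
    coordForm (chartAt (Euc n) x₀) (fun x : U => h x) =ᶠ[𝓝 (chartAt (Euc n) x₀ x₀)]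
      coordForm (chartAt (Euc n) (x₀ : M)) h := by
  have : Nonempty U := ⟨x₀⟩
  set e := chartAt (Euc n) (x₀ : M)
  set e' := chartAt (Euc n) x₀ with he'
  have h0 : ∀ y ∈ e'.target, (e'.symm y : M) = e.symm y := fun y hy =>
    OpenPartialHomeomorph.subtypeRestr_symm_eqOn e ⟨x₀⟩ hy |>.symm
  filter_upwards [e'.open_target.mem_nhds (mem_chart_target _ x₀)] with y hy
  have h1 : MDifferentiableAt (𝓡 n) (𝓡 n) (Subtype.val : U → M) (e'.symm y) :=
    (contMDiff_subtype_val (n := ∞)).mdifferentiableAt (by simp)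
  have h2 : MDifferentiableAt (𝓡 n) (𝓡 n) e'.symm y :=
    (contMDiffAt_symm_of_mem_maximalAtlas (chartAt_mem_maximalAtlas x₀) hy).mdifferentiableAt
      (by simp)
  have h3 := tderiv_comp (g := (Subtype.val : U → M)) (f := e'.symm) (a := y) h1 h2
  rw [tderiv_subtype_val] at h3
  have h4 : tderiv (Euc n) (Euc n) (fun y => (e'.symm y : M)) y =
      tderiv (Euc n) (Euc n) e.symm y := by
    refine tderiv_congr ?_
    filter_upwards [e'.open_target.mem_nhds hy] with z hz using h0 z hz
  ext u v
  rw [coordForm_apply, coordForm_apply, ← h0 y hy, ← h4, h3]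
  rfl

end OpenSubsets

/-! ### Convergence in `C^p` with rate `l²` -/

section Estimates

variable {d n : ℕ} {G : Type*} [TopologicalSpace G] [ChartedSpace (Euc d) G] [Group G]
  [LieGroup (𝓡 d) ∞ G]
  {M : Type*} [TopologicalSpace M] [ChartedSpace (Euc n) M] [IsManifold (𝓡 n) ∞ M]
  [MulAction G M] [ContMDiffSMul (𝓡 d) (𝓡 n) ∞ G M] {U : Opens M}

/-- The limit of the rescaled Cheeger deformations on `U`. -/
def limitMetric (gbi : SmoothMetric d G) (gM : SmoothMetric n M)
    (hr : (U : Set M) ⊆ regularPart G M) :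
    SmoothMetric n U :=
  mkMetric (fun x : U => tildeAt gbi gM 0 x) (fun x => isInner_tildeAt gbi gM 0 x) fun x =>
    (contDiffAt_coordForm_tildeAt gbi gM 0 (chartAt_mem_maximalAtlas (x : M))
      (mem_chart_source _ _) (hr x.2)).congr_of_eventuallyEq (coordForm_subtype _ x)

/-- The components of `tildeDiff` in the chart `e`. -/
def tildeDiffComponents (gbi : SmoothMetric d G) (gM : SmoothMetric n M)
    (e : OpenPartialHomeomorph M (Euc n)) (p : ℝ × Euc n) : Fin n → Fin n → ℝ :=
  formComponents n
    (tildeDiff (gbi.toForm 1) (coordAct d G e p.2) (coordForm e gM.toForm p.2) p.1)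

variable {gbi : SmoothMetric d G} (hbi : IsBiInvariant gbi.form) {gM : SmoothMetric n M}
  (hisom : ∀ a : G, pullbackForm (𝓡 n) (𝓡 n) (fun x : M => a • x) gM.form = gM.form)

include hbi hisom

lemma rescaledOn_eq {l : ℝ} (hl : 0 < l) {gl : SmoothMetric n M}
    (hgl : IsCheegerDeformation gbi.form gM.form l gl.form) (x : U) (v w : Euc n) :
    rescaledOn d G gM gl U l x v w = tildeAt gbi gM l x v w :=
  (pullbackForm_subtype_val (rescaledForm d G gM gl l) x v w).trans
    (rescaledForm_eq hbi hisom hl hgl x v w)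

lemma isSmoothForm_rescaledOn (hr : (U : Set M) ⊆ regularPart G M) {l : ℝ} (hl : 0 < l)
    {gl : SmoothMetric n M} (hgl : IsCheegerDeformation gbi.form gM.form l gl.form) :
    IsSmoothForm (rescaledOn d G gM gl U l) :=
  isSmoothForm_of_coordForm (tildeAt gbi gM l) (rescaledOn_eq hbi hisom hl hgl)
    fun _ he _ hx hxU => contDiffAt_coordForm_tildeAt gbi gM l he hx (hr hxU)

omit hbi hisom in
lemma contDiffAt_tildeDiffComponents (gbi : SmoothMetric d G) (gM : SmoothMetric n M)
    {e : OpenPartialHomeomorph M (Euc n)} (he : e ∈ IsManifold.maximalAtlas (𝓡 n) ∞ M) {x : M}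
    (hx : x ∈ e.source) (hxr : x ∈ regularPart G M) (l : ℝ) :
    ContDiffAt ℝ ∞ (tildeDiffComponents gbi gM e) (l, e x) :=
  (contDiffAt_tildeDiff (gbi.isInner_toForm 1)
    (contDiffAt_coordAct d G he (e.map_source hx)) (gM.contDiffAt_coordForm he hx)
    (eventually_isInner_coordForm gM he hx)
    (eventually_finrank_range_coordAct_le he hx hxr) l).formComponents

lemma chartComponents_sub_limitMetric {gl : SmoothMetric n M} {l : ℝ} (hl : 0 < l)
    (hgl : IsCheegerDeformation gbi.form gM.form l gl.form)
    (hr : (U : Set M) ⊆ regularPart G M) {e : OpenPartialHomeomorph M (Euc n)}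
    (he : e ∈ IsManifold.maximalAtlas (𝓡 n) ∞ M) {x : M} (hx : x ∈ e.source) (hxU : x ∈ U) :
    chartComponents e (rescaledOn d G gM gl U l - (limitMetric gbi gM hr).form)
      =ᶠ[𝓝 (e x)] (-l ^ 2) • fun y => tildeDiffComponents gbi gM e (l, y) := by
  have h2 := chartComponents_eventuallyEq (U := U) he
    (fun x => tildeAt gbi gM l x - tildeAt gbi gM 0 x)
    (T := rescaledOn d G gM gl U l - (limitMetric gbi gM hr).form)
    (fun x v w => congrArg₂ (· - ·) (rescaledOn_eq hbi hisom hl hgl x v w) rfl) hx hxU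
  filter_upwards [h2, e.open_target.mem_nhds (e.map_source hx)] with y hy hyt
  rw [hy]
  have h4 : coordForm e (fun x => tildeAt gbi gM l x - tildeAt gbi gM 0 x) y =
      coordForm e (tildeAt gbi gM l) y - coordForm e (tildeAt gbi gM 0) y := rfl
  rw [h4, coordForm_tildeAt gbi gM l he hyt, coordForm_tildeAt gbi gM 0 he hyt,
    tildeForm_sub_tildeForm_zero (gbi.isInner_toForm 1)
      ((gM.isInner_toForm _).coordForm he hyt), formComponents_smul]
  rfl

/-- The `C^p` estimate near a regular point. -/
lemma exists_iteratedFDeriv_le_near {gl : ℝ → SmoothMetric n M}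
    (hgl : ∀ l : ℝ, 0 < l → IsCheegerDeformation gbi.form gM.form l (gl l).form)
    (hr : (U : Set M) ⊆ regularPart G M) {e : OpenPartialHomeomorph M (Euc n)}
    (he : e ∈ IsManifold.maximalAtlas (𝓡 n) ∞ M) (k : ℕ) {x₀ : M} (hx₀ : x₀ ∈ e.source)
    (hx₀r : x₀ ∈ regularPart G M) :
    ∃ C : ℝ, ∃ V ∈ 𝓝 x₀, ∀ᶠ l in 𝓝[>] (0 : ℝ), ∀ x ∈ V ∩ U,
      ‖iteratedFDeriv ℝ k (chartComponents e
        (rescaledOn d G gM (gl l) U l - (limitMetric gbi gM hr).form)) (e x)‖ ≤ C * l ^ 2 := by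
  -- Joint smoothness at `(0, e x₀)` gives one constant for all small `l` and all nearby points.
  obtain ⟨C, S, hS, W, hW, hSW⟩ := (contDiffAt_tildeDiffComponents gbi gM he hx₀ hx₀r
    0).exists_norm_iteratedFDeriv_le k
  refine ⟨C, e.source ∩ e ⁻¹' W, inter_mem (e.open_source.mem_nhds hx₀)
    (e.continuousAt hx₀ hW), ?_⟩
  filter_upwards [mem_nhdsWithin_of_mem_nhds hS, self_mem_nhdsWithin] with l hlS hl x hx
  obtain ⟨⟨hxe, hxW⟩, hxU⟩ := hx
  have h1 := hSW l hlS (e x) hxW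
  have hsm : ContDiffAt ℝ k (tildeDiffComponents gbi gM e) (l, e x) :=
    (contDiffAt_tildeDiffComponents gbi gM he hxe (hr hxU) l).of_le (by exact_mod_cast le_top)
  have h2 := norm_iteratedFDeriv_of_eventuallyEq_smul
    (chartComponents_sub_limitMetric hbi hisom hl (hgl l hl) hr he hxe hxU)
    (hsm.comp (e x) (contDiffAt_const.prodMk contDiffAt_id))
  rw [h2, abs_neg, abs_pow, sq_abs, mul_comm]
  exact mul_le_mul_of_nonneg_right h1 (sq_nonneg l)

/-- The local estimates pass to subsets and finite unions, so compactness of `K` makes them uniform.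
-/
lemma exists_iteratedFDeriv_le {gl : ℝ → SmoothMetric n M}
    (hgl : ∀ l : ℝ, 0 < l → IsCheegerDeformation gbi.form gM.form l (gl l).form)
    (hr : (U : Set M) ⊆ regularPart G M) {e : OpenPartialHomeomorph M (Euc n)}
    (he : e ∈ IsManifold.maximalAtlas (𝓡 n) ∞ M) (k : ℕ) {K : Set M} (hK : IsCompact K)
    (hKe : K ⊆ e.source) (hKr : K ⊆ regularPart G M) :
    ∃ C : ℝ, ∀ᶠ l in 𝓝[>] (0 : ℝ), ∀ x ∈ K ∩ U,
      ‖iteratedFDeriv ℝ k (chartComponents e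
        (rescaledOn d G gM (gl l) U l - (limitMetric gbi gM hr).form)) (e x)‖ ≤ C * l ^ 2 := by
  refine hK.induction_on (p := fun S => ∃ C : ℝ, ∀ᶠ l in 𝓝[>] (0 : ℝ), ∀ x ∈ S ∩ U,
      ‖iteratedFDeriv ℝ k (chartComponents e
        (rescaledOn d G gM (gl l) U l - (limitMetric gbi gM hr).form)) (e x)‖ ≤ C * l ^ 2)
    ⟨0, by simp⟩ ?_ ?_ ?_
  · rintro s t hst ⟨C, hC⟩
    exact ⟨C, hC.mono fun l hl x hx => hl x ⟨hst hx.1, hx.2⟩⟩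
  · rintro s t ⟨C, hC⟩ ⟨C', hC'⟩
    refine ⟨max C C', ?_⟩
    filter_upwards [hC, hC'] with l h h' x hx
    rcases hx.1 with hs | ht
    · exact (h x ⟨hs, hx.2⟩).trans (by gcongr; exact le_max_left _ _)
    · exact (h' x ⟨ht, hx.2⟩).trans (by gcongr; exact le_max_right _ _)
  · intro x hx
    obtain ⟨C, V, hV, h⟩ :=
      exists_iteratedFDeriv_le_near hbi hisom hgl hr he k (hKe hx) (hKr hx)
    exact ⟨V, mem_nhdsWithin_of_mem_nhds hV, C, h⟩

lemma exists_cpNorm_le [T2Space M] {gl : ℝ → SmoothMetric n M}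
    (hgl : ∀ l : ℝ, 0 < l → IsCheegerDeformation gbi.form gM.form l (gl l).form)
    (hr : closure (U : Set M) ⊆ regularPart G M) (p : ℕ) (𝒜 : FiniteAtlas (n := n) U) :
    ∃ C : ℝ, ∀ᶠ l in 𝓝[>] (0 : ℝ), cpNorm 𝒜 p (rescaledOn d G gM (gl l) U l -
      (limitMetric gbi gM (subset_closure.trans hr)).form) ≤ ENNReal.ofReal (C * l ^ 2) := by
  -- A piece of the atlas may leave the regular part; its intersection with the closure of `U` is
  -- compact and does not.
  have h := fun (i : Fin 𝒜.card) (k : ℕ) => exists_iteratedFDeriv_le hbi hisom hgl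
    (subset_closure.trans hr) (𝒜.mem_maximalAtlas i) k
    (K := 𝒜.piece i ∩ closure U) ((𝒜.isCompact_piece i).inter_right isClosed_closure)
    (inter_subset_left.trans (𝒜.piece_subset i)) (inter_subset_right.trans hr)
  choose C hC using h
  -- There are finitely many pairs `(i, k)`, and the sum of absolute values dominates each constant
  -- whatever its sign.
  refine ⟨∑ i, ∑ k ∈ Finset.range (p + 1), |C i k|, ?_⟩
  have h2 : ∀ᶠ l in 𝓝[>] (0 : ℝ), ∀ i, ∀ k ∈ Finset.range (p + 1),
      ∀ x ∈ 𝒜.piece i ∩ closure U ∩ U, ‖iteratedFDeriv ℝ k (chartComponents (𝒜.chart i)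
        (rescaledOn d G gM (gl l) U l -
          (limitMetric gbi gM (subset_closure.trans hr)).form)) (𝒜.chart i x)‖ ≤ C i k * l ^ 2 :=
    eventually_all.2 fun i => (eventually_all_finset _).2 fun k _ => hC i k
  filter_upwards [h2] with l hl
  refine iSup_le fun i => iSup_le fun k => iSup_le fun hk => iSup_le fun x => iSup_le fun hx => ?_
  have hk' : k ∈ Finset.range (p + 1) := Finset.mem_range.2 (by omega)
  rw [← ofReal_norm]
  refine ENNReal.ofReal_le_ofReal ((hl i k hk' x
    ⟨⟨hx.1, subset_closure hx.2⟩, hx.2⟩).trans ?_)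
  gcongr
  refine (le_abs_self _).trans ((Finset.single_le_sum (f := fun k => |C i k|)
    (fun _ _ => abs_nonneg _) hk').trans ?_)
  exact Finset.single_le_sum (f := fun i => ∑ k ∈ Finset.range (p + 1), |C i k|)
    (fun _ _ => Finset.sum_nonneg fun _ _ => abs_nonneg _) (Finset.mem_univ i)

theorem tendsto_cpNorm_rescaledOn [T2Space M] {gl : ℝ → SmoothMetric n M}
    (hgl : ∀ l : ℝ, 0 < l → IsCheegerDeformation gbi.form gM.form l (gl l).form)
    (hr : closure (U : Set M) ⊆ regularPart G M) (p : ℕ) (𝒜 : FiniteAtlas (n := n) U) :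
    Tendsto (fun l : ℝ => cpNorm 𝒜 p (rescaledOn d G gM (gl l) U l -
        (limitMetric gbi gM (subset_closure.trans hr)).form)) (𝓝[>] 0) (𝓝 0) ∧
      ∃ C : ℝ, ∃ l₀ : ℝ, 0 < l₀ ∧ ∀ l : ℝ, 0 < l → l < l₀ →
        cpNorm 𝒜 p (rescaledOn d G gM (gl l) U l -
          (limitMetric gbi gM (subset_closure.trans hr)).form) ≤ ENNReal.ofReal (C * l ^ 2) := by
  obtain ⟨C, hC⟩ := exists_cpNorm_le hbi hisom hgl hr p 𝒜
  constructor
  · refine tendsto_of_tendsto_of_tendsto_of_le_of_le' tendsto_const_nhds ?_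
      (Eventually.of_forall fun _ => zero_le) hC
    have : Tendsto (fun l : ℝ => ENNReal.ofReal (C * l ^ 2)) (𝓝 0)
        (𝓝 (ENNReal.ofReal (C * 0 ^ 2))) :=
      ENNReal.tendsto_ofReal ((continuous_const.mul (continuous_id.pow 2)).tendsto 0)
    simpa using this.mono_left nhdsWithin_le_nhds
  · obtain ⟨l₀, hl₀, h⟩ := mem_nhdsGT_iff_exists_Ioo_subset.1 hC
    exact ⟨C, l₀, hl₀, fun l h1 h2 => h ⟨h1, h2⟩⟩

end Estimates

end

noncomputable section

/-! ### Compact group actions near a principal orbit -/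

section Topology

variable {G : Type*} [TopologicalSpace G] [Group G] [IsTopologicalGroup G] [CompactSpace G]
  {N : Type*} [TopologicalSpace N] [T2Space N] [MulAction G N] [ContinuousSMul G N]

/-- An element conjugating a closed subgroup of a compact group into itself normalizes it. -/
lemma conj_inv_mem_stabilizer {x : N} {b : G}
    (hb : ∀ h ∈ MulAction.stabilizer G x, b * h * b⁻¹ ∈ MulAction.stabilizer G x) {h : G}
    (hh : h ∈ MulAction.stabilizer G x) : b⁻¹ * h * b ∈ MulAction.stabilizer G x := by
  have hcl : IsClosed {c : G | (c * h * c⁻¹) • x = x} :=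
    isClosed_eq (by fun_prop) continuous_const
  have hpow : ∀ m : ℕ, b ^ m ∈ {c : G | (c * h * c⁻¹) • x = x} := by
    intro m
    change b ^ m * h * (b ^ m)⁻¹ ∈ MulAction.stabilizer G x
    induction m with
    | zero => simpa using hh
    | succ m ih =>
      have := hb _ ih
      rwa [show b ^ (m + 1) * h * (b ^ (m + 1))⁻¹ = b * (b ^ m * h * (b ^ m)⁻¹) * b⁻¹ by group]
  -- In a compact group the closure of the natural powers of `b` contains all integer powers.
  have h1 : b⁻¹ ∈ closure (range fun m : ℕ => b ^ m) := by
    rw [← closure_range_zpow_eq_pow]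
    exact subset_closure ⟨-1, by simp⟩
  have h2 := closure_minimal (range_subset_iff.2 hpow) hcl h1
  simpa [MulAction.mem_stabilizer_iff] using h2

/-- Near a point of a principal orbit, points on the same orbit differ by a small group element. -/
lemma eventually_exists_smul_eq {x : N} (hx : x ∈ regularPart G N) {V : Set G}
    (hV : V ∈ 𝓝 (1 : G)) :
    ∀ᶠ p : N × N in 𝓝 (x, x), (∃ a : G, a • p.1 = p.2) → ∃ a ∈ V, a • p.1 = p.2 := by
  -- An ultrafilter of bad pairs converging to `(x, x)` replaces a sequence; compactness of `G`
  -- makes the chosen group elements converge along it.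
  by_contra hcon
  rw [not_eventually] at hcon
  set S : Set (N × N) := {p | ¬((∃ a : G, a • p.1 = p.2) → ∃ a ∈ V, a • p.1 = p.2)} with hS
  have : (𝓝 (x, x) ⊓ 𝓟 S).NeBot := frequently_mem_iff_neBot.1 hcon
  let F : Ultrafilter (N × N) := Ultrafilter.of (𝓝 (x, x) ⊓ 𝓟 S)
  have hF : (F : Filter (N × N)) ≤ 𝓝 (x, x) ⊓ 𝓟 S := Ultrafilter.of_le _
  have hFS : ∀ᶠ p in (F : Filter (N × N)), p ∈ S := hF.trans inf_le_right (mem_principal_self S)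
  have ht1 : Tendsto (fun p : N × N => p.1) F (𝓝 x) :=
    (continuous_fst.tendsto (x, x)).mono_left (hF.trans inf_le_left)
  have ht2 : Tendsto (fun p : N × N => p.2) F (𝓝 x) :=
    (continuous_snd.tendsto (x, x)).mono_left (hF.trans inf_le_left)
  have hg : ∀ p : N × N, ∃ a : G, p ∈ S → a • p.1 = p.2 := by
    intro p
    by_cases hp : p ∈ S
    · obtain ⟨⟨a, ha⟩, -⟩ := Classical.not_imp.1 hp
      exact ⟨a, fun _ => ha⟩
    · exact ⟨1, fun h => (hp h).elim⟩
  choose g hg using hg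
  -- Here the principal orbit condition enters: the isotropy group of `x` is conjugated into that of
  -- the nearby point `p.1`.
  have hb : ∀ p : N × N, ∃ b : G, ∀ h ∈ MulAction.stabilizer G x, (b * h * b⁻¹) • p.1 = p.1 := by
    intro p
    obtain ⟨b, hb⟩ := hx p.1
    exact ⟨b, fun h hh => hb ⟨h, hh, rfl⟩⟩
  choose b hb using hb
  obtain ⟨g₀, -, hg₀⟩ := isCompact_univ.ultrafilter_le_nhds (F.map g) (by simp)
  obtain ⟨b₀, -, hb₀⟩ := isCompact_univ.ultrafilter_le_nhds (F.map b) (by simp)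
  have htg : Tendsto g F (𝓝 g₀) := hg₀
  have htb : Tendsto b F (𝓝 b₀) := hb₀
  have hg₀x : g₀ ∈ MulAction.stabilizer G x := by
    have h1 : Tendsto (fun p : N × N => g p • p.1) F (𝓝 (g₀ • x)) := htg.smul ht1
    have h2 : Tendsto (fun p : N × N => g p • p.1) F (𝓝 x) :=
      ht2.congr' (hFS.mono fun p hp => (hg p hp).symm)
    exact tendsto_nhds_unique h1 h2
  have hb₀x : ∀ h ∈ MulAction.stabilizer G x, b₀ * h * b₀⁻¹ ∈ MulAction.stabilizer G x := by
    intro h hh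
    have h1 : Tendsto (fun p : N × N => (b p * h * (b p)⁻¹) • p.1) F (𝓝 ((b₀ * h * b₀⁻¹) • x)) :=
      ((htb.mul tendsto_const_nhds).mul htb.inv).smul ht1
    have h2 : Tendsto (fun p : N × N => (b p * h * (b p)⁻¹) • p.1) F (𝓝 x) :=
      ht1.congr fun p => (hb p h hh).symm
    exact tendsto_nhds_unique h1 h2
  -- The limit `b₀` normalizes the isotropy group of `x`, which contains `g₀`. Conjugating `b₀⁻¹
  -- g₀⁻¹ b₀` by `b p` gives an element fixing `p.1` and tending to `g₀⁻¹`; multiplying `g p` by it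
  -- on the right keeps the image of `p.1` and makes the product tend to `1`, contrary to badness.
  have hk : b₀⁻¹ * g₀⁻¹ * b₀ ∈ MulAction.stabilizer G x :=
    conj_inv_mem_stabilizer hb₀x (inv_mem hg₀x)
  have hε : Tendsto (fun p => g p * (b p * (b₀⁻¹ * g₀⁻¹ * b₀) * (b p)⁻¹)) F (𝓝 1) := by
    have := htg.mul ((htb.mul (tendsto_const_nhds (x := b₀⁻¹ * g₀⁻¹ * b₀))).mul htb.inv)
    rwa [show g₀ * (b₀ * (b₀⁻¹ * g₀⁻¹ * b₀) * b₀⁻¹) = 1 by group] at this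
  obtain ⟨p, hpS, hpV⟩ := (hFS.and (hε hV)).exists
  refine (Classical.not_imp.1 hpS).2 ⟨_, hpV, ?_⟩
  rw [mul_smul, hb p _ hk, hg p hpS]

variable {B : Type*} [TopologicalSpace B] {f : N → B}

/-- The orbit space of a compact group acting on a Hausdorff space is Hausdorff. -/
lemma IsOpenQuotientMap.t2Space_of_orbits (hf : IsOpenQuotientMap f)
    (hfib : ∀ x y, f x = f y ↔ ∃ a : G, a • x = y) : T2Space B := by
  rw [t2Space_iff_of_isOpenQuotientMap hf]
  have hcl : IsClosed {p : G × (N × N) | p.1 • p.2.1 = p.2.2} :=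
    isClosed_eq (by fun_prop) (by fun_prop)
  have h := isClosedMap_snd_of_compactSpace _ hcl
  convert h using 1
  ext q
  constructor
  · intro hq
    obtain ⟨a, ha⟩ := (hfib q.1 q.2).1 hq
    exact ⟨(a, q), ha, rfl⟩
  · rintro ⟨⟨a, q'⟩, ha, rfl⟩
    exact (hfib _ _).2 ⟨a, ha⟩

end Topology

/-! ### The inverse function theorem and a linear slice -/

section LocalInverse

variable {E F : Type*} [NormedAddCommGroup E] [NormedSpace ℝ E] [FiniteDimensional ℝ E]
  [NormedAddCommGroup F] [NormedSpace ℝ F] [FiniteDimensional ℝ F]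

/-- The inverse function theorem on an open set. -/
lemma exists_localInverse {θ : E → F} {Ω : Set E} (hΩ : IsOpen Ω) (hθ : ContDiffOn ℝ ∞ θ Ω) {p₀ : E}
    (hp₀ : p₀ ∈ Ω) (hb : Function.Bijective (fderiv ℝ θ p₀)) :
    ∃ H : OpenPartialHomeomorph E F, p₀ ∈ H.source ∧ H.source ⊆ Ω ∧ ⇑H = θ ∧
      ∀ y ∈ H.target, ContDiffAt ℝ ∞ H.symm y := by
  have : CompleteSpace E := FiniteDimensional.complete ℝ E
  have : CompleteSpace F := FiniteDimensional.complete ℝ F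
  have hat : ∀ p ∈ Ω, ContDiffAt ℝ ∞ θ p := fun p hp => hθ.contDiffAt (hΩ.mem_nhds hp)
  have hfd : ContinuousOn (fderiv ℝ θ) Ω := hθ.continuousOn_fderiv_of_isOpen hΩ (by simp)
  -- Restricting to points with invertible derivative makes the inverse smooth on its whole domain,
  -- not only at one point.
  let S := Ω ∩ fderiv ℝ θ ⁻¹' range ((↑) : (E ≃L[ℝ] F) → E →L[ℝ] F)
  have hS : IsOpen S := hfd.isOpen_inter_preimage hΩ ContinuousLinearEquiv.isOpen
  let D : E ≃L[ℝ] F :=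
    (LinearEquiv.ofBijective (fderiv ℝ θ p₀).toLinearMap hb).toContinuousLinearEquiv
  have hD : HasFDerivAt θ (D : E →L[ℝ] F) p₀ :=
    ((hat p₀ hp₀).differentiableAt (by simp)).hasFDerivAt
  let H₀ := (hat p₀ hp₀).toOpenPartialHomeomorph θ hD (by simp)
  have hH₀ : ⇑H₀ = θ := rfl
  refine ⟨H₀.restrOpen S hS, ⟨(hat p₀ hp₀).mem_toOpenPartialHomeomorph_source hD (by simp),
    hp₀, D, hD.fderiv.symm⟩, fun p hp => hp.2.1, rfl, ?_⟩
  intro y hy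
  have hp := (H₀.restrOpen S hS).map_target hy
  obtain ⟨D', hD'⟩ := hp.2.2
  refine OpenPartialHomeomorph.contDiffAt_symm _ hy (f₀' := D') ?_ (hat _ hp.2.1)
  rw [hD']
  exact ((hat _ hp.2.1).differentiableAt (by simp)).hasFDerivAt

/-- `J` parametrizes a complement of the range of `A`, and `i` lifts a parametrization of that range
through a linear section of `A`. -/
lemma exists_linear_slice {d n r k : ℕ} (A : Euc d →L[ℝ] Euc n)
    (hr : Module.finrank ℝ (LinearMap.range A.toLinearMap) = r) (hk : r + k = n) :
    ∃ (i : Euc r →L[ℝ] Euc d) (J : Euc k →L[ℝ] Euc n),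
      Function.Bijective fun p : Euc r × Euc k => A (i p.1) + J p.2 := by
  obtain ⟨C, hC⟩ := Submodule.exists_isCompl (LinearMap.range A.toLinearMap)
  have hCk : Module.finrank ℝ C = k := by
    have := Submodule.finrank_add_eq_of_isCompl hC
    rw [hr, finrank_euclideanSpace_fin] at this
    omega
  obtain ⟨g, hg⟩ := A.toLinearMap.rangeRestrict.exists_rightInverse_of_surjective
    (LinearMap.range_rangeRestrict _)
  let ρ : Euc r ≃ₗ[ℝ] LinearMap.range A.toLinearMap :=
    LinearEquiv.ofFinrankEq _ _ (by rw [hr, finrank_euclideanSpace_fin])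
  let κ : Euc k ≃ₗ[ℝ] C := LinearEquiv.ofFinrankEq _ _ (by rw [hCk, finrank_euclideanSpace_fin])
  refine ⟨LinearMap.toContinuousLinearMap (g ∘ₗ ρ.toLinearMap),
    LinearMap.toContinuousLinearMap (C.subtype ∘ₗ κ.toLinearMap), ?_⟩
  have : (fun p : Euc r × Euc k => A (LinearMap.toContinuousLinearMap (g ∘ₗ ρ.toLinearMap) p.1) +
      LinearMap.toContinuousLinearMap (C.subtype ∘ₗ κ.toLinearMap) p.2) =
      ((ρ.prodCongr κ).trans (Submodule.prodEquivOfIsCompl _ _ hC)) := by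
    funext p
    have h1 : A (g (ρ p.1)) = ρ p.1 := congrArg Subtype.val (LinearMap.congr_fun hg (ρ p.1))
    simp only [LinearEquiv.trans_apply, Submodule.coe_prodEquivOfIsCompl']
    exact congrArg (· + (κ p.2 : Euc n)) h1
  rw [this]
  exact LinearEquiv.bijective _

end LocalInverse

end

noncomputable section

/-! ### Coordinates adapted to the orbits -/

section FlowBox

variable {d n : ℕ} {G : Type*} [TopologicalSpace G] [ChartedSpace (Euc d) G] [Group G]
  [LieGroup (𝓡 d) ∞ G]
  {N : Type*} [TopologicalSpace N] [ChartedSpace (Euc n) N] [IsManifold (𝓡 n) ∞ N]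
  [MulAction G N] [ContMDiffSMul (𝓡 d) (𝓡 n) ∞ G N] {e : OpenPartialHomeomorph N (Euc n)}

/-- The differential of an orbit map, in charts, takes values in the tangent spaces of the orbit. -/
lemma exists_fderiv_localAct (he : e ∈ IsManifold.maximalAtlas (𝓡 n) ∞ N) {u : Euc d} {y : Euc n}
    (hu : u ∈ (chartAt (Euc d) (1 : G)).target)
    (hs : (chartAt (Euc d) (1 : G)).symm u • e.symm y ∈ e.source) (v : Euc d) :
    ∃ w, fderiv ℝ (fun u => localAct d G e (u, y)) u v =
      coordAct d G e (localAct d G e (u, y)) w := by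
  set c := chartAt (Euc d) (1 : G) with hc
  have hcm : c ∈ IsManifold.maximalAtlas (𝓡 d) ∞ G := IsManifold.chart_mem_maximalAtlas _
  refine ⟨rightDeriv d (c.symm u) (tderiv (Euc d) (Euc d) c.symm u v), ?_⟩
  have h1 : MDifferentiableAt (𝓡 d) (𝓡 d) c.symm u :=
    (contMDiffAt_symm_of_mem_maximalAtlas hcm hu).mdifferentiableAt (by simp)
  have h2 : MDifferentiableAt (𝓡 d) (𝓡 n) (fun a : G => a • e.symm y) (c.symm u) :=
    mdifferentiableAt_orbitMap _ _
  have h3 : MDifferentiableAt (𝓡 n) (𝓡 n) e (c.symm u • e.symm y) :=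
    (contMDiffAt_of_mem_maximalAtlas he hs).mdifferentiableAt (by simp)
  have h4 : MDifferentiableAt (𝓡 d) (𝓡 n) (fun a : G => e (a • e.symm y)) (c.symm u) :=
    MDifferentiableAt.comp (c.symm u) h3 h2
  have h5 : (fun u => localAct d G e (u, y)) = fun u => e (c.symm u • e.symm y) := rfl
  rw [← tderiv_eq_fderiv, h5, tderiv_comp_apply (g := fun a : G => e (a • e.symm y)) h4 h1,
    tderiv_comp_apply (g := e) (f := fun a : G => a • e.symm y) h3 h2, tderiv_orbitMap]
  have h6 : e.symm (localAct d G e (u, y)) = c.symm u • e.symm y := e.left_inv hs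
  unfold coordAct
  rw [h6]
  rfl

/-- Coordinates `(t, z) ↦ c⁻¹(i t) • e⁻¹(y₀ + J z)` adapted to the orbits. -/
structure FlowBox (d : ℕ) (G : Type*) [TopologicalSpace G] [ChartedSpace (Euc d) G] [Group G]
    [MulAction G N] (e : OpenPartialHomeomorph N (Euc n)) (y₀ : Euc n) (r k : ℕ) where
  i : Euc r →L[ℝ] Euc d
  J : Euc k →L[ℝ] Euc n
  H : OpenPartialHomeomorph (Euc r × Euc k) (Euc n)
  zero_mem : 0 ∈ H.source
  mem_chart : ∀ p ∈ H.source,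
    chartAt (Euc d) (1 : G) 1 + i p.1 ∈ (chartAt (Euc d) (1 : G)).target
  mem_target : ∀ p ∈ H.source, y₀ + J p.2 ∈ e.target
  mem_source : ∀ p ∈ H.source,
    (chartAt (Euc d) (1 : G)).symm (chartAt (Euc d) (1 : G) 1 + i p.1) •
      e.symm (y₀ + J p.2) ∈ e.source
  apply_eq : ∀ p, H p = localAct d G e (chartAt (Euc d) (1 : G) 1 + i p.1, y₀ + J p.2)
  contDiffAt_symm : ∀ y ∈ H.target, ContDiffAt ℝ ∞ H.symm y

/-- The differential at `0` is `(t, z) ↦ A (i t) + J z`, with `A` the infinitesimal action at `y₀`.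
It is bijective by the choice of `i` and `J`, so the inverse function theorem applies. -/
theorem exists_flowBox (he : e ∈ IsManifold.maximalAtlas (𝓡 n) ∞ N) {y₀ : Euc n}
    (hy₀ : y₀ ∈ e.target) {r k : ℕ} (hr : orbitRank d n G (e.symm y₀) = r) (hk : r + k = n) :
    Nonempty (FlowBox d G e y₀ r k) := by
  set c := chartAt (Euc d) (1 : G) with hc
  have hcm : c ∈ IsManifold.maximalAtlas (𝓡 d) ∞ G := IsManifold.chart_mem_maximalAtlas _
  have hcs : ContinuousSMul G N := ContMDiffSMul.continuousSMul (I := 𝓡 d) (I' := 𝓡 n) ∞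
  rw [← finrank_range_coordAct he hy₀] at hr
  obtain ⟨i, J, hij⟩ := exists_linear_slice (coordAct d G e y₀) hr hk
  let ι : Euc r × Euc k → Euc d × Euc n := fun p => (c 1 + i p.1, y₀ + J p.2)
  have hι : ContDiff ℝ ∞ ι :=
    (contDiff_const.add (i.contDiff.comp contDiff_fst)).prodMk
      (contDiff_const.add (J.contDiff.comp contDiff_snd))
  let Ω₁ : Set (Euc d × Euc n) := (c.target ×ˢ e.target) ∩
    (fun p : Euc d × Euc n => c.symm p.1 • e.symm p.2) ⁻¹' e.source
  have hΩ₁ : IsOpen Ω₁ := by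
    refine ContinuousOn.isOpen_inter_preimage ?_ (c.open_target.prod e.open_target) e.open_source
    exact (c.continuousOn_symm.comp continuousOn_fst fun p hp => hp.1).smul
      (e.continuousOn_symm.comp continuousOn_snd fun p hp => hp.2)
  have hι0 : ι 0 = (c 1, y₀) := by simp [ι]
  have hmem : (c 1, y₀) ∈ Ω₁ :=
    ⟨⟨mem_chart_target _ _, hy₀⟩, by
      change c.symm (c 1) • e.symm y₀ ∈ e.source
      rw [chartAt_one_symm_smul]; exact e.map_target hy₀⟩
  have hsm : ContDiffOn ℝ ∞ (fun p => localAct d G e (ι p)) (ι ⁻¹' Ω₁) := fun p hp =>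
    ((contDiffAt_localAct_of_mem d G he hp.1.1 hp.1.2 hp.2).comp p
      hι.contDiffAt).contDiffWithinAt
  have hder : fderiv ℝ (fun p => localAct d G e (ι p)) 0 =
      (coordAct d G e y₀ ∘L i).coprod J := by
    have hd : HasFDerivAt (localAct d G e) (fderiv ℝ (localAct d G e) (c 1, y₀)) (ι 0) := by
      rw [hι0]
      exact ((contDiffAt_localAct d G he hy₀).differentiableAt (by simp)).hasFDerivAt
    have hdι : HasFDerivAt ι (i.prodMap J) 0 :=
      ((i.prodMap J).hasFDerivAt (x := 0)).const_add (c 1, y₀)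
    refine (hd.comp (0 : Euc r × Euc k) hdι).fderiv.trans ?_
    have h1 := coordAct_eq_fderiv d G he hy₀
    -- The group element `1` acts as the identity, hence so does the partial differential in `y`.
    have h2 : fderiv ℝ (localAct d G e) (c 1, y₀) ∘L ContinuousLinearMap.inr ℝ (Euc d) (Euc n) =
        ContinuousLinearMap.id ℝ (Euc n) := by
      have h3 : HasFDerivAt (fun y : Euc n => (c 1, y))
        (ContinuousLinearMap.inr ℝ (Euc d) (Euc n)) y₀ := hasFDerivAt_prodMk_right _ _
      rw [hι0] at hd
      rw [← (hd.comp y₀ h3).fderiv]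
      have : (localAct d G e ∘ fun y : Euc n => (c 1, y)) =ᶠ[𝓝 y₀] id := by
        filter_upwards [e.open_target.mem_nhds hy₀] with y hy
        change e (c.symm (c 1) • e.symm y) = y
        rw [chartAt_one_symm_smul, e.right_inv hy]
      rw [this.fderiv_eq, fderiv_id]
    refine ContinuousLinearMap.ext fun p => ?_
    rw [h1]
    have h4 : i.prodMap J p = ContinuousLinearMap.inl ℝ (Euc d) (Euc n) (i p.1) +
        ContinuousLinearMap.inr ℝ (Euc d) (Euc n) (J p.2) := by
      simp [Prod.map]
    have h5 := congrArg (fun f : Euc n →L[ℝ] Euc n => f (J p.2)) h2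
    change fderiv ℝ (localAct d G e) (c 1, y₀) (i.prodMap J p) = _
    rw [h4, map_add]
    exact congrArg (fun z => fderiv ℝ (localAct d G e) (c 1, y₀)
      (ContinuousLinearMap.inl ℝ (Euc d) (Euc n) (i p.1)) + z) h5
  obtain ⟨H, hH0, hHS, hH, hHs⟩ := exists_localInverse (hΩ₁.preimage hι.continuous) hsm
    (p₀ := 0) (by rw [mem_preimage, hι0]; exact hmem) (by rw [hder]; exact hij)
  exact ⟨⟨i, J, H, hH0, fun p hp => (hHS hp).1.1, fun p hp => (hHS hp).1.2,
    fun p hp => (hHS hp).2, fun p => congrFun hH p, hHs⟩⟩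

namespace FlowBox

variable {y₀ : Euc n} {r k : ℕ} (F : FlowBox d G e y₀ r k)

/-- The transversal coordinate. -/
def σ (y : Euc n) : Euc k := (F.H.symm y).2

lemma contDiffAt_σ {y : Euc n} (hy : y ∈ F.H.target) : ContDiffAt ℝ ∞ F.σ y :=
  contDiffAt_snd.comp y (F.contDiffAt_symm y hy)

lemma contDiffAt_H (he : e ∈ IsManifold.maximalAtlas (𝓡 n) ∞ N) {p : Euc r × Euc k}
    (hp : p ∈ F.H.source) : ContDiffAt ℝ ∞ F.H p := by
  have h : ⇑F.H = fun p => localAct d G e (chartAt (Euc d) (1 : G) 1 + F.i p.1, y₀ + F.J p.2) :=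
    funext F.apply_eq
  rw [h]
  exact (contDiffAt_localAct_of_mem d G he (F.mem_chart p hp) (F.mem_target p hp)
    (F.mem_source p hp)).comp p
    ((contDiffAt_const.add (F.i.contDiff.contDiffAt.comp p contDiffAt_fst)).prodMk
      (contDiffAt_const.add (F.J.contDiff.contDiffAt.comp p contDiffAt_snd)))

lemma fderiv_σ_fderiv_H (he : e ∈ IsManifold.maximalAtlas (𝓡 n) ∞ N) {p : Euc r × Euc k}
    (hp : p ∈ F.H.source) (v : Euc r × Euc k) :
    fderiv ℝ F.σ (F.H p) (fderiv ℝ F.H p v) = v.2 := by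
  have h1 := ((F.contDiffAt_σ (F.H.map_source hp)).differentiableAt (by simp)).hasFDerivAt
  have h2 := ((F.contDiffAt_H he hp).differentiableAt (by simp)).hasFDerivAt
  have h3 : F.σ ∘ F.H =ᶠ[𝓝 p] Prod.snd := by
    filter_upwards [F.H.open_source.mem_nhds hp] with q hq
    simp [σ, F.H.left_inv hq]
  have h4 := (h1.comp p h2).unique (hasFDerivAt_snd.congr_of_eventuallyEq h3)
  exact congrArg (fun f : Euc r × Euc k →L[ℝ] Euc k => f v) h4

lemma surjective_fderiv_σ (he : e ∈ IsManifold.maximalAtlas (𝓡 n) ∞ N) {y : Euc n}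
    (hy : y ∈ F.H.target) : Function.Surjective (fderiv ℝ F.σ y) := by
  intro w
  have := F.fderiv_σ_fderiv_H he (F.H.map_target hy) (0, w)
  rw [F.H.right_inv hy] at this
  exact ⟨_, this⟩

lemma injective_fderiv_H (he : e ∈ IsManifold.maximalAtlas (𝓡 n) ∞ N) {p : Euc r × Euc k}
    (hp : p ∈ F.H.source) : Function.Injective (fderiv ℝ F.H p) := by
  have h1 := ((F.contDiffAt_symm _ (F.H.map_source hp)).differentiableAt (by simp)).hasFDerivAt
  have h2 := ((F.contDiffAt_H he hp).differentiableAt (by simp)).hasFDerivAt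
  have h3 : F.H.symm ∘ F.H =ᶠ[𝓝 p] id := by
    filter_upwards [F.H.open_source.mem_nhds hp] with q hq
    simp [F.H.left_inv hq]
  have h4 := (h1.comp p h2).unique ((hasFDerivAt_id p).congr_of_eventuallyEq h3)
  exact Function.LeftInverse.injective fun v =>
    congrArg (fun f : Euc r × Euc k →L[ℝ] Euc r × Euc k => f v) h4

lemma target_subset : F.H.target ⊆ e.target := by
  intro y hy
  rw [← F.H.right_inv hy, F.apply_eq]
  exact e.map_source (F.mem_source _ (F.H.map_target hy))

/-- The transversal coordinate is constant along the orbits, infinitesimally. -/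
lemma fderiv_σ_coordAct (he : e ∈ IsManifold.maximalAtlas (𝓡 n) ∞ N) {y : Euc n}
    (hy : y ∈ F.H.target) (hr : orbitRank d n G (e.symm y) = r) (w : Euc d) :
    fderiv ℝ F.σ y (coordAct d G e y w) = 0 := by
  rw [← finrank_range_coordAct he (F.target_subset hy)] at hr
  obtain ⟨p, hp, rfl⟩ : ∃ p ∈ F.H.source, F.H p = y :=
    ⟨F.H.symm y, F.H.map_target hy, F.H.right_inv hy⟩
  -- Varying `t` with `z` fixed moves along an orbit.
  have h1 : ∀ t, fderiv ℝ F.H p (t, 0) ∈ LinearMap.range (coordAct d G e (F.H p)).toLinearMap := by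
    intro t
    obtain ⟨w, hw⟩ := exists_fderiv_localAct he (F.mem_chart p hp) (F.mem_source p hp) (F.i t)
    refine ⟨w, ?_⟩
    rw [← F.apply_eq p] at hw
    refine hw.symm.trans ?_
    have h2 := ((F.contDiffAt_H he hp).differentiableAt (by simp)).hasFDerivAt
    have h3 : HasFDerivAt (fun t : Euc r => F.H (t, p.2))
        (fderiv ℝ F.H p ∘L ContinuousLinearMap.inl ℝ (Euc r) (Euc k)) p.1 :=
      HasFDerivAt.comp (g := F.H) (f := fun t => (t, p.2)) p.1 h2 (hasFDerivAt_prodMk_left p.1 p.2)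
    have h4 : HasFDerivAt (fun u => localAct d G e (u, y₀ + F.J p.2)) (fderiv ℝ
        (fun u => localAct d G e (u, y₀ + F.J p.2)) (chartAt (Euc d) (1 : G) 1 + F.i p.1))
        (chartAt (Euc d) (1 : G) 1 + F.i p.1) := by
      refine DifferentiableAt.hasFDerivAt ?_
      exact ((contDiffAt_localAct_of_mem d G he (F.mem_chart p hp) (F.mem_target p hp)
        (F.mem_source p hp)).differentiableAt (by simp)).comp
          (chartAt (Euc d) (1 : G) 1 + F.i p.1) (by fun_prop)
    have h5 : HasFDerivAt (fun t : Euc r => chartAt (Euc d) (1 : G) 1 + F.i t) F.i p.1 :=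
      F.i.hasFDerivAt.const_add _
    have h6 := h4.comp p.1 h5
    have h7 : (fun t : Euc r => F.H (t, p.2)) = (fun u => localAct d G e (u, y₀ + F.J p.2)) ∘
        fun t : Euc r => chartAt (Euc d) (1 : G) 1 + F.i t := funext fun t => F.apply_eq (t, p.2)
    rw [h7] at h3
    exact congrArg (fun f : Euc r →L[ℝ] Euc n => f t) (h6.unique h3)
  let Λ : Euc r →ₗ[ℝ] LinearMap.range (coordAct d G e (F.H p)).toLinearMap :=
    ((fderiv ℝ F.H p ∘L ContinuousLinearMap.inl ℝ (Euc r) (Euc k)).toLinearMap).codRestrict _ h1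
  have hΛ : Function.Injective Λ := by
    intro t t' htt
    have h2 : fderiv ℝ F.H p (t, 0) = fderiv ℝ F.H p (t', 0) := congrArg Subtype.val htt
    exact congrArg Prod.fst (F.injective_fderiv_H he hp h2)
  -- Both spaces have dimension `r`, so the `t`-directions fill the tangent space of the orbit; `σ`
  -- does not see them.
  have hΛs : Function.Surjective Λ :=
    (LinearMap.injective_iff_surjective_of_finrank_eq_finrank
      (by rw [finrank_euclideanSpace_fin, hr])).1 hΛ
  obtain ⟨t, ht⟩ := hΛs ⟨_, ⟨w, rfl⟩⟩
  have h2 : fderiv ℝ F.H p (t, 0) = coordAct d G e (F.H p) w := congrArg Subtype.val ht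
  rw [← h2, F.fderiv_σ_fderiv_H he hp]

end FlowBox

end FlowBox

end

noncomputable section

/-! ### Local slices and charts of the orbit space -/

section Slice

variable {d n : ℕ} {G : Type*} [TopologicalSpace G] [ChartedSpace (Euc d) G] [Group G]
  [LieGroup (𝓡 d) ∞ G] [CompactSpace G]
  {N : Type*} [TopologicalSpace N] [ChartedSpace (Euc n) N] [IsManifold (𝓡 n) ∞ N] [T2Space N]
  [MulAction G N] [ContMDiffSMul (𝓡 d) (𝓡 n) ∞ G N]

/-- The transversal coordinate is constant along small pieces of orbits. -/
lemma FlowBox.exists_σ_localAct_eq {e : OpenPartialHomeomorph N (Euc n)} {y₀ : Euc n} {r k : ℕ}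
    (F : FlowBox d G e y₀ r k) (he : e ∈ IsManifold.maximalAtlas (𝓡 n) ∞ N) (hy₀ : y₀ ∈ F.H.target)
    (hr : ∀ x : N, orbitRank d n G x = r) :
    ∃ V ∈ 𝓝 (1 : G), ∃ W ∈ 𝓝 y₀, ∀ a ∈ V, ∀ y ∈ W, a • e.symm y ∈ e.source ∧
      F.σ (e (a • e.symm y)) = F.σ y := by
  set c := chartAt (Euc d) (1 : G) with hc
  have hcs : ContinuousSMul G N := ContMDiffSMul.continuousSMul (I := 𝓡 d) (I' := 𝓡 n) ∞
  let Ω : Set (Euc d × Euc n) := (c.target ×ˢ e.target) ∩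
    (fun p : Euc d × Euc n => c.symm p.1 • e.symm p.2) ⁻¹' (e.source ∩ e ⁻¹' F.H.target)
  have hΩ : IsOpen Ω := by
    refine ContinuousOn.isOpen_inter_preimage ?_ (c.open_target.prod e.open_target)
      (e.isOpen_inter_preimage F.H.open_target)
    exact (c.continuousOn_symm.comp continuousOn_fst fun p hp => hp.1).smul
      (e.continuousOn_symm.comp continuousOn_snd fun p hp => hp.2)
  have hy₀e := F.target_subset hy₀
  have hmem : (c 1, y₀) ∈ Ω := by
    refine ⟨⟨mem_chart_target _ _, hy₀e⟩, ?_⟩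
    change c.symm (c 1) • e.symm y₀ ∈ e.source ∩ e ⁻¹' F.H.target
    rw [chartAt_one_symm_smul]
    refine ⟨e.map_target hy₀e, ?_⟩
    rw [mem_preimage, e.right_inv hy₀e]
    exact hy₀
  obtain ⟨S, hS, W, hW, hSW⟩ := mem_nhds_prod_iff.1 (hΩ.mem_nhds hmem)
  -- A ball of group parameters is convex, so the vanishing derivative computed below forces
  -- constancy.
  obtain ⟨δ, hδ, hball⟩ := Metric.mem_nhds_iff.1 hS
  refine ⟨c.source ∩ c ⁻¹' Metric.ball (c 1) δ, inter_mem (c.open_source.mem_nhds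
    (mem_chart_source _ _)) (c.continuousAt (mem_chart_source _ _) (Metric.ball_mem_nhds _ hδ)),
    W, hW, ?_⟩
  rintro a ⟨hac, haδ⟩ y hy
  have hΩy : ∀ u ∈ Metric.ball (c 1) δ, (u, y) ∈ Ω := fun u hu => hSW (mk_mem_prod (hball hu) hy)
  have hau := hΩy (c a) haδ
  have hae : a • e.symm y ∈ e.source := by
    have := hau.2.1
    change c.symm (c a) • e.symm y ∈ e.source at this
    rwa [c.left_inv hac] at this
  refine ⟨hae, ?_⟩
  have hdiff : ∀ u ∈ Metric.ball (c 1) δ,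
      HasFDerivAt (fun u => F.σ (localAct d G e (u, y))) (0 : Euc d →L[ℝ] Euc k) u := by
    intro u hu
    obtain ⟨⟨huc, hye⟩, hus, hut⟩ := hΩy u hu
    have h1 : DifferentiableAt ℝ (fun u => localAct d G e (u, y)) u :=
      DifferentiableAt.comp (g := localAct d G e) (f := fun u => (u, y)) u
        ((contDiffAt_localAct_of_mem d G (p := (u, y)) he huc hye hus).differentiableAt
          (by simp)) (by fun_prop)
    have hut' : localAct d G e (u, y) ∈ F.H.target := hut
    have h2 := ((F.contDiffAt_σ hut').differentiableAt (by simp)).hasFDerivAt.comp u h1.hasFDerivAt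
    have h3 : fderiv ℝ F.σ (localAct d G e (u, y)) ∘L
        fderiv ℝ (fun u => localAct d G e (u, y)) u = 0 := by
      ext1 v
      obtain ⟨w, hw⟩ := exists_fderiv_localAct (d := d) (G := G) he huc hus v
      rw [ContinuousLinearMap.comp_apply, hw, F.fderiv_σ_coordAct he hut' (hr _)]
      rfl
    rw [h3] at h2
    exact h2
  have hconst := (convex_ball (c 1) δ).is_const_of_fderivWithin_eq_zero (𝕜 := ℝ)
    (f := fun u => F.σ (localAct d G e (u, y)))
    (fun u hu => (hdiff u hu).differentiableAt.differentiableWithinAt)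
    (fun u hu => by
      rw [fderivWithin_of_isOpen Metric.isOpen_ball hu, (hdiff u hu).fderiv])
    haδ (Metric.mem_ball_self hδ)
  have h1 : localAct d G e (c a, y) = e (a • e.symm y) := by
    change e (c.symm (c a) • e.symm y) = _
    rw [c.left_inv hac]
  have h2 : localAct d G e (c 1, y) = y := by
    change e (c.symm (c 1) • e.symm y) = y
    rw [chartAt_one_symm_smul, e.right_inv hau.1.2]
  simpa only [h1, h2] using hconst

/-- A local slice for the orbits: a transversal coordinate `σ` and a section `s`. -/
structure OrbitSlice (d : ℕ) (G : Type*) [TopologicalSpace G] [ChartedSpace (Euc d) G] [Group G]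
    [MulAction G N] (k : ℕ) (x₀ : N) where
  σ : N → Euc k
  s : Euc k → N
  W : Set N
  O : Set (Euc k)
  isOpen_W : IsOpen W
  mem_W : x₀ ∈ W
  isOpen_O : IsOpen O
  mem_O : σ x₀ ∈ O
  contMDiffAt_σ : ∀ y ∈ W, ContMDiffAt (𝓡 n) (𝓡 k) ∞ σ y
  surjective_tderiv_σ : ∀ y ∈ W, Function.Surjective (tderiv (Euc n) (Euc k) σ y)
  s_mem : ∀ z ∈ O, s z ∈ W
  σ_s : ∀ z ∈ O, σ (s z) = z
  contMDiffAt_s : ∀ z ∈ O, ContMDiffAt (𝓡 k) (𝓡 n) ∞ s z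
  exists_smul_s : ∀ y ∈ W, ∃ a : G, a • s (σ y) = y
  σ_eq : ∀ y ∈ W, ∀ y' ∈ W, (∃ a : G, a • y = y') → σ y = σ y'

/-- The flow box provides `σ` and the section `z ↦ e⁻¹ (y₀ + J z)`. That `σ` separates orbits no
more finely than it should is the global part, and rests on regularity of `x₀`. -/
theorem exists_orbitSlice {r k : ℕ} (hr : ∀ x : N, orbitRank d n G x = r) (hk : r + k = n) {x₀ : N}
    (hx₀ : x₀ ∈ regularPart G N) : Nonempty (OrbitSlice d G (n := n) k x₀) := by
  have hcs : ContinuousSMul G N := ContMDiffSMul.continuousSMul (I := 𝓡 d) (I' := 𝓡 n) ∞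
  have htg : IsTopologicalGroup G := topologicalGroup_of_lieGroup (𝓡 d) ∞
  set e := chartAt (Euc n) x₀ with hedef
  have he : e ∈ IsManifold.maximalAtlas (𝓡 n) ∞ N := chartAt_mem_maximalAtlas x₀
  have hx₀e : x₀ ∈ e.source := mem_chart_source _ _
  set y₀ := e x₀ with hy₀
  obtain ⟨F⟩ := exists_flowBox (d := d) (G := G) he (e.map_source hx₀e) (hr _) hk
  have hF0 : F.H 0 = y₀ := by
    rw [F.apply_eq]
    simp only [Prod.fst_zero, Prod.snd_zero, map_zero, add_zero]
    change e ((chartAt (Euc d) (1 : G)).symm (chartAt (Euc d) (1 : G) 1) • e.symm (e x₀)) = _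
    rw [chartAt_one_symm_smul, e.left_inv hx₀e]
  have hy₀F : y₀ ∈ F.H.target := hF0 ▸ F.H.map_source F.zero_mem
  obtain ⟨V, hV, W₁, hW₁, hVW⟩ := F.exists_σ_localAct_eq he hy₀F hr
  obtain ⟨W₂, W₃, hW₂, hx₀W₂, hW₃o, hx₀W₃, hW₂₃⟩ :=
    mem_nhds_prod_iff'.1 (eventually_exists_smul_eq hx₀ hV)
  obtain ⟨W₁', hW₁', hW₁o, hy₀W₁⟩ := mem_nhds_iff.1 hW₁
  set W : Set N := (e.source ∩ e ⁻¹' (F.H.target ∩ W₁')) ∩ (W₂ ∩ W₃) with hWdef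
  have hWo : IsOpen W :=
    (e.isOpen_inter_preimage (F.H.open_target.inter hW₁o)).inter (hW₂.inter hW₃o)
  have hx₀W : x₀ ∈ W := ⟨⟨hx₀e, hy₀F, hy₀W₁⟩, hx₀W₂, hx₀W₃⟩
  set ι : Euc k → Euc n := fun z => y₀ + F.J z with hι
  have hιs : ContDiff ℝ ∞ ι := contDiff_const.add F.J.contDiff
  set O : Set (Euc k) := ι ⁻¹' (e.target ∩ e.symm ⁻¹' W) ∩
    (fun z => ((0 : Euc r), z)) ⁻¹' F.H.source with hOdef
  have hOo : IsOpen O := ((e.isOpen_inter_preimage_symm hWo).preimage hιs.continuous).inter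
    (F.H.open_source.preimage (by fun_prop))
  have hH0z : ∀ z, ι z ∈ e.target → F.H (0, z) = ι z := by
    intro z hz
    rw [F.apply_eq]
    simp only [map_zero, add_zero]
    change e ((chartAt (Euc d) (1 : G)).symm (chartAt (Euc d) (1 : G) 1) • e.symm (ι z)) = _
    rw [chartAt_one_symm_smul, e.right_inv hz]
  have hσ0 : F.σ y₀ = 0 := by
    rw [FlowBox.σ, ← hF0, F.H.left_inv F.zero_mem]; rfl
  have hι0 : ι 0 = y₀ := by simp [hι]
  refine ⟨⟨fun x => F.σ (e x), fun z => e.symm (ι z), W, O, hWo, hx₀W, hOo, ?_, ?_, ?_, ?_, ?_, ?_,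
    ?_, ?_⟩⟩
  · change F.σ y₀ ∈ O
    rw [hσ0]
    refine ⟨?_, F.zero_mem⟩
    rw [mem_preimage, hι0]
    exact ⟨e.map_source hx₀e, by rw [mem_preimage, e.left_inv hx₀e]; exact hx₀W⟩
  · intro y hy
    exact ContMDiffAt.comp (g := F.σ) (f := e) y (F.contDiffAt_σ hy.1.2.1).contMDiffAt
      (contMDiffAt_of_mem_maximalAtlas he hy.1.1)
  · intro y hy
    have h1 : MDifferentiableAt (𝓡 n) (𝓡 k) F.σ (e y) :=
      (F.contDiffAt_σ hy.1.2.1).contMDiffAt.mdifferentiableAt (by simp)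
    have h2 : MDifferentiableAt (𝓡 n) (𝓡 n) e y :=
      (contMDiffAt_of_mem_maximalAtlas he hy.1.1).mdifferentiableAt (by simp)
    rw [tderiv_comp (g := F.σ) (f := e) h1 h2, tderiv_eq_fderiv]
    refine (F.surjective_fderiv_σ he hy.1.2.1).comp fun v => ?_
    refine ⟨tderiv (Euc n) (Euc n) e.symm (e y) v, ?_⟩
    have := tderiv_chart_comp_symm he (e.map_source hy.1.1) v
    rwa [e.left_inv hy.1.1] at this
  · exact fun z hz => hz.1.2
  · intro z hz
    rw [e.right_inv hz.1.1, ← hH0z z hz.1.1, FlowBox.σ, F.H.left_inv hz.2]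
  · intro z hz
    exact ContMDiffAt.comp z (contMDiffAt_symm_of_mem_maximalAtlas he hz.1.1)
      hιs.contDiffAt.contMDiffAt
  · intro y hy
    have hp := F.H.map_target hy.1.2.1
    set p := F.H.symm (e y) with hpdef
    refine ⟨(chartAt (Euc d) (1 : G)).symm (chartAt (Euc d) (1 : G) 1 + F.i p.1), ?_⟩
    change _ • e.symm (ι p.2) = y
    have h1 : F.H p = e y := F.H.right_inv hy.1.2.1
    rw [F.apply_eq] at h1
    exact e.injOn (F.mem_source p hp) hy.1.1 h1
  · rintro y hy y' hy' h
    -- An arbitrary group element joining `y` to `y'` is exchanged for one in `V`, along which `σ`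
    -- is known to be constant.
    obtain ⟨a, ha, hay⟩ := hW₂₃ (mk_mem_prod hy.2.1 hy'.2.2) h
    have hay' : a • y = y' := hay
    subst hay'
    have h2 := (hVW a ha (e y) (hW₁' hy.1.2.2)).2
    rw [e.left_inv hy.1.1] at h2
    exact h2.symm

variable {B : Type*} [TopologicalSpace B] {f : N → B}

/-- The chart of the orbit space defined by a slice. -/
lemma OrbitSlice.exists_chart {k : ℕ} {x₀ : N} (S : OrbitSlice d G (n := n) k x₀)
    (hf : IsOpenQuotientMap f) (hfib : ∀ x y, f x = f y ↔ ∃ a : G, a • x = y) :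
    ∃ χ : OpenPartialHomeomorph B (Euc k), f x₀ ∈ χ.source ∧
      (∀ z ∈ χ.target, χ.symm z = f (S.s z) ∧ ContMDiffAt (𝓡 k) (𝓡 n) ∞ S.s z) ∧
      ∀ y, f y ∈ χ.source → ContMDiffAt (𝓡 n) (𝓡 k) ∞ (fun y => χ (f y)) y ∧
        Function.Surjective (tderiv (Euc n) (Euc k) (fun y => χ (f y)) y) := by
  have hinj : InjOn (fun z => f (S.s z)) S.O := by
    intro z hz z' hz' h
    rw [← S.σ_s z hz, ← S.σ_s z' hz']
    exact S.σ_eq _ (S.s_mem z hz) _ (S.s_mem z' hz') ((hfib _ _).1 h)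
  have hfs : ∀ y ∈ S.W, f (S.s (S.σ y)) = f y := fun y hy => (hfib _ _).2 (S.exists_smul_s y hy)
  have hσc : ContinuousOn S.σ S.W := fun y hy =>
    (S.contMDiffAt_σ y hy).continuousAt.continuousWithinAt
  have hopen : ∀ O' ⊆ S.O, IsOpen O' → IsOpen ((fun z => f (S.s z)) '' O') := by
    intro O' hO' hO'o
    -- Written this way, the image is open because `f` is an open map.
    have : (fun z => f (S.s z)) '' O' = f '' (S.W ∩ S.σ ⁻¹' O') := by
      ext b
      constructor
      · rintro ⟨z, hz, rfl⟩
        refine ⟨S.s z, ⟨S.s_mem z (hO' hz), ?_⟩, rfl⟩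
        rw [mem_preimage, S.σ_s z (hO' hz)]
        exact hz
      · rintro ⟨y, ⟨hyW, hyO⟩, rfl⟩
        exact ⟨S.σ y, hyO, hfs y hyW⟩
    rw [this]
    exact hf.isOpenMap _ (hσc.isOpen_inter_preimage S.isOpen_W hO'o)
  have : Nonempty (Euc k) := ⟨0⟩
  let ψ₀ : PartialEquiv (Euc k) B := hinj.toPartialEquiv
  have hψ₀ : ⇑ψ₀ = fun z => f (S.s z) := rfl
  have hψ₀s : ψ₀.source = S.O := rfl
  have hcont : ContinuousOn ψ₀ ψ₀.source := fun z hz =>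
    (hf.continuous.continuousAt.comp (S.contMDiffAt_s z hz).continuousAt).continuousWithinAt
  let ψ : OpenPartialHomeomorph (Euc k) B :=
    OpenPartialHomeomorph.ofContinuousOpenRestrict ψ₀ hcont (by
      intro O' hO'
      obtain ⟨O'', hO'', rfl⟩ := isOpen_induced_iff.1 hO'
      have := hopen (S.O ∩ O'') inter_subset_left (S.isOpen_O.inter hO'')
      convert this using 1
      ext b
      constructor
      · rintro ⟨⟨z, hz⟩, hz', rfl⟩
        exact ⟨z, ⟨hz, hz'⟩, rfl⟩
      · rintro ⟨z, ⟨hz, hz'⟩, rfl⟩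
        exact ⟨⟨z, hz⟩, hz', rfl⟩) S.isOpen_O
  have hψ : ∀ z, ψ z = f (S.s z) := fun z => rfl
  have hψs : ψ.source = S.O := rfl
  have hcs : ContinuousSMul G N := ContMDiffSMul.continuousSMul (I := 𝓡 d) (I' := 𝓡 n) ∞
  refine ⟨ψ.symm, ?_, fun z hz => ⟨rfl, S.contMDiffAt_s z hz⟩, fun y hy => ?_⟩
  · have := ψ.map_source (x := S.σ x₀) S.mem_O
    rw [hψ, hfs x₀ S.mem_W] at this
    exact this
  · set z := ψ.symm (f y) with hz
    have hzO : z ∈ S.O := ψ.map_target hy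
    have hfz : f (S.s z) = f y := ψ.right_inv hy
    -- The point `y` itself may lie outside `W`; only its orbit meets `W`. Translating by `a`
    -- reduces to `σ` near a point of `W`.
    obtain ⟨a, ha⟩ := (hfib y (S.s z)).1 hfz.symm
    have hWO : IsOpen (S.W ∩ S.σ ⁻¹' S.O) := hσc.isOpen_inter_preimage S.isOpen_W S.isOpen_O
    have hyW : a • y ∈ S.W ∩ S.σ ⁻¹' S.O := by
      rw [ha]
      exact ⟨S.s_mem z hzO, by rw [mem_preimage, S.σ_s z hzO]; exact hzO⟩
    have hev : (fun y => ψ.symm (f y)) =ᶠ[𝓝 y] fun y => S.σ (a • y) := by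
      filter_upwards [(hWO.preimage (continuous_const_smul a)).mem_nhds hyW] with y' hy'
      have h1 : f y' = ψ (S.σ (a • y')) := by
        rw [hψ, hfs _ hy'.1]
        exact (hfib _ _).2 ⟨a, rfl⟩
      rw [h1, ψ.left_inv hy'.2]
    have h1 := S.contMDiffAt_σ _ hyW.1
    have h2 : ContMDiffAt (𝓡 n) (𝓡 n) ∞ (fun y : N => a • y) y := contMDiff_translate d G a y
    refine ⟨(ContMDiffAt.comp y h1 h2).congr_of_eventuallyEq hev, ?_⟩
    rw [tderiv_congr hev, tderiv_comp (g := S.σ) (f := fun y : N => a • y)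
      (h1.mdifferentiableAt (by simp)) (h2.mdifferentiableAt (by simp))]
    exact (S.surjective_tderiv_σ _ hyW.1).comp (bijective_transDeriv d a y).2

end Slice

end

noncomputable section

/-! ### The smooth structure of the orbit space -/

section OrbitManifold

variable {d n : ℕ} {G : Type*} [TopologicalSpace G] [ChartedSpace (Euc d) G] [Group G]
  [LieGroup (𝓡 d) ∞ G] [CompactSpace G]
  {N : Type*} [TopologicalSpace N] [ChartedSpace (Euc n) N] [IsManifold (𝓡 n) ∞ N] [T2Space N]
  [MulAction G N] [ContMDiffSMul (𝓡 d) (𝓡 n) ∞ G N]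
  {B : Type*} [TopologicalSpace B] {f : N → B}

/-- The orbit space of an action with only principal orbits is a manifold. -/
theorem exists_orbitManifold {r k : ℕ} (hr : ∀ x : N, orbitRank d n G x = r) (hk : r + k = n)
    (hreg : ∀ x : N, x ∈ regularPart G N) (hf : IsOpenQuotientMap f)
    (hfib : ∀ x y, f x = f y ↔ ∃ a : G, a • x = y) :
    ∃ (_ : ChartedSpace (Euc k) B) (_ : IsManifold (𝓡 k) ∞ B), ContMDiff (𝓡 n) (𝓡 k) ∞ f ∧
      (∀ x, Function.Surjective (tderiv (Euc n) (Euc k) f x)) ∧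
      ∀ b : B, ∃ s : Euc k → N, ∀ z ∈ (chartAt (Euc k) b).target,
        (chartAt (Euc k) b).symm z = f (s z) ∧ ContMDiffAt (𝓡 k) (𝓡 n) ∞ s z := by
  have hall : ∀ b : B, ∃ (χ : OpenPartialHomeomorph B (Euc k)) (s : Euc k → N), b ∈ χ.source ∧
      (∀ z ∈ χ.target, χ.symm z = f (s z) ∧ ContMDiffAt (𝓡 k) (𝓡 n) ∞ s z) ∧
      ∀ y, f y ∈ χ.source → ContMDiffAt (𝓡 n) (𝓡 k) ∞ (fun y => χ (f y)) y ∧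
        Function.Surjective (tderiv (Euc n) (Euc k) (fun y => χ (f y)) y) := by
    intro b
    obtain ⟨x₀, rfl⟩ := hf.surjective b
    obtain ⟨S⟩ := exists_orbitSlice (d := d) (G := G) hr hk (hreg x₀)
    obtain ⟨χ, h⟩ := S.exists_chart hf hfib
    exact ⟨χ, S.s, h⟩
  choose χ s hb hs hχ using hall
  let cs : ChartedSpace (Euc k) B :=
    { atlas := range χ
      chartAt := χ
      mem_chart_source := hb
      chart_mem_atlas := fun b => ⟨b, rfl⟩ }
  have hm : IsManifold (𝓡 k) ∞ B := by
    refine isManifold_of_contDiffOn (𝓡 k) ∞ B ?_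
    rintro _ _ ⟨b, rfl⟩ ⟨b', rfl⟩
    rintro z ⟨hz, -⟩
    have hz1 : z ∈ (χ b).target := hz.1
    have hz2 : (χ b).symm z ∈ (χ b').source := hz.2
    obtain ⟨h1, h2⟩ := hs b z hz1
    rw [h1] at hz2
    -- The transition map factors through `N`: a local section followed by `χ b' ∘ f`, both smooth.
    have h3 : ContMDiffAt (𝓡 k) (𝓡 k) ∞ (fun z => χ b' (f (s b z))) z :=
      ContMDiffAt.comp (g := fun y => χ b' (f y)) (f := s b) z (hχ b' _ hz2).1 h2
    refine ContDiffAt.contDiffWithinAt ((contMDiffAt_iff_contDiffAt.1 h3).congr_of_eventuallyEq ?_)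
    filter_upwards [(χ b).open_target.mem_nhds hz1] with w hw
    exact congrArg (χ b') (hs b w hw).1
  have hmem : ∀ b, χ b ∈ IsManifold.maximalAtlas (𝓡 k) ∞ B := fun b => chartAt_mem_maximalAtlas b
  have hev : ∀ x, (fun y => (χ (f x)).symm (χ (f x) (f y))) =ᶠ[𝓝 x] f := by
    intro x
    filter_upwards [((χ (f x)).open_source.preimage hf.continuous).mem_nhds (hb (f x))] with y hy
    exact (χ (f x)).left_inv hy
  have hsy : ∀ x, ContMDiffAt (𝓡 k) (𝓡 k) ∞ (χ (f x)).symm (χ (f x) (f x)) := fun x =>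
    contMDiffAt_symm_of_mem_maximalAtlas (hmem _) ((χ (f x)).map_source (hb _))
  refine ⟨cs, hm, fun x => ?_, fun x => ?_, fun b => ⟨s b, hs b⟩⟩
  · exact (ContMDiffAt.comp (g := (χ (f x)).symm) (f := fun y => χ (f x) (f y)) x (hsy x)
      (hχ (f x) x (hb _)).1).congr_of_eventuallyEq (hev x).symm
  · rw [← tderiv_congr (hev x), tderiv_comp (g := (χ (f x)).symm) (f := fun y => χ (f x) (f y))
      ((hsy x).mdifferentiableAt (by simp)) ((hχ (f x) x (hb _)).1.mdifferentiableAt (by simp))]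
    have h1 : Function.Surjective (tderiv (Euc k) (Euc k) (χ (f x)).symm (χ (f x) (f x))) :=
      fun v => ⟨_, tderiv_symm_comp_chart (hmem _) (hb (f x)) v⟩
    exact h1.comp (hχ (f x) x (hb _)).2

end OrbitManifold

/-! ### The metric of the quotient -/

section QuotientMetric

variable {n k : ℕ}
  {N : Type*} [TopologicalSpace N] [ChartedSpace (Euc n) N] [IsManifold (𝓡 n) ∞ N]
  {B : Type*} [TopologicalSpace B] [ChartedSpace (Euc k) B] [IsManifold (𝓡 k) ∞ B] {f : N → B}

/-- The quotient metric in charts. -/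
lemma coordForm_quotient (g : SmoothMetric n N) (hf : ContMDiff (𝓡 n) (𝓡 k) ∞ f)
    (hsub : ∀ x, Function.Surjective (tderiv (Euc n) (Euc k) f x))
    {h : B → Euc k →L[ℝ] Euc k →L[ℝ] ℝ}
    (hh : ∀ x, h (f x) = quotForm (tderiv (Euc n) (Euc k) f x) (g.toForm x))
    {e : OpenPartialHomeomorph N (Euc n)} (he : e ∈ IsManifold.maximalAtlas (𝓡 n) ∞ N)
    {χ : OpenPartialHomeomorph B (Euc k)} (hχ : χ ∈ IsManifold.maximalAtlas (𝓡 k) ∞ B) {y : Euc n}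
    (hy : y ∈ e.target) (hfy : f (e.symm y) ∈ χ.source) :
    Function.Surjective (fderiv ℝ (fun y => χ (f (e.symm y))) y) ∧
    coordForm χ h (χ (f (e.symm y))) =
      quotForm (fderiv ℝ (fun y => χ (f (e.symm y))) y) (coordForm e g.toForm y) := by
  have h1 : MDifferentiableAt (𝓡 n) (𝓡 n) e.symm y :=
    (contMDiffAt_symm_of_mem_maximalAtlas he hy).mdifferentiableAt (by simp)
  have h2 : MDifferentiableAt (𝓡 n) (𝓡 k) f (e.symm y) := hf.mdifferentiableAt (by simp)
  have h3 : MDifferentiableAt (𝓡 k) (𝓡 k) χ (f (e.symm y)) :=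
    (contMDiffAt_of_mem_maximalAtlas hχ hfy).mdifferentiableAt (by simp)
  have h4 : MDifferentiableAt (𝓡 n) (𝓡 k) (fun y => f (e.symm y)) y :=
    MDifferentiableAt.comp y h2 h1
  have hT : Function.Surjective (tderiv (Euc n) (Euc n) e.symm y) := fun v =>
    ⟨_, tderiv_chart_symm_comp he hy v⟩
  have hS : Function.Injective (tderiv (Euc k) (Euc k) χ.symm (χ (f (e.symm y)))) :=
    Function.LeftInverse.injective (tderiv_chart_comp_symm hχ (χ.map_source hfy))
  have hD : ∀ v, fderiv ℝ (fun y => χ (f (e.symm y))) y v = tderiv (Euc k) (Euc k) χ (f (e.symm y))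
      (tderiv (Euc n) (Euc k) f (e.symm y) (tderiv (Euc n) (Euc n) e.symm y v)) := by
    intro v
    rw [← tderiv_eq_fderiv, tderiv_comp_apply (g := χ) (f := fun y => f (e.symm y)) h3 h4,
      tderiv_comp_apply (g := f) (f := e.symm) h2 h1]
  have hsurj : Function.Surjective (fderiv ℝ (fun y => χ (f (e.symm y))) y) := by
    intro w
    obtain ⟨u, hu⟩ := hsub (e.symm y) (tderiv (Euc k) (Euc k) χ.symm (χ (f (e.symm y))) w)
    obtain ⟨v, rfl⟩ := hT u
    refine ⟨v, ?_⟩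
    rw [hD, hu]
    have := tderiv_chart_comp_symm hχ (χ.map_source hfy) w
    rwa [χ.left_inv hfy] at this
  refine ⟨hsurj, ?_⟩
  ext u v
  refine IsQuotForm.eq ((g.isInner_toForm _).coordForm he hy) hsurj
    (h := fun u v => coordForm χ h (χ (f (e.symm y))) u v) ?_ u v
  have hq : IsQuotForm (tderiv (Euc n) (Euc k) f (e.symm y)) (g.toForm (e.symm y))
      (fun u v => h (χ.symm (χ (f (e.symm y)))) u v) := by
    rw [χ.left_inv hfy, hh]
    exact isQuotForm_quotForm (g.isInner_toForm _) (hsub _)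
  refine hq.of_intertwine (tderiv (Euc n) (Euc n) e.symm y)
    (tderiv (Euc k) (Euc k) χ.symm (χ (f (e.symm y)))) hT hS (fun v => ?_) fun _ _ => rfl
  rw [hD, tderiv_symm_comp_chart hχ hfy]

/-- By `hinv` the quotient form does not depend on the point of the fiber, so an arbitrary one
defines the metric. Smoothness is checked by moving along a local section, where the chart formula
on `N` applies. -/
theorem exists_quotientMetric (g : SmoothMetric n N) (hf : ContMDiff (𝓡 n) (𝓡 k) ∞ f)
    (hsurj : Function.Surjective f)
    (hsub : ∀ x, Function.Surjective (tderiv (Euc n) (Euc k) f x))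
    (hinv : ∀ x y, f x = f y → quotForm (tderiv (Euc n) (Euc k) f x) (g.toForm x) =
      quotForm (tderiv (Euc n) (Euc k) f y) (g.toForm y))
    (hsec : ∀ b : B, ∃ s : Euc k → N, ∀ z ∈ (chartAt (Euc k) b).target,
        (chartAt (Euc k) b).symm z = f (s z) ∧ ContMDiffAt (𝓡 k) (𝓡 n) ∞ s z) :
    ∃ gB : SmoothMetric k B, IsRiemannianSubmersion (𝓡 n) (𝓡 k) f g.form gB.form := by
  let h : B → Euc k →L[ℝ] Euc k →L[ℝ] ℝ := fun b =>
    quotForm (tderiv (Euc n) (Euc k) f (Function.surjInv hsurj b))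
      (g.toForm (Function.surjInv hsurj b))
  have hh : ∀ x, h (f x) = quotForm (tderiv (Euc n) (Euc k) f x) (g.toForm x) := fun x =>
    hinv _ _ (Function.surjInv_eq hsurj (f x))
  have hin : ∀ b, IsInner (h b) := fun b => isInner_quotForm (g.isInner_toForm _) (hsub _)
  have hsm : ∀ b, ContDiffAt ℝ ∞ (coordForm (chartAt (Euc k) b) h) (chartAt (Euc k) b b) := by
    intro b
    set χ := chartAt (Euc k) b with hχdef
    have hχ : χ ∈ IsManifold.maximalAtlas (𝓡 k) ∞ B := chartAt_mem_maximalAtlas b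
    obtain ⟨s, hs⟩ := hsec b
    have hz₀ : χ b ∈ χ.target := mem_chart_target _ _
    have hsz := (hs _ hz₀).2
    set e := chartAt (Euc n) (s (χ b)) with hedef
    have he : e ∈ IsManifold.maximalAtlas (𝓡 n) ∞ N := chartAt_mem_maximalAtlas _
    have hse : s (χ b) ∈ e.source := mem_chart_source _ _
    set y₀ := e (s (χ b)) with hy₀
    have hy₀t : y₀ ∈ e.target := e.map_source hse
    have hfy₀ : f (e.symm y₀) ∈ χ.source := by
      rw [hy₀, e.left_inv hse, ← (hs _ hz₀).1]
      exact χ.map_target hz₀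
    have hφ : ContDiffAt ℝ ∞ (fun y => χ (f (e.symm y))) y₀ := by
      rw [← contMDiffAt_iff_contDiffAt]
      exact ContMDiffAt.comp (g := χ) (f := fun y => f (e.symm y)) y₀
        (contMDiffAt_of_mem_maximalAtlas hχ hfy₀)
        (ContMDiffAt.comp (g := f) (f := e.symm) y₀ (hf _)
          (contMDiffAt_symm_of_mem_maximalAtlas he hy₀t))
    have hes : ContDiffAt ℝ ∞ (fun z => e (s z)) (χ b) := by
      rw [← contMDiffAt_iff_contDiffAt]
      exact ContMDiffAt.comp (g := e) (f := s) (χ b) (contMDiffAt_of_mem_maximalAtlas he hse) hsz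
    have hq : ContDiffAt ℝ ∞ (fun y => quotForm (fderiv ℝ (fun y => χ (f (e.symm y))) y)
        (coordForm e g.toForm y)) y₀ :=
      (hφ.fderiv_right (by simp)).quotForm (g.contDiffAt_coordForm he hse)
        ((g.isInner_toForm _).coordForm he hy₀t)
        (coordForm_quotient g hf hsub hh he hχ hy₀t hfy₀).1
    refine (ContDiffAt.comp (f := fun z => e (s z)) (χ b) hq hes).congr_of_eventuallyEq ?_
    filter_upwards [χ.open_target.mem_nhds hz₀,
      hsz.continuousAt.preimage_mem_nhds (e.open_source.mem_nhds hse)] with z hz hze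
    have h1 : e.symm (e (s z)) = s z := e.left_inv hze
    have h2 : f (s z) = χ.symm z := (hs z hz).1.symm
    have h3 := (coordForm_quotient g hf hsub hh he hχ (y := e (s z)) (e.map_source hze)
      (by rw [h1, h2]; exact χ.map_target hz)).2
    rw [h1, h2, χ.right_inv hz] at h3
    exact h3
  refine ⟨mkMetric h hin hsm, hf, hsub, fun x v w hv hw => ?_⟩
  change h (f x) (tderiv (Euc n) (Euc k) f x v) (tderiv (Euc n) (Euc k) f x w) = g.toForm x v w
  rw [hh]
  exact quotForm_apply (g.isInner_toForm x) (hsub x) hv hw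

end QuotientMetric

end

noncomputable section

/-! ### Christoffel symbols of a metric at a point -/

section Christoffel

set_option synthInstance.maxHeartbeats 200000

variable {E : Type*} [NormedAddCommGroup E] [NormedSpace ℝ E] [FiniteDimensional ℝ E]

/-- The Christoffel symbols of a metric with value `a` and differential `D` at a point. -/
def christoffel (a : E →L[ℝ] E →L[ℝ] ℝ) (D : E →L[ℝ] E →L[ℝ] E →L[ℝ] ℝ) (v w : E) : E :=
  a.inverse ((2⁻¹ : ℝ) • (D v w + D w v - (D.flip v).flip w))

variable {a : E →L[ℝ] E →L[ℝ] ℝ} {D : E →L[ℝ] E →L[ℝ] E →L[ℝ] ℝ}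

lemma apply_christoffel (ha : IsInner a) (v w z : E) :
    a (christoffel a D v w) z = 2⁻¹ * (D v w z + D w v z - D z v w) := by
  rw [christoffel, ha.apply_inverse]
  rfl

lemma christoffel_symm (ha : IsInner a) (hD : ∀ u v w, D u v w = D u w v) (v w : E) :
    christoffel a D v w = christoffel a D w v := by
  refine ha.ext fun z => ?_
  rw [apply_christoffel ha, apply_christoffel ha, hD z v w]
  ring

lemma christoffel_add_left (ha : IsInner a) (v v' w : E) :
    christoffel a D (v + v') w = christoffel a D v w + christoffel a D v' w := by
  refine ha.ext fun z => ?_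
  rw [map_add a, add_apply, apply_christoffel ha, apply_christoffel ha, apply_christoffel ha]
  simp only [map_add, add_apply]
  ring

lemma christoffel_smul_left (ha : IsInner a) (c : ℝ) (v w : E) :
    christoffel a D (c • v) w = c • christoffel a D v w := by
  refine ha.ext fun z => ?_
  rw [map_smul a, smul_apply, apply_christoffel ha, apply_christoffel ha]
  simp only [map_smul, smul_apply, smul_eq_mul]
  ring

lemma christoffel_add_right (ha : IsInner a) (hD : ∀ u v w, D u v w = D u w v) (v w w' : E) :
    christoffel a D v (w + w') = christoffel a D v w + christoffel a D v w' := by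
  rw [christoffel_symm ha hD, christoffel_add_left ha, christoffel_symm ha hD w,
    christoffel_symm ha hD w']

lemma christoffel_smul_right (ha : IsInner a) (hD : ∀ u v w, D u v w = D u w v) (c : ℝ) (v w : E) :
    christoffel a D v (c • w) = c • christoffel a D v w := by
  rw [christoffel_symm ha hD, christoffel_smul_left ha, christoffel_symm ha hD w]

/-- Metric compatibility of the Christoffel symbols. -/
lemma christoffel_metric (ha : IsInner a) (hD : ∀ u v w, D u v w = D u w v) (v w z : E) :
    a (christoffel a D v w) z + a w (christoffel a D v z) = D v w z := by
  rw [ha.symm w, apply_christoffel ha, apply_christoffel ha, hD z v w, hD w v z, hD v z w]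
  ring

/-- The Christoffel symbols, as a linear map in the first argument. -/
def christoffelL (ha : IsInner a) (D : E →L[ℝ] E →L[ℝ] E →L[ℝ] ℝ) (w : E) : E →L[ℝ] E :=
  LinearMap.toContinuousLinearMap
    { toFun := fun v => christoffel a D v w
      map_add' := fun v v' => christoffel_add_left ha v v' w
      map_smul' := fun c v => christoffel_smul_left ha c v w }

end Christoffel

/-! ### The Levi-Civita connection in the preferred charts -/

section LeviCivita

set_option synthInstance.maxHeartbeats 200000

variable {n : ℕ} {N : Type*} [TopologicalSpace N] [ChartedSpace (Euc n) N] [IsManifold (𝓡 n) ∞ N]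

/-- The expression of the vector field `Y` in the chart `e`. -/
def coordField (e : OpenPartialHomeomorph N (Euc n)) (Y : N → Euc n) (u : Euc n) : Euc n :=
  tderiv (Euc n) (Euc n) e (e.symm u) (Y (e.symm u))

/-- The chart at `x` has identity differential at `x`. Computing at each `x` in its own chart
therefore gives tangent vectors directly, with no change of components. -/
lemma coordField_chartAt_self (Y : N → Euc n) (x : N) :
    coordField (chartAt (Euc n) x) Y (chartAt (Euc n) x x) = Y x := by
  have : IsManifold (𝓡 n) 1 N := IsManifold.of_le (n := ∞) (by simp)
  unfold coordField
  rw [(chartAt (Euc n) x).left_inv (mem_chart_source _ x), tderiv_chartAt_self]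
  rfl

lemma trivializationAt_snd {x₀ x : N} (hx : x ∈ (chartAt (Euc n) x₀).source) (v : Euc n) :
    (trivializationAt (Euc n) (fun x : N => TangentSpace (𝓡 n) x) x₀
      (⟨x, v⟩ : TangentBundle (𝓡 n) N)).2 = tderiv (Euc n) (Euc n) (chartAt (Euc n) x₀) x v := by
  have : IsManifold (𝓡 n) 1 N := IsManifold.of_le (n := ∞) (by simp)
  have h1 : x ∈ (trivializationAt (Euc n) (fun x : N => TangentSpace (𝓡 n) x) x₀).baseSet := hx
  have h2 := TangentBundle.continuousLinearMapAt_trivializationAt (I := 𝓡 n) hx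
  have h3 : (trivializationAt (Euc n) (fun x : N => TangentSpace (𝓡 n) x) x₀
      (⟨x, v⟩ : TangentBundle (𝓡 n) N)).2 = Bundle.Trivialization.continuousLinearMapAt ℝ
      (trivializationAt (Euc n) (fun x : N => TangentSpace (𝓡 n) x) x₀) x v :=
    (congrFun (Bundle.Trivialization.coe_linearMapAt_of_mem (R := ℝ) _ h1) v).symm
  rw [h3, h2]
  simp only [mfld_simps]
  rfl

/-- The trivialization of the tangent bundle at `x` acts by the differential of the chart, so it
turns the field into its chart expression. -/
lemma mdifferentiableAt_field_iff (Y : N → Euc n) (x : N) :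
    MDifferentiableAt (𝓡 n) (𝓡 n).tangent (fun y => (⟨y, Y y⟩ : TangentBundle (𝓡 n) N)) x ↔
      DifferentiableAt ℝ (coordField (chartAt (Euc n) x) Y) (chartAt (Euc n) x x) := by
  set e := chartAt (Euc n) x with he
  have hem : e ∈ IsManifold.maximalAtlas (𝓡 n) ∞ N := chartAt_mem_maximalAtlas x
  have hx : x ∈ e.source := mem_chart_source _ x
  have hs := mdifferentiableAt_section (IB := 𝓡 n) (F := Euc n)
    (E := fun x : N => TangentSpace (𝓡 n) x) Y (b₀ := x)
  refine hs.trans ?_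
  have hev : (fun b => (trivializationAt (Euc n) (fun x : N => TangentSpace (𝓡 n) x) x
      (⟨b, Y b⟩ : TangentBundle (𝓡 n) N)).2) =ᶠ[𝓝 x] fun b => coordField e Y (e b) := by
    filter_upwards [e.open_source.mem_nhds hx] with b hb
    rw [trivializationAt_snd hb, coordField, e.left_inv hb]
  have h1 : MDifferentiableAt (𝓡 n) (𝓡 n) e x :=
    (contMDiffAt_of_mem_maximalAtlas hem hx).mdifferentiableAt (by simp)
  have h2 : MDifferentiableAt (𝓡 n) (𝓡 n) e.symm (e x) :=
    (contMDiffAt_symm_of_mem_maximalAtlas hem (e.map_source hx)).mdifferentiableAt (by simp)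
  rw [← mdifferentiableAt_iff_differentiableAt]
  constructor
  · intro h
    have h3 : MDifferentiableAt (𝓡 n) (𝓡 n) (fun b => coordField e Y (e b)) (e.symm (e x)) := by
      rw [e.left_inv hx]
      exact h.congr_of_eventuallyEq hev.symm
    refine (MDifferentiableAt.comp (g := fun b => coordField e Y (e b)) (f := e.symm) (e x) h3
      h2).congr_of_eventuallyEq ?_
    filter_upwards [e.open_target.mem_nhds (e.map_source hx)] with u hu
    exact congrArg (coordField e Y) (e.right_inv hu).symm
  · intro h
    exact (MDifferentiableAt.comp (g := coordField e Y) (f := e) x h h1).congr_of_eventuallyEq hev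

lemma tderiv_chartAt_symm_self (x : N) :
    tderiv (Euc n) (Euc n) (chartAt (Euc n) x).symm (chartAt (Euc n) x x) =
      ContinuousLinearMap.id ℝ (Euc n) := by
  have : IsManifold (𝓡 n) 1 N := IsManifold.of_le (n := ∞) (by simp)
  ext1 v
  have := tderiv_symm_comp_chart (chartAt_mem_maximalAtlas x) (mem_chart_source (Euc n) x) v
  rwa [tderiv_chartAt_self] at this

/-- The differential at `x`, in the chart at `x`. -/
lemma tderiv_eq_fderiv_comp_chart_symm {F : Type*} [NormedAddCommGroup F] [NormedSpace ℝ F]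
    {φ : N → F} {x : N} (h : MDifferentiableAt (𝓡 n) 𝓘(ℝ, F) φ x) :
    DifferentiableAt ℝ (fun u => φ ((chartAt (Euc n) x).symm u)) (chartAt (Euc n) x x) ∧
    tderiv (Euc n) F φ x =
      fderiv ℝ (fun u => φ ((chartAt (Euc n) x).symm u)) (chartAt (Euc n) x x) := by
  set e := chartAt (Euc n) x with he
  have hem : e ∈ IsManifold.maximalAtlas (𝓡 n) ∞ N := chartAt_mem_maximalAtlas x
  have hx : x ∈ e.source := mem_chart_source _ x
  have h2 : MDifferentiableAt (𝓡 n) (𝓡 n) e.symm (e x) :=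
    (contMDiffAt_symm_of_mem_maximalAtlas hem (e.map_source hx)).mdifferentiableAt (by simp)
  have h3 : MDifferentiableAt (𝓡 n) 𝓘(ℝ, F) φ (e.symm (e x)) := by rwa [e.left_inv hx]
  refine ⟨mdifferentiableAt_iff_differentiableAt.1 (MDifferentiableAt.comp (e x) h3 h2), ?_⟩
  rw [← tderiv_eq_fderiv, tderiv_comp (g := φ) (f := e.symm) h3 h2, tderiv_chartAt_symm_self,
    e.left_inv hx]
  rfl

/-- The manifold bracket is defined by pulling fields back through the inverse chart, and the
pullback is the chart expression. -/
lemma mlieBracket_eq_coord (X Y : N → Euc n) (x : N) :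
    VectorField.mlieBracket (𝓡 n) (M := N) X Y x =
      VectorField.lieBracket ℝ (coordField (chartAt (Euc n) x) X) (coordField (chartAt (Euc n) x) Y)
        (chartAt (Euc n) x x) := by
  have : IsManifold (𝓡 n) 1 N := IsManifold.of_le (n := ∞) (by simp)
  set e := chartAt (Euc n) x with he
  have hem : e ∈ IsManifold.maximalAtlas (𝓡 n) ∞ N := chartAt_mem_maximalAtlas x
  have key : ∀ Z : N → Euc n, VectorField.mpullbackWithin 𝓘(ℝ, Euc n) (𝓡 n)
      (extChartAt (𝓡 n) x).symm Z (range (𝓡 n)) =ᶠ[𝓝 (e x)] coordField e Z := by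
    intro Z
    filter_upwards [e.open_target.mem_nhds (mem_chart_target _ x)] with u hu
    have : (tderiv (Euc n) (Euc n) e.symm u).inverse = tderiv (Euc n) (Euc n) e (e.symm u) := by
      refine ContinuousLinearMap.inverse_eq ?_ ?_
      · ext1 v; exact tderiv_chart_symm_comp hem hu v
      · ext1 v; exact tderiv_chart_comp_symm hem hu v
    have h' : mfderivWithin 𝓘(ℝ, Euc n) (𝓡 n) (extChartAt (𝓡 n) x).symm (range (𝓡 n)) u =
        tderiv (Euc n) (Euc n) e.symm u := by
      simp only [mfld_simps, mfderivWithin_univ]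
      rfl
    refine (VectorField.mpullbackWithin_apply ..).trans ?_
    refine Eq.trans ?_ (congrArg (fun T : Euc n →L[ℝ] Euc n => T (Z (e.symm u))) this)
    exact congrArg (fun T : Euc n →L[ℝ] Euc n => T.inverse (Z (e.symm u))) h'
  refine (VectorField.mlieBracketWithin_apply).trans ?_
  simp only [mfderiv_extChartAt_self]
  have h1 := (key X).lieBracket_vectorField_eq (𝕜 := ℝ) (key Y)
  refine (congrArg (fun T : Euc n →L[ℝ] Euc n => T _) (ContinuousLinearMap.inverse_id
    (R := ℝ) (M := Euc n))).trans (Eq.trans ?_ h1)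
  have h2 : (extChartAt (𝓡 n) x).symm ⁻¹' (univ : Set N) ∩ range (𝓡 n) = univ := by
    simp only [mfld_simps]
  refine Eq.trans (congrArg (fun s : Set (Euc n) => VectorField.lieBracketWithin ℝ _ _ s _) h2) ?_
  exact congrFun (VectorField.lieBracketWithin_univ (𝕜 := ℝ)) _

variable (g : SmoothMetric n N)

/-- The differential at `x` of the metric in the chart at `x`. -/
def metricDeriv (x : N) : Euc n →L[ℝ] Euc n →L[ℝ] Euc n →L[ℝ] ℝ :=
  fderiv ℝ (coordForm (chartAt (Euc n) x) g.toForm) (chartAt (Euc n) x x)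

lemma hasFDerivAt_coordForm (x : N) :
    HasFDerivAt (coordForm (chartAt (Euc n) x) g.toForm) (metricDeriv g x) (chartAt (Euc n) x x) :=
  ((g.contDiffAt_coordForm (chartAt_mem_maximalAtlas x) (mem_chart_source _ x)).differentiableAt
    (by simp)).hasFDerivAt

lemma coordForm_chartAt_self (x : N) :
    coordForm (chartAt (Euc n) x) g.toForm (chartAt (Euc n) x x) = g.toForm x := by
  ext u v
  rw [coordForm_apply, tderiv_chartAt_symm_self,
    (chartAt (Euc n) x).left_inv (mem_chart_source _ x)]
  rfl

lemma metricDeriv_symm (x : N) (u v w : Euc n) : metricDeriv g x u v w = metricDeriv g x u w v := by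
  have h := hasFDerivAt_coordForm g x
  have h1 := (h.clm_apply (hasFDerivAt_const v _)).clm_apply (hasFDerivAt_const w _)
  have h2 := (h.clm_apply (hasFDerivAt_const w _)).clm_apply (hasFDerivAt_const v _)
  have h3 : (fun y => coordForm (chartAt (Euc n) x) g.toForm y v w) =
      fun y => coordForm (chartAt (Euc n) x) g.toForm y w v :=
    funext fun y => (g.isInner_toForm _).symm _ _
  rw [h3] at h1
  have := congrArg (fun f : Euc n →L[ℝ] ℝ => f u) (h1.unique h2)
  simpa using this

/-- The Levi-Civita covariant derivative. -/
def leviCivitaFun (Y : N → Euc n) (x : N) : Euc n →L[ℝ] Euc n :=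
  fderiv ℝ (coordField (chartAt (Euc n) x) Y) (chartAt (Euc n) x x) +
    christoffelL (g.isInner_toForm x) (metricDeriv g x) (Y x)

lemma leviCivitaFun_apply (Y : N → Euc n) (x : N) (v : Euc n) :
    leviCivitaFun g Y x v =
      fderiv ℝ (coordField (chartAt (Euc n) x) Y) (chartAt (Euc n) x x) v +
        christoffel (g.toForm x) (metricDeriv g x) v (Y x) := rfl

lemma leviCivitaFun_add {Y Z : N → Euc n} {x : N}
    (hY : DifferentiableAt ℝ (coordField (chartAt (Euc n) x) Y) (chartAt (Euc n) x x))
    (hZ : DifferentiableAt ℝ (coordField (chartAt (Euc n) x) Z) (chartAt (Euc n) x x)) :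
    leviCivitaFun g (Y + Z) x = leviCivitaFun g Y x + leviCivitaFun g Z x := by
  ext1 v
  have h : coordField (chartAt (Euc n) x) (Y + Z) =
      coordField (chartAt (Euc n) x) Y + coordField (chartAt (Euc n) x) Z :=
    funext fun u => map_add _ _ _
  rw [add_apply, leviCivitaFun_apply, leviCivitaFun_apply, leviCivitaFun_apply, h, fderiv_add hY hZ,
    Pi.add_apply, christoffel_add_right (g.isInner_toForm x) (metricDeriv_symm g x), add_apply]
  abel

lemma leviCivitaFun_smul {Y : N → Euc n} {φ : N → ℝ} {x : N}
    (hY : DifferentiableAt ℝ (coordField (chartAt (Euc n) x) Y) (chartAt (Euc n) x x))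
    (hφ : MDifferentiableAt (𝓡 n) 𝓘(ℝ, ℝ) φ x) (v : Euc n) :
    leviCivitaFun g (fun y => φ y • Y y) x v =
      φ x • leviCivitaFun g Y x v + tderiv (Euc n) ℝ φ x v • Y x := by
  obtain ⟨h1, h2⟩ := tderiv_eq_fderiv_comp_chart_symm hφ
  have h : coordField (chartAt (Euc n) x) (fun y => φ y • Y y) =
      fun u => φ ((chartAt (Euc n) x).symm u) • coordField (chartAt (Euc n) x) Y u :=
    funext fun u => map_smul _ _ _
  rw [leviCivitaFun_apply, leviCivitaFun_apply, h, h2,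
    christoffel_smul_right (g.isInner_toForm x) (metricDeriv_symm g x)]
  have h3 := (h1.hasFDerivAt.smul hY.hasFDerivAt).fderiv
  have h4 := congrArg (fun f : Euc n →L[ℝ] Euc n => f v) h3
  refine (congrArg (· + _) h4).trans ?_
  rw [coordField_chartAt_self, (chartAt (Euc n) x).left_inv (mem_chart_source _ x), smul_add]
  simp only [add_apply, smul_apply, ContinuousLinearMap.smulRight_apply]
  abel

/-- The Levi-Civita connection. -/
def leviCivita : CovariantDerivative (𝓡 n) (Euc n) (fun x : N => TangentSpace (𝓡 n) x) where
  toFun := fun Y x => leviCivitaFun g Y x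
  isCovariantDerivativeOnUniv :=
    { add := fun {σ σ' x} hσ hσ' _ => leviCivitaFun_add g ((mdifferentiableAt_field_iff σ x).1 hσ)
        ((mdifferentiableAt_field_iff σ' x).1 hσ')
      leibniz := fun {σ φ x} hσ hφ _ => by
        refine ContinuousLinearMap.ext fun v => ?_
        exact leviCivitaFun_smul g ((mdifferentiableAt_field_iff σ x).1 hσ) hφ v }

/-- The Christoffel terms cancel by symmetry; the derivatives left over form the bracket. -/
lemma leviCivitaFun_torsion (X Y : N → Euc n) (x : N) :
    leviCivitaFun g Y x (X x) - leviCivitaFun g X x (Y x) =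
      VectorField.lieBracket ℝ (coordField (chartAt (Euc n) x) X) (coordField (chartAt (Euc n) x) Y)
        (chartAt (Euc n) x x) := by
  rw [leviCivitaFun_apply, leviCivitaFun_apply,
    christoffel_symm (g.isInner_toForm x) (metricDeriv_symm g x) (Y x) (X x),
    VectorField.lieBracket, coordField_chartAt_self, coordField_chartAt_self]
  abel

/-- The product rule for `g(Y, Z)` in the chart at `x` gives the derivative of the metric plus two
derivatives of fields; `christoffel_metric` splits the former between the two sides. -/
lemma leviCivitaFun_metric {Y Z : N → Euc n} {x : N}
    (hY : DifferentiableAt ℝ (coordField (chartAt (Euc n) x) Y) (chartAt (Euc n) x x))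
    (hZ : DifferentiableAt ℝ (coordField (chartAt (Euc n) x) Z) (chartAt (Euc n) x x)) (v : Euc n) :
    tderiv (Euc n) ℝ (fun y => g.toForm y (Y y) (Z y)) x v =
      g.toForm x (leviCivitaFun g Y x v) (Z x) + g.toForm x (Y x) (leviCivitaFun g Z x v) := by
  set e := chartAt (Euc n) x with he
  have hem : e ∈ IsManifold.maximalAtlas (𝓡 n) ∞ N := chartAt_mem_maximalAtlas x
  have hx : x ∈ e.source := mem_chart_source _ x
  have hd := (((hasFDerivAt_coordForm g x).clm_apply hY.hasFDerivAt).clm_apply hZ.hasFDerivAt)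
  have heq : (fun y => g.toForm y (Y y) (Z y)) =ᶠ[𝓝 x]
      fun y => coordForm e g.toForm (e y) (coordField e Y (e y)) (coordField e Z (e y)) := by
    filter_upwards [e.open_source.mem_nhds hx] with y hy
    unfold coordField
    rw [coordForm_apply, e.left_inv hy, tderiv_symm_comp_chart hem hy,
      tderiv_symm_comp_chart hem hy]
  have h1 : MDifferentiableAt (𝓡 n) (𝓡 n) e x :=
    (contMDiffAt_of_mem_maximalAtlas hem hx).mdifferentiableAt (by simp)
  have : IsManifold (𝓡 n) 1 N := IsManifold.of_le (n := ∞) (by simp)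
  have h2 := tderiv_comp_apply (g := fun u => coordForm e g.toForm u (coordField e Y u)
    (coordField e Z u)) (f := e) (a := x) hd.differentiableAt.mdifferentiableAt h1 v
  rw [tderiv_eq_fderiv, hd.fderiv, he, tderiv_chartAt_self, ← he] at h2
  rw [tderiv_congr heq, h2, leviCivitaFun_apply, leviCivitaFun_apply]
  have h3 := christoffel_metric (g.isInner_toForm x) (metricDeriv_symm g x) v (Y x) (Z x)
  have h4 : coordForm e g.toForm (e x) = g.toForm x := coordForm_chartAt_self g x
  have h5 : coordField e Y (e x) = Y x := coordField_chartAt_self Y x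
  have h6 : coordField e Z (e x) = Z x := coordField_chartAt_self Z x
  simp only [add_apply, ContinuousLinearMap.comp_apply, ContinuousLinearMap.flip_apply,
    ContinuousLinearMap.id_apply, map_add, h4, h5, h6, ← he]
  rw [← h3]
  ring

theorem isLeviCivita_leviCivita : IsLeviCivita g (leviCivita g) where
  torsion_eq_zero := by
    rw [CovariantDerivative.torsion_eq_zero_iff]
    intro X Y x _ _
    exact (leviCivitaFun_torsion g X Y x).trans (mlieBracket_eq_coord X Y x).symm
  metric x Y Z hY hZ v := leviCivitaFun_metric g ((mdifferentiableAt_field_iff Y x).1 hY)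
    ((mdifferentiableAt_field_iff Z x).1 hZ) v

end LeviCivita

end

noncomputable section

/-! ### Killing fields in coordinates -/

section KillingCalculus

set_option synthInstance.maxHeartbeats 200000

variable {D E F : Type*} [NormedAddCommGroup D] [NormedSpace ℝ D] [NormedAddCommGroup E]
  [NormedSpace ℝ E] [NormedAddCommGroup F] [NormedSpace ℝ F]

/-- Differentiating `DΦ (Y) = 0` along a curve. -/
lemma fderiv_apply_fderiv_of_curve {Φ : E → F} {Y : E → E} {γ : ℝ → E} {u v : E}
    (hΦ : ContDiffAt ℝ ∞ Φ u) (hY : DifferentiableAt ℝ Y u) (hγ : HasDerivAt γ v 0) (hγ0 : γ 0 = u)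
    (h0 : ∀ᶠ t in 𝓝 (0 : ℝ), fderiv ℝ Φ (γ t) (Y (γ t)) = 0) :
    fderiv ℝ Φ u (fderiv ℝ Y u v) = -fderiv ℝ (fderiv ℝ Φ) u v (Y u) := by
  subst hγ0
  have h1 : HasFDerivAt (fderiv ℝ Φ) (fderiv ℝ (fderiv ℝ Φ) (γ 0)) (γ 0) :=
    ((hΦ.fderiv_right (m := ∞) (by simp)).differentiableAt (by simp)).hasFDerivAt
  have h2 := h1.comp_hasDerivAt (0 : ℝ) hγ
  have h3 := hY.hasFDerivAt.comp_hasDerivAt (0 : ℝ) hγ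
  have h4 := h2.clm_apply h3
  have h5 : HasDerivAt (fun t => fderiv ℝ Φ (γ t) (Y (γ t))) 0 0 :=
    (hasDerivAt_const (0 : ℝ) (0 : F)).congr_of_eventuallyEq h0
  have h6 := h4.unique h5
  rw [eq_neg_iff_add_eq_zero, add_comm]
  exact h6

lemma HasFDerivAt.hasDerivAt_fst {Φ : D × E → F} {Φ' : D × E →L[ℝ] F} {c : D} {u : E}
    (h : HasFDerivAt Φ Φ' (c, u)) (V : D) :
    HasDerivAt (fun t : ℝ => Φ (c + t • V, u)) (Φ' (V, 0)) 0 := by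
  have hγ : HasDerivAt (fun t : ℝ => ((c + t • V, u) : D × E)) (V, 0) 0 := by
    refine HasDerivAt.prodMk ?_ (hasDerivAt_const _ _)
    simpa using ((hasDerivAt_id (0 : ℝ)).smul_const V).const_add c
  have hγ0 : ((c + (0 : ℝ) • V, u) : D × E) = (c, u) := by simp
  rw [← hγ0] at h
  exact h.comp_hasDerivAt (0 : ℝ) hγ

lemma HasFDerivAt.comp_hasDerivAt_curve {g : E → F} {g' : E →L[ℝ] F} {γ : ℝ → E} {u v : E} {t : ℝ}
    (hg : HasFDerivAt g g' u) (hγ : HasDerivAt γ v t) (h : γ t = u) :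
    HasDerivAt (fun t => g (γ t)) (g' v) t := by
  subst h
  exact hg.comp_hasDerivAt t hγ

lemma HasDerivAt.clm_apply_const {A : ℝ → D →L[ℝ] E} {A' : D →L[ℝ] E} {t : ℝ}
    (h : HasDerivAt A A' t) (v : D) : HasDerivAt (fun t => A t v) (A' v) t :=
  (ContinuousLinearMap.apply ℝ E v).hasFDerivAt.comp_hasDerivAt t h

/-- The time derivative of the differential of a flow is the differential of its velocity. -/
lemma hasDerivAt_fderiv_flow {L : D × E → E} {c V : D} {u : E} {X : E → E}
    (hL : ContDiffAt ℝ ∞ L (c, u)) (hX : X =ᶠ[𝓝 u] fun w => fderiv ℝ L (c, w) (V, 0)) (w : E) :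
    HasDerivAt (fun t : ℝ => fderiv ℝ L (c + t • V, u) (0, w)) (fderiv ℝ X u w) 0 := by
  have hLdd : HasFDerivAt (fderiv ℝ L) (fderiv ℝ (fderiv ℝ L) (c, u)) (c, u) :=
    ((hL.fderiv_right (m := ∞) (by simp)).differentiableAt (by simp)).hasFDerivAt
  have hsymm : IsSymmSndFDerivAt ℝ L (c, u) := hL.isSymmSndFDerivAt (by
    rw [minSmoothness_of_isRCLikeNormedField]; norm_cast)
  have h1 := (ContinuousLinearMap.apply ℝ E ((V, 0) : D × E)).hasFDerivAt.comp u
    (hLdd.comp u (hasFDerivAt_prodMk_right c u))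
  have h2 : fderiv ℝ X u w = fderiv ℝ (fderiv ℝ L) (c, u) (0, w) (V, 0) := by
    rw [hX.fderiv_eq]
    exact congrArg (fun T : E →L[ℝ] E => T w) h1.fderiv
  -- Symmetry of the second derivative exchanges the time derivative with the space derivative.
  rw [h2, hsymm]
  exact (hLdd.hasDerivAt_fst V).clm_apply_const (0, w)

lemma fderiv_snd_of_eventually_eq {L : D × E → E} {c : D} {u : E}
    (hL : DifferentiableAt ℝ L (c, u)) (hLc : ∀ᶠ w in 𝓝 u, L (c, w) = w) (w : E) :
    fderiv ℝ L (c, u) (0, w) = w := by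
  have h1 := hL.hasFDerivAt.comp u (hasFDerivAt_prodMk_right c u)
  have h2 : HasFDerivAt (L ∘ fun w => (c, w)) (ContinuousLinearMap.id ℝ E) u :=
    (hasFDerivAt_id u).congr_of_eventuallyEq hLc
  exact congrArg (fun T : E →L[ℝ] E => T w) (h1.unique h2)

lemma hasDerivAt_bilin {g : ℝ → E →L[ℝ] E →L[ℝ] ℝ} {g' : E →L[ℝ] E →L[ℝ] ℝ} {A B : ℝ → E}
    {A' B' : E} {t : ℝ} (hg : HasDerivAt g g' t) (hA : HasDerivAt A A' t) (hB : HasDerivAt B B' t) :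
    HasDerivAt (fun t => g t (A t) (B t)) (g' (A t) (B t) + g t A' (B t) + g t (A t) B') t :=
  (hg.clm_apply hA).clm_apply hB

/-- The Killing equation for the velocity field `∂_V L` of a family of isometries `L (q, ·)`. -/
lemma killing_equation {L : D × E → E} {c V : D} {u : E} {g : E → E →L[ℝ] E →L[ℝ] ℝ}
    {g' : E →L[ℝ] E →L[ℝ] E →L[ℝ] ℝ} {X : E → E}
    (hL : ContDiffAt ℝ ∞ L (c, u)) (hLc : ∀ᶠ w in 𝓝 u, L (c, w) = w)
    (hX : X =ᶠ[𝓝 u] fun w => fderiv ℝ L (c, w) (V, 0)) (hg : HasFDerivAt g g' u)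
    (hinv : ∀ᶠ q in 𝓝 c, ∀ a b, g (L (q, u)) (fderiv ℝ L (q, u) (0, a)) (fderiv ℝ L (q, u) (0, b)) =
      g u a b) (a b : E) :
    g' (X u) a b + g u (fderiv ℝ X u a) b + g u a (fderiv ℝ X u b) = 0 := by
  have hLd : DifferentiableAt ℝ L (c, u) := hL.differentiableAt (by simp)
  have hLu : L (c, u) = u := hLc.self_of_nhds
  have hid := fderiv_snd_of_eventually_eq hLd hLc
  have hγ0 : ((c + (0 : ℝ) • V, u) : D × E) = (c, u) := by simp
  have hB : HasDerivAt (fun t : ℝ => L (c + t • V, u)) (X u) 0 := by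
    rw [hX.self_of_nhds]
    exact hLd.hasFDerivAt.hasDerivAt_fst V
  have hgB : HasDerivAt (fun t : ℝ => g (L (c + t • V, u))) (g' (X u)) 0 := by
    exact HasFDerivAt.comp_hasDerivAt_curve (F := E →L[ℝ] E →L[ℝ] ℝ) (g := g) (g' := g') hg hB
      (by rw [hγ0, hLu])
  -- The invariance identity is differentiated at `t = 0` along the line `c + t V` of group
  -- parameters.
  have hall := hasDerivAt_bilin hgB (hasDerivAt_fderiv_flow hL hX a)
    (hasDerivAt_fderiv_flow hL hX b)
  have hconst : HasDerivAt (fun t : ℝ => g (L (c + t • V, u)) (fderiv ℝ L (c + t • V, u) (0, a))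
      (fderiv ℝ L (c + t • V, u) (0, b))) 0 0 := by
    have hc : Tendsto (fun t : ℝ => c + t • V) (𝓝 0) (𝓝 c) := by
      have : Continuous (fun t : ℝ => c + t • V) := by fun_prop
      simpa using this.tendsto 0
    refine (hasDerivAt_const (0 : ℝ) (g u a b)).congr_of_eventuallyEq ?_
    filter_upwards [hc.eventually hinv] with t ht using ht a b
  have h := hall.unique hconst
  rwa [hγ0, hLu, hid, hid] at h

/-- A Killing field whose length has a critical point at `u` satisfies `∇_X X = 0` there. -/
lemma fderiv_add_christoffel_of_killing [FiniteDimensional ℝ E] {g : E → E →L[ℝ] E →L[ℝ] ℝ}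
    {g' : E →L[ℝ] E →L[ℝ] E →L[ℝ] ℝ} {X : E → E} {u : E} (hi : IsInner (g u))
    (hg : HasFDerivAt g g' u) (hX : DifferentiableAt ℝ X u)
    (hkill : ∀ a b, g' (X u) a b + g u (fderiv ℝ X u a) b + g u a (fderiv ℝ X u b) = 0)
    (hmax : IsLocalMax (fun w => g w (X w) (X w)) u) :
    fderiv ℝ X u (X u) + christoffel (g u) g' (X u) (X u) = 0 := by
  have h1 := (hg.clm_apply hX.hasFDerivAt).clm_apply hX.hasFDerivAt
  have h2 := hmax.hasFDerivAt_eq_zero h1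
  -- Pair with `z`: the Killing equation in the directions `X u` and `z`, minus half the criticality
  -- of `g(X, X)` in the direction `z`, is the assertion.
  refine hi.ext fun z => ?_
  rw [map_add (g u), map_zero, zero_apply, add_apply, apply_christoffel hi]
  have h3 := hkill (X u) z
  have h4 := congrArg (fun T : E →L[ℝ] ℝ => T z) h2
  simp only [add_apply, ContinuousLinearMap.comp_apply, ContinuousLinearMap.flip_apply,
    zero_apply] at h4
  have h5 := hi.symm (X u) (fderiv ℝ X u z)
  linarith

end KillingCalculus

end

noncomputable section

/-! ### Normal homogeneous orbits are totally geodesic -/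

section TotallyGeodesic

set_option synthInstance.maxHeartbeats 200000

variable {d n k : ℕ} {G : Type*} [TopologicalSpace G] [ChartedSpace (Euc d) G] [Group G]
  [LieGroup (𝓡 d) ∞ G]
  {N : Type*} [TopologicalSpace N] [ChartedSpace (Euc n) N] [IsManifold (𝓡 n) ∞ N]
  [MulAction G N] [ContMDiffSMul (𝓡 d) (𝓡 n) ∞ G N]
  {B : Type*} [TopologicalSpace B] [ChartedSpace (Euc k) B] [IsManifold (𝓡 k) ∞ B]

section Coordinates

variable {f : N → B}

/-- The expression of `f` in the charts at `x` and `f x`. -/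
def coordMap (k : ℕ) {B : Type*} [TopologicalSpace B] [ChartedSpace (Euc k) B]
    (f : N → B) (x : N) (u : Euc n) : Euc k :=
  chartAt (Euc k) (f x) (f ((chartAt (Euc n) x).symm u))

lemma eventually_coordMap (hf : ContMDiff (𝓡 n) (𝓡 k) ∞ f) (x : N) :
    ∀ᶠ u in 𝓝 (chartAt (Euc n) x x), ContDiffAt ℝ ∞ (coordMap k f x) u ∧
      fderiv ℝ (coordMap k f x) u = tderiv (Euc k) (Euc k) (chartAt (Euc k) (f x))
        (f ((chartAt (Euc n) x).symm u)) ∘L tderiv (Euc n) (Euc k) f ((chartAt (Euc n) x).symm u) ∘L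
        tderiv (Euc n) (Euc n) (chartAt (Euc n) x).symm u := by
  set e := chartAt (Euc n) x with he
  set χ := chartAt (Euc k) (f x) with hχ
  have hem : e ∈ IsManifold.maximalAtlas (𝓡 n) ∞ N := chartAt_mem_maximalAtlas x
  have hχm : χ ∈ IsManifold.maximalAtlas (𝓡 k) ∞ B := chartAt_mem_maximalAtlas (f x)
  have hx : x ∈ e.source := mem_chart_source _ x
  have hc : ContinuousAt (fun u => f (e.symm u)) (e x) := by
    refine ContinuousAt.comp (g := f) hf.continuous.continuousAt ?_
    exact e.continuousAt_symm (e.map_source hx)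
  have hs : ∀ᶠ u in 𝓝 (e x), f (e.symm u) ∈ χ.source :=
    hc.eventually (χ.open_source.mem_nhds (by
      beta_reduce; rw [e.left_inv hx]; exact mem_chart_source _ _))
  filter_upwards [hs, e.open_target.mem_nhds (e.map_source hx)] with u hu hu'
  have h1 : ContMDiffAt (𝓡 n) (𝓡 n) ∞ e.symm u := contMDiffAt_symm_of_mem_maximalAtlas hem hu'
  have h2 : ContMDiffAt (𝓡 k) (𝓡 k) ∞ χ (f (e.symm u)) := contMDiffAt_of_mem_maximalAtlas hχm hu
  have h3 : ContMDiffAt (𝓡 n) (𝓡 k) ∞ (fun u => f (e.symm u)) u :=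
    ContMDiffAt.comp (g := f) (f := e.symm) u hf.contMDiffAt h1
  refine ⟨contMDiffAt_iff_contDiffAt.1 (ContMDiffAt.comp (g := χ) (f := fun u => f (e.symm u)) u
    h2 h3), ?_⟩
  rw [← tderiv_eq_fderiv, ← tderiv_comp (g := f) (f := e.symm) (hf.mdifferentiableAt (by simp))
    (h1.mdifferentiableAt (by simp)), ← tderiv_comp (g := χ) (f := fun u => f (e.symm u))
    (h2.mdifferentiableAt (by simp)) (h3.mdifferentiableAt (by simp))]
  rfl

lemma fderiv_coordMap_chartAt_self (hf : ContMDiff (𝓡 n) (𝓡 k) ∞ f) (x : N) :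
    fderiv ℝ (coordMap k f x) (chartAt (Euc n) x x) = tderiv (Euc n) (Euc k) f x := by
  have : IsManifold (𝓡 n) 1 N := IsManifold.of_le (n := ∞) (by simp)
  have : IsManifold (𝓡 k) 1 B := IsManifold.of_le (n := ∞) (by simp)
  rw [(eventually_coordMap hf x).self_of_nhds.2, tderiv_chartAt_symm_self,
    (chartAt (Euc n) x).left_inv (mem_chart_source _ x), tderiv_chartAt_self]
  rfl

lemma eventually_fderiv_coordMap_coordField (hf : ContMDiff (𝓡 n) (𝓡 k) ∞ f) (x : N) :
    ∀ᶠ u in 𝓝 (chartAt (Euc n) x x), ∀ Y : N → Euc n,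
      tderiv (Euc n) (Euc k) f ((chartAt (Euc n) x).symm u) (Y ((chartAt (Euc n) x).symm u)) = 0 →
      fderiv ℝ (coordMap k f x) u (coordField (chartAt (Euc n) x) Y u) = 0 := by
  filter_upwards [eventually_coordMap hf x,
    (chartAt (Euc n) x).open_target.mem_nhds (mem_chart_target _ x)] with u hu hu' Y hY
  rw [hu.2, ContinuousLinearMap.comp_apply, ContinuousLinearMap.comp_apply, coordField,
    tderiv_chart_symm_comp (chartAt_mem_maximalAtlas x) hu', hY, map_zero]

end Coordinates

section Invariance

variable {g : SmoothMetric n N}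

lemma eventually_chart_symm_smul_mem (x : N) :
    ∀ᶠ q in 𝓝 (chartAt (Euc d) (1 : G) 1), (chartAt (Euc d) (1 : G)).symm q • x ∈
      (chartAt (Euc n) x).source := by
  have hc : ContinuousAt (fun q => (chartAt (Euc d) (1 : G)).symm q • x)
      (chartAt (Euc d) (1 : G) 1) := by
    refine ContinuousAt.comp (g := fun a : G => a • x)
      (contMDiff_orbitMap (d := d) (n := n) x).continuous.continuousAt ?_
    exact (chartAt (Euc d) (1 : G)).continuousAt_symm (mem_chart_target _ _)
  refine hc.eventually ((chartAt (Euc n) x).open_source.mem_nhds ?_)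
  change _ • x ∈ _
  rw [chartAt_one_symm_smul]
  exact mem_chart_source _ _

/-- An invariant metric is invariant in coordinates. -/
lemma eventually_coordForm_localAct
    (hg : ∀ (a : G) (x : N) (u v : Euc n),
      g.toForm (a • x) (transDeriv n a x u) (transDeriv n a x v) = g.toForm x u v) (x : N) :
    ∀ᶠ q in 𝓝 (chartAt (Euc d) (1 : G) 1), ∀ a b : Euc n,
      coordForm (chartAt (Euc n) x) g.toForm
        (localAct d G (chartAt (Euc n) x) (q, chartAt (Euc n) x x))
        (fderiv ℝ (localAct d G (chartAt (Euc n) x)) (q, chartAt (Euc n) x x) (0, a))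
        (fderiv ℝ (localAct d G (chartAt (Euc n) x)) (q, chartAt (Euc n) x x) (0, b)) =
      coordForm (chartAt (Euc n) x) g.toForm (chartAt (Euc n) x x) a b := by
  filter_upwards [eventually_chart_symm_smul_mem (d := d) (n := n) (G := G) x,
    (chartAt (Euc d) (1 : G)).open_target.mem_nhds (mem_chart_target _ _)] with q hq hq'
  set c := chartAt (Euc d) (1 : G) with hc
  set e := chartAt (Euc n) x with he
  have hem : e ∈ IsManifold.maximalAtlas (𝓡 n) ∞ N := chartAt_mem_maximalAtlas x
  have hx : x ∈ e.source := mem_chart_source _ x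
  have hL : e.symm (localAct d G e (q, e x)) = c.symm q • x := by
    unfold localAct
    rw [e.left_inv hx, e.left_inv hq]
  have hD : ∀ w, tderiv (Euc n) (Euc n) e.symm (localAct d G e (q, e x))
      (fderiv ℝ (localAct d G e) (q, e x) (0, w)) = transDeriv n (c.symm q) x w := by
    intro w
    have h0 := (contDiffAt_localAct_of_mem d G hem (p := (q, e x)) hq' (e.map_source hx)
      (by rw [e.left_inv hx]; exact hq)).differentiableAt (by simp)
    have h1 := h0.hasFDerivAt.comp (e x) (hasFDerivAt_prodMk_right q (e x))
    have h2 : fderiv ℝ (localAct d G e) (q, e x) (0, w) =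
        tderiv (Euc n) (Euc n) (fun u => e (c.symm q • e.symm u)) (e x) w := by
      rw [tderiv_eq_fderiv]
      exact (congrArg (fun T : Euc n →L[ℝ] Euc n => T w) h1.fderiv).symm
    have h3 : MDifferentiableAt (𝓡 n) (𝓡 n) e.symm (e x) :=
      (contMDiffAt_symm_of_mem_maximalAtlas hem (e.map_source hx)).mdifferentiableAt (by simp)
    have h4 : MDifferentiableAt (𝓡 n) (𝓡 n) (fun y : N => c.symm q • y) (e.symm (e x)) :=
      mdifferentiableAt_translate d G _ _
    have h5 : MDifferentiableAt (𝓡 n) (𝓡 n) e (c.symm q • e.symm (e x)) := by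
      rw [e.left_inv hx]
      exact (contMDiffAt_of_mem_maximalAtlas hem hq).mdifferentiableAt (by simp)
    have h6 : MDifferentiableAt (𝓡 n) (𝓡 n) (fun u => c.symm q • e.symm u) (e x) :=
      MDifferentiableAt.comp (g := fun y : N => c.symm q • y) (f := e.symm) (e x) h4 h3
    have h7 : localAct d G e (q, e x) = e (c.symm q • x) := by
      unfold localAct
      rw [e.left_inv hx]
    rw [h2, h7, tderiv_comp_apply (g := e) (f := fun u => c.symm q • e.symm u) h5 h6,
      tderiv_comp_apply (g := fun y : N => c.symm q • y) (f := e.symm) h4 h3,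
      tderiv_chartAt_symm_self, e.left_inv hx, tderiv_symm_comp_chart hem hq]
    rfl
  intro a b
  rw [coordForm_apply, hD, hD, hL, hg, coordForm_chartAt_self]

/-- The integral curves of the action fields, in coordinates. -/
lemma hasDerivAt_localAct (x : N) (V : Euc d) :
    HasDerivAt (fun t : ℝ => localAct d G (chartAt (Euc n) x)
      (chartAt (Euc d) (1 : G) 1 + t • V, chartAt (Euc n) x x)) (actDeriv d n G x V) 0 := by
  have hem : chartAt (Euc n) x ∈ IsManifold.maximalAtlas (𝓡 n) ∞ N := chartAt_mem_maximalAtlas x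
  have h := ((contDiffAt_localAct d G hem (mem_chart_target _ x)).differentiableAt
    (by simp)).hasFDerivAt.hasDerivAt_fst V
  have h1 := coordAct_eq_fderiv d G hem (mem_chart_target _ x)
  have h2 : fderiv ℝ (localAct d G (chartAt (Euc n) x))
      (chartAt (Euc d) (1 : G) 1, chartAt (Euc n) x x) (V, 0) = actDeriv d n G x V := by
    have h3 := congrArg (fun T : Euc d →L[ℝ] Euc n => T V) h1
    refine h3.symm.trans ?_
    exact coordField_chartAt_self (fun y => actDeriv d n G y V) x
  rwa [h2] at h

/-- An action field whose length is maximal at `x` satisfies `∇_X X = 0` there. -/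
lemma leviCivitaFun_actDeriv
    (hg : ∀ (a : G) (x : N) (u v : Euc n),
      g.toForm (a • x) (transDeriv n a x u) (transDeriv n a x v) = g.toForm x u v)
    {x : N} {V : Euc d}
    (hmax : ∀ y : N, g.toForm y (actDeriv d n G y V) (actDeriv d n G y V) ≤
      g.toForm x (actDeriv d n G x V) (actDeriv d n G x V)) :
    leviCivitaFun g (fun y => actDeriv d n G y V) x (actDeriv d n G x V) = 0 := by
  set e := chartAt (Euc n) x with he
  have hem : e ∈ IsManifold.maximalAtlas (𝓡 n) ∞ N := chartAt_mem_maximalAtlas x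
  have hx : x ∈ e.source := mem_chart_source _ x
  have hxt : e x ∈ e.target := e.map_source hx
  set X := coordField e (fun y => actDeriv d n G y V) with hX
  have hXx : X (e x) = actDeriv d n G x V := coordField_chartAt_self _ x
  have hgx : coordForm e g.toForm (e x) = g.toForm x := coordForm_chartAt_self g x
  have hXd : DifferentiableAt ℝ X (e x) :=
    ((contDiffAt_coordAct d G hem hxt).clm_apply contDiffAt_const).differentiableAt (by simp)
  have hkill := killing_equation (V := V) (X := X) (contDiffAt_localAct d G hem hxt)
    (by
      filter_upwards [e.open_target.mem_nhds hxt] with w hw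
      unfold localAct
      rw [chartAt_one_symm_smul, e.right_inv hw])
    (by
      filter_upwards [e.open_target.mem_nhds hxt] with w hw
      exact congrArg (fun T : Euc d →L[ℝ] Euc n => T V) (coordAct_eq_fderiv d G hem hw))
    (hasFDerivAt_coordForm g x) (eventually_coordForm_localAct hg x)
  have hval : ∀ w ∈ e.target, coordForm e g.toForm w (X w) (X w) = g.toForm (e.symm w)
      (actDeriv d n G (e.symm w) V) (actDeriv d n G (e.symm w) V) := by
    intro w hw
    have h1 : tderiv (Euc n) (Euc n) e.symm w (X w) = actDeriv d n G (e.symm w) V :=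
      tderiv_chart_symm_comp hem hw _
    rw [coordForm_apply, h1]
  have hloc : IsLocalMax (fun w => coordForm e g.toForm w (X w) (X w)) (e x) := by
    filter_upwards [e.open_target.mem_nhds hxt] with w hw
    rw [hval w hw, hval _ hxt, e.left_inv hx]
    exact hmax _
  have h := fderiv_add_christoffel_of_killing (by rw [hgx]; exact g.isInner_toForm x)
    (hasFDerivAt_coordForm g x) hXd hkill hloc
  rw [hXx, hgx] at h
  exact h

end Invariance

section SecondFundamentalForm

variable {g : SmoothMetric n N} {f : N → B}

/-- The second fundamental form of the fibers, as a bilinear form. -/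
def fiberForm (k : ℕ) {B : Type*} [TopologicalSpace B] [ChartedSpace (Euc k) B]
    (g : SmoothMetric n N) (f : N → B) (x : N) (v w : Euc n) : Euc k :=
  tderiv (Euc n) (Euc k) f x (christoffel (g.toForm x) (metricDeriv g x) v w) -
    fderiv ℝ (fderiv ℝ (coordMap k f x)) (chartAt (Euc n) x x) v w

/-- Both the Christoffel symbols and the second derivative of `f` in charts are symmetric; this is
what permits polarization. -/
lemma fiberForm_symm (hf : ContMDiff (𝓡 n) (𝓡 k) ∞ f) (x : N) (v w : Euc n) :
    fiberForm k g f x v w = fiberForm k g f x w v := by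
  have hs : IsSymmSndFDerivAt ℝ (coordMap k f x) (chartAt (Euc n) x x) :=
    (eventually_coordMap hf x).self_of_nhds.1.isSymmSndFDerivAt (by
      rw [minSmoothness_of_isRCLikeNormedField]; norm_cast)
  unfold fiberForm
  rw [christoffel_symm (g.isInner_toForm x) (metricDeriv_symm g x), hs]

lemma fiberForm_add_left (x : N) (v v' w : Euc n) :
    fiberForm k g f x (v + v') w = fiberForm k g f x v w + fiberForm k g f x v' w := by
  unfold fiberForm
  rw [christoffel_add_left (g.isInner_toForm x), map_add, map_add, add_apply]
  abel

/-- A field tangent to the fiber through `x`, differentiated along the fiber. -/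
lemma tderiv_leviCivitaFun (hf : ContMDiff (𝓡 n) (𝓡 k) ∞ f)
    (hinv : ∀ (a : G) (x : N), f (a • x) = f x) {x : N} {Y : N → Euc n}
    (hY : DifferentiableAt ℝ (coordField (chartAt (Euc n) x) Y) (chartAt (Euc n) x x))
    (hY0 : ∀ y, f y = f x → tderiv (Euc n) (Euc k) f y (Y y) = 0) (V : Euc d) :
    tderiv (Euc n) (Euc k) f x (leviCivitaFun g Y x (actDeriv d n G x V)) =
      fiberForm k g f x (actDeriv d n G x V) (Y x) := by
  have hx : x ∈ (chartAt (Euc n) x).source := mem_chart_source _ x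
  have hγ := hasDerivAt_localAct (n := n) (G := G) x V
  have hγ0 : localAct d G (chartAt (Euc n) x)
      (chartAt (Euc d) (1 : G) 1 + (0 : ℝ) • V, chartAt (Euc n) x x) = chartAt (Euc n) x x := by
    unfold localAct
    rw [zero_smul, add_zero, chartAt_one_symm_smul, (chartAt (Euc n) x).left_inv hx]
  have hc : Tendsto (fun t : ℝ => chartAt (Euc d) (1 : G) 1 + t • V) (𝓝 0)
      (𝓝 (chartAt (Euc d) (1 : G) 1)) := by
    have : Continuous (fun t : ℝ => chartAt (Euc d) (1 : G) 1 + t • V) := by fun_prop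
    simpa using this.tendsto 0
  have hct := hγ.continuousAt.tendsto
  rw [hγ0] at hct
  -- The curve `t ↦ localAct (c + t V, ·)`, with `c` the chart image of `1`, stays in the fiber
  -- through `x`, where `Y` is assumed tangent.
  have h := fderiv_apply_fderiv_of_curve (eventually_coordMap hf x).self_of_nhds.1 hY hγ hγ0 (by
    filter_upwards [hct.eventually (eventually_fderiv_coordMap_coordField hf x),
      hc.eventually (eventually_chart_symm_smul_mem (n := n) x)] with t ht hs
    refine ht Y (hY0 _ ?_)
    unfold localAct
    rw [(chartAt (Euc n) x).left_inv hx, (chartAt (Euc n) x).left_inv hs, hinv])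
  rw [fderiv_coordMap_chartAt_self hf, coordField_chartAt_self] at h
  rw [leviCivitaFun_apply, map_add, h, fiberForm]
  abel

end SecondFundamentalForm

/-- Let `G` act by isometries so that the fibers of `f` are infinitesimally the orbits. If the
orbits are normal homogeneous, then they are totally geodesic. -/
theorem hasTotallyGeodesicFibers {g : SmoothMetric n N} {f : N → B} {b : Euc d →L[ℝ] Euc d →L[ℝ] ℝ}
    (hb : IsInner b) (hf : ContMDiff (𝓡 n) (𝓡 k) ∞ f) (hinv : ∀ (a : G) (x : N), f (a • x) = f x)
    (hker : ∀ (x : N) (v : Euc n), tderiv (Euc n) (Euc k) f x v = 0 ↔ ∃ V, actDeriv d n G x V = v)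
    (hg : ∀ (a : G) (x : N) (u v : Euc n),
      g.toForm (a • x) (transDeriv n a x u) (transDeriv n a x v) = g.toForm x u v)
    (hle : ∀ (x : N) (V : Euc d), g.toForm x (actDeriv d n G x V) (actDeriv d n G x V) ≤ b V V)
    (heq : ∀ (x : N) (V : Euc d), OrthKer (actDeriv d n G x) b V →
      g.toForm x (actDeriv d n G x V) (actDeriv d n G x V) = b V V) :
    HasTotallyGeodesicFibers (k := k) g f := by
  have hdiag : ∀ (x : N) (v : Euc n), tderiv (Euc n) (Euc k) f x v = 0 →
      fiberForm k g f x v v = 0 := by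
    intro x v hv
    obtain ⟨W, hW⟩ := (hker x v).1 hv
    set A := actDeriv d n G x with hA
    -- The vector `v` is lifted to the Lie algebra orthogonally to the kernel; `A` is restricted to
    -- its range so that it is onto.
    obtain ⟨V, hV, hVW⟩ := exists_orthKer (L := A.codRestrict A.range fun w => ⟨w, rfl⟩) hb
      (fun ⟨_, w, hw⟩ => ⟨w, Subtype.ext hw⟩) ⟨v, W, hW⟩
    have hVv : actDeriv d n G x V = v := congrArg Subtype.val hVW
    have hV' : OrthKer (actDeriv d n G x) b V := fun u hu => hV u (Subtype.ext hu)
    have hem : chartAt (Euc n) x ∈ IsManifold.maximalAtlas (𝓡 n) ∞ N := chartAt_mem_maximalAtlas x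
    -- The squared length of the field of `V` is at most `b V V` everywhere and equals it at `x`, so
    -- `x` is a maximum.
    have h1 := leviCivitaFun_actDeriv hg (x := x) (V := V) fun y =>
      (hle y V).trans (heq x V hV').ge
    have h2 := tderiv_leviCivitaFun (G := G) (g := g) hf hinv (x := x)
      (Y := fun y => actDeriv d n G y V)
      (((contDiffAt_coordAct d G hem (mem_chart_target _ x)).clm_apply
        contDiffAt_const).differentiableAt (by simp)) (fun y _ => (hker y _).2 ⟨V, rfl⟩) V
    rw [h1, map_zero, hVv] at h2
    exact h2.symm
  -- Polarization of the vanishing diagonal.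
  have hall : ∀ (x : N) (v w : Euc n), tderiv (Euc n) (Euc k) f x v = 0 →
      tderiv (Euc n) (Euc k) f x w = 0 → fiberForm k g f x v w = 0 := by
    intro x v w hv hw
    have h := hdiag x (v + w) (by rw [map_add, hv, hw, add_zero])
    rw [fiberForm_add_left, fiberForm_symm hf x v (v + w), fiberForm_symm hf x w (v + w),
      fiberForm_add_left, fiberForm_add_left, hdiag x v hv, hdiag x w hw, zero_add, add_zero,
      fiberForm_symm hf x w v, ← two_smul ℝ, smul_eq_zero] at h
    exact h.resolve_left two_ne_zero
  refine ⟨leviCivita g, isLeviCivita_leviCivita g, ?_⟩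
  rintro _ Y hY hY0 x rfl v hv
  obtain ⟨V, hV⟩ := (hker x v).1 hv
  have h := tderiv_leviCivitaFun (G := G) (g := g) hf hinv (x := x) (Y := Y)
    ((mdifferentiableAt_field_iff Y x).1 (hY.mdifferentiableAt (by simp))) hY0 V
  rw [hV] at h
  exact h.trans (hall x v (Y x) hv (hY0 x rfl))

end TotallyGeodesic

end

noncomputable section

/-! ### The Riemannian submersion onto the orbit space -/

section OrbitFibration

variable {d n : ℕ} {G : Type*} [TopologicalSpace G] [ChartedSpace (Euc d) G] [Group G]
  [LieGroup (𝓡 d) ∞ G]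
  {N : Type*} [TopologicalSpace N] [ChartedSpace (Euc n) N] [IsManifold (𝓡 n) ∞ N]
  [MulAction G N] [ContMDiffSMul (𝓡 d) (𝓡 n) ∞ G N]
  {B : Type*} [TopologicalSpace B] {f : N → B}

/-- Invariance of `f` puts the tangent space of the orbit into the kernel, and `r + k = n` makes the
dimensions equal. -/
lemma tderiv_eq_zero_iff_of_orbits {r k : ℕ} [ChartedSpace (Euc k) B] {x : N}
    (hr : orbitRank d n G x = r) (hk : r + k = n) (hinv : ∀ (a : G) (x : N), f (a • x) = f x)
    (hf : MDifferentiableAt (𝓡 n) (𝓡 k) f x)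
    (hsub : Function.Surjective (tderiv (Euc n) (Euc k) f x)) (v : Euc n) :
    tderiv (Euc n) (Euc k) f x v = 0 ↔ ∃ V, actDeriv d n G x V = v := by
  have hle : LinearMap.range (actDeriv d n G x).toLinearMap ≤
      LinearMap.ker (tderiv (Euc n) (Euc k) f x).toLinearMap := by
    rintro _ ⟨V, rfl⟩
    have hf' : MDifferentiableAt (𝓡 n) (𝓡 k) f ((1 : G) • x) := by rwa [one_smul]
    have h := tderiv_comp_apply (g := f) (f := fun a : G => a • x) hf'
      (mdifferentiableAt_orbitMap (d := d) x (1 : G)) V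
    simp only [hinv, tderiv_const, one_smul] at h
    exact h.symm
  have h1 := LinearMap.finrank_range_add_finrank_ker (tderiv (Euc n) (Euc k) f x).toLinearMap
  rw [LinearMap.range_eq_top.2 hsub, finrank_top, finrank_euclideanSpace_fin,
    finrank_euclideanSpace_fin] at h1
  have h2 := Submodule.eq_of_le_of_finrank_eq hle (by
    unfold orbitRank at hr
    omega)
  exact (SetLike.ext_iff.1 h2 v).symm

/-- The orbit space of an isometric action with only principal orbits, all of them normal
homogeneous. -/
theorem exists_orbitFibration [CompactSpace G] [T2Space N] {r k : ℕ}
    (hr : ∀ x : N, orbitRank d n G x = r) (hk : r + k = n)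
    (hreg : ∀ x : N, x ∈ regularPart G N) (hf : IsOpenQuotientMap f)
    (hfib : ∀ x y, f x = f y ↔ ∃ a : G, a • x = y)
    {g : SmoothMetric n N} {b : Euc d →L[ℝ] Euc d →L[ℝ] ℝ} (hb : IsInner b)
    (hg : ∀ (a : G) (x : N) (u v : Euc n),
      g.toForm (a • x) (transDeriv n a x u) (transDeriv n a x v) = g.toForm x u v)
    (hle : ∀ (x : N) (V : Euc d), g.toForm x (actDeriv d n G x V) (actDeriv d n G x V) ≤ b V V)
    (heq : ∀ (x : N) (V : Euc d), OrthKer (actDeriv d n G x) b V →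
      g.toForm x (actDeriv d n G x V) (actDeriv d n G x V) = b V V) :
    ∃ (_ : ChartedSpace (Euc k) B) (_ : IsManifold (𝓡 k) ∞ B) (gB : SmoothMetric k B),
      IsRiemannianSubmersion (𝓡 n) (𝓡 k) f g.form gB.form ∧
      HasTotallyGeodesicFibers (k := k) g f ∧
      ∀ (x : N) (v : Euc n), tderiv (Euc n) (Euc k) f x v = 0 ↔ ∃ V, actDeriv d n G x V = v := by
  obtain ⟨cs, hm, hfs, hsub, hsec⟩ := exists_orbitManifold hr hk hreg hf hfib
  have hinv : ∀ (a : G) (x : N), f (a • x) = f x := fun a x => ((hfib x (a • x)).2 ⟨a, rfl⟩).symm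
  have hker : ∀ (x : N) (v : Euc n),
      tderiv (Euc n) (Euc k) f x v = 0 ↔ ∃ V, actDeriv d n G x V = v := fun x =>
    tderiv_eq_zero_iff_of_orbits (hr x) hk hinv (hfs.mdifferentiableAt (by simp)) (hsub x)
  -- Translation by `a` is an isometry intertwining the differentials of `f` at `x` and `a • x`, so
  -- the quotient forms along an orbit agree.
  obtain ⟨gB, hgB⟩ := exists_quotientMetric g hfs hf.surjective hsub (fun x y hxy => by
    obtain ⟨a, rfl⟩ := (hfib x y).1 hxy
    ext u v
    refine (IsQuotForm.eq (g.isInner_toForm x) (hsub x) (h := fun u v =>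
      quotForm (tderiv (Euc n) (Euc k) f (a • x)) (g.toForm (a • x)) u v) ?_ u v).symm
    refine (isQuotForm_quotForm (g.isInner_toForm (a • x)) (hsub (a • x))).of_intertwine
      (transDeriv n a x) (ContinuousLinearMap.id ℝ _) (bijective_transDeriv d a x).2
      Function.injective_id (fun w => ?_) (hg a x)
    have h := tderiv_comp_apply (g := f) (f := fun y : N => a • y) (a := x)
      (hfs.mdifferentiableAt (by simp)) (mdifferentiableAt_translate d G a x) w
    simp only [hinv] at h
    exact h.symm) hsec
  exact ⟨cs, hm, gB, hgB, hasTotallyGeodesicFibers hb hfs hinv hker hg hle heq, hker⟩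

end OrbitFibration

/-! ### Restriction of the action to an invariant open set -/

section OpenAction

variable {d n : ℕ} {G : Type*} [TopologicalSpace G] [ChartedSpace (Euc d) G] [Group G]
  {M : Type*} [TopologicalSpace M] [ChartedSpace (Euc n) M]
  [MulAction G M] {U : Opens M}

/-- The action on an invariant open set. -/
abbrev openMulAction (U : Opens M) (hU : ∀ (a : G), ∀ x ∈ U, a • x ∈ U) : MulAction G U where
  smul a x := openTranslate U hU a x
  one_smul x := Subtype.ext (one_smul G (x : M))
  mul_smul a b x := Subtype.ext (mul_smul a b (x : M))

variable (hU : ∀ (a : G), ∀ x ∈ U, a • x ∈ U)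

lemma contMDiffSMul_openMulAction [ContMDiffSMul (𝓡 d) (𝓡 n) ∞ G M] :
    letI := openMulAction U hU
    ContMDiffSMul (𝓡 d) (𝓡 n) ∞ G U := by
  let := openMulAction U hU
  refine ⟨(ContMDiff.subtypeVal_comp_iff (I' := 𝓡 n) U (fun p : G × U => p.1 • p.2)).1 ?_⟩
  exact contMDiff_fst.smul (contMDiff_subtype_val.comp contMDiff_snd)

/-- Isotropy groups are the same in `U` as in `M`, and the condition is tested against fewer points.
-/
lemma mem_regularPart_openMulAction {x : U} (hx : (x : M) ∈ regularPart G M) :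
    letI := openMulAction U hU
    x ∈ regularPart G U := by
  let := openMulAction U hU
  have hs : ∀ y : U, MulAction.stabilizer G y = MulAction.stabilizer G (y : M) := fun y => by
    ext a
    exact Subtype.ext_iff
  intro y
  rw [hs, hs]
  exact hx y

lemma orbitMk_eq_iff (x y : U) :
    letI := openMulAction U hU
    orbitMk G U x = orbitMk G U y ↔ ∃ a : G, a • x = y := by
  let := openMulAction U hU
  refine Quotient.eq.trans ?_
  change (x : M) ∈ MulAction.orbit G (y : M) ↔ _
  rw [← MulAction.mem_orbit_symm]
  exact exists_congr fun a => (Subtype.ext_iff (a1 := a • x) (a2 := y)).symm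

include hU in
-- The saturation of an open set is the union of its translates, each of which is open.
lemma isOpenQuotientMap_orbitMk [ContinuousConstSMul G M] : IsOpenQuotientMap (orbitMk G U) := by
  refine ⟨Quot.mk_surjective, continuous_quot_mk, fun V hV => ?_⟩
  let := openMulAction U hU
  have hc : ContinuousConstSMul G U := ⟨fun a =>
    ((continuous_const_smul a).comp continuous_subtype_val).subtype_mk _⟩
  have h : orbitMk G U ⁻¹' (orbitMk G U '' V) = ⋃ a : G, (fun x : U => a • x) '' V := by
    ext y
    simp only [mem_preimage, mem_image, mem_iUnion, orbitMk_eq_iff hU]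
    exact ⟨fun ⟨x, hx, a, ha⟩ => ⟨a, x, hx, ha⟩, fun ⟨a, x, hx, ha⟩ => ⟨x, hx, a, ha⟩⟩
  refine isOpen_coinduced.2 ?_
  change IsOpen (orbitMk G U ⁻¹' (orbitMk G U '' V))
  rw [h]
  exact isOpen_iUnion fun a => isOpenMap_smul a V hV

variable [IsManifold (𝓡 n) ∞ M]

lemma tderiv_coe_comp {E' A : Type*} [NormedAddCommGroup E'] [NormedSpace ℝ E'] [TopologicalSpace A]
    [ChartedSpace E' A] {φ : A → U} {a : A} (h : MDifferentiableAt 𝓘(ℝ, E') (𝓡 n) φ a) :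
    tderiv E' (Euc n) (fun z => (φ z : M)) a = tderiv E' (Euc n) φ a := by
  have h2 : MDifferentiableAt (𝓡 n) (𝓡 n) (Subtype.val : U → M) (φ a) :=
    (contMDiff_subtype_val (n := ∞)).mdifferentiableAt (by simp)
  rw [tderiv_comp (g := (Subtype.val : U → M)) (f := φ) h2 h, tderiv_subtype_val]
  rfl

variable [ContMDiffSMul (𝓡 d) (𝓡 n) ∞ G M]

lemma actDeriv_openMulAction (x : U) :
    letI := openMulAction U hU
    actDeriv d n G x = actDeriv d n G (x : M) := by
  let := openMulAction U hU
  have := contMDiffSMul_openMulAction (d := d) (n := n) hU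
  exact (tderiv_coe_comp (mdifferentiableAt_orbitMap (d := d) x (1 : G))).symm

include d in
lemma transDeriv_openMulAction (a : G) (x : U) :
    letI := openMulAction U hU
    transDeriv n a x = transDeriv n a (x : M) := by
  let := openMulAction U hU
  have := contMDiffSMul_openMulAction (d := d) (n := n) hU
  refine (tderiv_coe_comp (mdifferentiableAt_translate d G a x)).symm.trans ?_
  have h2 : MDifferentiableAt (𝓡 n) (𝓡 n) (Subtype.val : U → M) x :=
    (contMDiff_subtype_val (n := ∞)).mdifferentiableAt (by simp)
  refine (tderiv_comp (g := fun y : M => a • y) (f := (Subtype.val : U → M))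
    (mdifferentiableAt_translate d G a (x : M)) h2).trans ?_
  rw [tderiv_subtype_val]
  rfl

end OpenAction

/-! ### Invariance and normal homogeneity of the limit metric -/

section LimitMetric

variable {d n : ℕ} {G : Type*} [TopologicalSpace G] [ChartedSpace (Euc d) G] [Group G]
  [LieGroup (𝓡 d) ∞ G]
  {M : Type*} [TopologicalSpace M] [ChartedSpace (Euc n) M] [IsManifold (𝓡 n) ∞ M]
  [MulAction G M] [ContMDiffSMul (𝓡 d) (𝓡 n) ∞ G M]
  {U : Opens M} (hU : ∀ (a : G), ∀ x ∈ U, a • x ∈ U)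
  {gbi : SmoothMetric d G} (hbi : IsBiInvariant gbi.form) {gM : SmoothMetric n M}
  (hr : (U : Set M) ⊆ regularPart G M)

include hbi in
lemma limitMetric_transDeriv
    (hisom : ∀ a : G, pullbackForm (𝓡 n) (𝓡 n) (fun x : M => a • x) gM.form = gM.form)
    (a : G) (x : U) (u v : Euc n) :
    letI := openMulAction U hU
    (limitMetric gbi gM hr).toForm (a • x) (transDeriv n a x u) (transDeriv n a x v) =
      (limitMetric gbi gM hr).toForm x u v := by
  let := openMulAction U hU
  rw [transDeriv_openMulAction (d := d) hU]
  exact tildeAt_transDeriv hbi (hisom a) 0 (x : M) u v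

include hbi in
/-- The orbits are normal homogeneous for the limit metric. -/
lemma hasNormalHomogeneousFibers_limitMetric {k : ℕ} {B : Type*} [TopologicalSpace B]
    [ChartedSpace (Euc k) B] {f : U → B}
    (hfib : ∀ x y : U, f x = f y ↔ ∃ a : G, openTranslate U hU a x = y)
    (hker : ∀ (x : U) (v : Euc n), tderiv (Euc n) (Euc k) f x v = 0 ↔
      ∃ V, actDeriv d n G (x : M) V = v) :
    HasNormalHomogeneousFibers (k := k) U hU gbi.form (limitMetric gbi gM hr).form f := by
  let := openMulAction U hU
  have := contMDiffSMul_openMulAction (d := d) (n := n) hU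
  intro x φ
  have hφ : ∀ a, tderiv (Euc d) (Euc n) φ a =
      actDeriv d n G (φ a : M) ∘L rightDeriv d a := fun a => by
    rw [← actDeriv_openMulAction hU]
    exact tderiv_orbitMap (d := d) (n := n) x a
  refine ⟨?_, contMDiff_orbitMap (d := d) x, fun a => ⟨fun u => ?_, fun v w hv hw => ?_⟩⟩
  · ext y
    exact (hfib x y).symm.trans eq_comm
  · refine (hker (φ a) u).trans ?_
    constructor
    · rintro ⟨V, hV⟩
      obtain ⟨v, rfl⟩ := surjective_rightDeriv a V
      exact ⟨v, (congrArg (fun T : Euc d →L[ℝ] Euc n => T v) (hφ a)).trans hV⟩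
    · rintro ⟨v, hv⟩
      exact ⟨_, (congrArg (fun T : Euc d →L[ℝ] Euc n => T v) (hφ a)).symm.trans hv⟩
  -- Right translation by `a⁻¹` is an isometry to the tangent space at `1` and carries the kernel of
  -- the orbit map at `a` to that of `actDeriv` at `φ a`.
  · have key : ∀ v : Euc d, IsHorizontal (𝓡 d) (𝓡 n) φ gbi.form a v →
        OrthKer (actDeriv d n G (φ a : M)) (gbi.toForm 1) (rightDeriv d a v) := by
      intro v hv u hu
      obtain ⟨w, rfl⟩ := surjective_rightDeriv a u
      rw [hbi.rightDeriv]
      exact hv w ((congrArg (fun T : Euc d →L[ℝ] Euc n => T w) (hφ a)).trans hu)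
    have h := tildeForm_zero_apply (gbi.isInner_toForm 1) (gM.isInner_toForm (φ a : M)) (key v hv)
      (key w hw)
    refine Eq.trans ?_ (h.trans (hbi.rightDeriv a v w))
    change tildeAt gbi gM 0 (φ a : M) (tderiv (Euc d) (Euc n) φ a v)
      (tderiv (Euc d) (Euc n) φ a w) = _
    rw [hφ]
    rfl

include hr in
/-- On a set of regular points the orbits have the same dimension. -/
lemma exists_orbitRank_eq :
    ∃ r k : ℕ, r + k = n ∧ ∀ x ∈ U, orbitRank d n G x = r := by
  by_cases h : (U : Set M).Nonempty
  · obtain ⟨x, hx⟩ := h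
    have h1 : orbitRank d n G x ≤ n := by
      refine (Submodule.finrank_le _).trans ?_
      rw [finrank_euclideanSpace_fin]
    refine ⟨orbitRank d n G x, n - orbitRank d n G x, by omega, fun y hy => ?_⟩
    exact le_antisymm (orbitRank_le_of_mem_regularPart (hr hx) y)
      (orbitRank_le_of_mem_regularPart (hr hy) x)
  -- For empty `U` any decomposition of `n` will do.
  · exact ⟨0, n, zero_add n, fun x hx => (h ⟨x, hx⟩).elim⟩

end LimitMetric

end

/-! ### The theorem -/

theorem theoremA {d n : ℕ}
    {G : Type*} [TopologicalSpace G] [ChartedSpace (EuclideanSpace ℝ (Fin d)) G] [Group G]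
    [LieGroup (𝓡 d) ∞ G] [CompactSpace G] [T2Space G]
    {M : Type*} [TopologicalSpace M] [ChartedSpace (EuclideanSpace ℝ (Fin n)) M]
    [IsManifold (𝓡 n) ∞ M] [T2Space M] [SecondCountableTopology M]
    [MulAction G M] [ContMDiffSMul (𝓡 d) (𝓡 n) ∞ G M]
    (gbi : SmoothMetric d G) (hbi : IsBiInvariant gbi.form)
    (gM : SmoothMetric n M) (hcomplete : IsCompleteMetric gM)
    (hisom : ∀ a : G, pullbackForm (𝓡 n) (𝓡 n) (fun x : M => a • x) gM.form = gM.form) :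
    (∀ l : ℝ, 0 < l → ∃! gl : SmoothMetric n M, IsCheegerDeformation gbi.form gM.form l gl.form) ∧
    ∀ gl : ℝ → SmoothMetric n M,
      (∀ l : ℝ, 0 < l → IsCheegerDeformation gbi.form gM.form l (gl l).form) →
    ∀ (U : Opens M) (hU : ∀ (a : G), ∀ x ∈ U, a • x ∈ U),
      IsCompact (closure (U : Set M)) → closure (U : Set M) ⊆ regularPart G M →
    ∃ gt : SmoothMetric n U,
      (∀ l : ℝ, 0 < l → IsSmoothForm (rescaledOn d G gM (gl l) U l)) ∧
      (∀ (p : ℕ) (𝒜 : FiniteAtlas (n := n) U),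
        Tendsto (fun l : ℝ => cpNorm 𝒜 p (rescaledOn d G gM (gl l) U l - gt.form)) (𝓝[>] 0) (𝓝 0) ∧
        ∃ C : ℝ, ∃ l₀ : ℝ, 0 < l₀ ∧ ∀ l : ℝ, 0 < l → l < l₀ →
          cpNorm 𝒜 p (rescaledOn d G gM (gl l) U l - gt.form) ≤ ENNReal.ofReal (C * l ^ 2)) ∧
      (∀ a : G, pullbackForm (𝓡 n) (𝓡 n) (openTranslate U hU a) gt.form = gt.form) ∧
      T2Space (OrbitSpace G U) ∧ SecondCountableTopology (OrbitSpace G U) ∧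
      ∃ (k : ℕ) (_ : ChartedSpace (EuclideanSpace ℝ (Fin k)) (OrbitSpace G U))
        (_ : IsManifold (𝓡 k) ∞ (OrbitSpace G U)) (gB : SmoothMetric k (OrbitSpace G U)),
        IsRiemannianSubmersion (𝓡 n) (𝓡 k) (orbitMk G U) gt.form gB.form ∧
        HasTotallyGeodesicFibers (k := k) gt (orbitMk G U) ∧
        HasNormalHomogeneousFibers (k := k) U hU gbi.form gt.form (orbitMk G U) := by
  refine ⟨fun l hl => existsUnique_isCheegerDeformation hbi hisom hl, ?_⟩
  intro gl hgl U hU _ hr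
  have hrU : (U : Set M) ⊆ regularPart G M := subset_closure.trans hr
  let := openMulAction U hU
  have hs : ContMDiffSMul (𝓡 d) (𝓡 n) ∞ G U := contMDiffSMul_openMulAction hU
  have htg : IsTopologicalGroup G := topologicalGroup_of_lieGroup (𝓡 d) ∞
  have hcs : ContinuousSMul G M := ContMDiffSMul.continuousSMul (I := 𝓡 d) (I' := 𝓡 n) ∞
  have hcsU : ContinuousSMul G U := ContMDiffSMul.continuousSMul (I := 𝓡 d) (I' := 𝓡 n) ∞
  have hq : IsOpenQuotientMap (orbitMk G U) := isOpenQuotientMap_orbitMk hU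
  have hfib : ∀ x y : U, orbitMk G U x = orbitMk G U y ↔ ∃ a : G, a • x = y := orbitMk_eq_iff hU
  have hinv := limitMetric_transDeriv hU hbi hrU hisom
  obtain ⟨r, k, hk, hrank⟩ := exists_orbitRank_eq (d := d) (n := n) hrU
  obtain ⟨cs, hm, gB, hsub, htot, hker⟩ := exists_orbitFibration (d := d) (G := G) (r := r) (k := k)
    (b := gbi.toForm 1) (g := limitMetric gbi gM hrU)
    (fun x => by
      unfold orbitRank
      rw [actDeriv_openMulAction hU]
      exact hrank x x.2)
    hk (fun x => mem_regularPart_openMulAction hU (hrU x.2)) hq hfib (gbi.isInner_toForm 1) hinv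
    -- The two facts about the limit metric behind total geodesy: the upper bound on lengths of
    -- action fields, and equality on vectors orthogonal to the infinitesimal isotropy.
    (fun x V => by
      rw [actDeriv_openMulAction hU]
      exact tildeForm_zero_apply_le (gbi.isInner_toForm 1) (gM.isInner_toForm (x : M)) V)
    (fun x V hV => by
      rw [actDeriv_openMulAction hU] at hV ⊢
      exact tildeForm_zero_apply (gbi.isInner_toForm 1) (gM.isInner_toForm (x : M)) hV hV)
  refine ⟨limitMetric gbi gM hrU, fun l hl => isSmoothForm_rescaledOn hbi hisom hrU hl (hgl l hl),
    fun p 𝒜 => tendsto_cpNorm_rescaledOn hbi hisom hgl hr p 𝒜,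
    fun a => funext fun x => funext fun u => funext fun v => hinv a x u v,
    hq.t2Space_of_orbits hfib, hq.isQuotientMap.secondCountableTopology hq.isOpenMap,
    k, cs, hm, gB, hsub, htot, ?_⟩
  refine hasNormalHomogeneousFibers_limitMetric hU hbi hrU hfib fun x v => ?_
  rw [← actDeriv_openMulAction hU]
  exact hker x v
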